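/- **Setting.** For spinors $w,z\in\mathbb C^2$ put $\langle w|z\rangle=\bar w^0z^0+\bar w^1z^1$, $|z]=(-\bar z^1,\bar z^0)$, $[w|z\rangle=w^0z^1-w^1z^0$, $\langle w|z]=-\bar w^0\bar z^1+\bar w^1\bar z^0$, and let $d\mu(z)=\pi^{-2}e^{-\langle z|z\rangle}\,dz^0dz^1$ be the Gaussian probability measure on $\mathbb C^2$ (Lebesgue measure on each factor). Let the boundary $\partial\triangle$ of a 3-cell consist of finitely many triangles whose sides, cyclically ordered in each triangle, are glued in pairs. Its dual graph $\Gamma$ is three-valent: nodes are triangles, half-links are sides, links are glued pairs of sides; every link $l$ is oriented from $s(l)$ to $t(l)$. For one spinor $z_h$ on each half-link $h$, the scaleless spin network state is $$\mathcal S_\Gamma(z)=\int\prod_h d\mu(\xi_h)\;\exp\Big(\sum_l\langle\xi_{s(l)}|\xi_{t(l)}]+\sum_{n}X_n(z,\xi)\Big),\qquad X_n=\sum_{\alpha\in n}[z_{s(\alpha)}|z_{t(\alpha)}\rangle[\xi_{s(\alpha)}|\xi_{t(\alpha)}\rangle ,$$ where $\alpha$ runs over the three angles (pairs of cyclically consecutive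 half-links) of the node $n$. For $k$ assigning to each node $n$ a total spin $k_n\in\mathbb N$, let $\mathcal S_{\Gamma,k}(z)=\int\prod_h d\mu(\xi_h)\,e^{\sum_l\langle\xi_{s(l)}|\xi_{t(l)}]}\prod_nX_n^{k_n}/k_n!$, the part of $\mathcal S_\Gamma$ that is homogeneous of degree $2k_n$ in the spinors of each node $n$. **Gluing of Type II.** Let $t_1\ne t_2$ be triangles of $\partial\triangle$ sharing exactly one edge $e$, the other four sides of $t_1,t_2$ being glued to triangles other than $t_1,t_2$. Fold $t_1$ onto $t_2$ along $e$. This identifies the remaining sides in two pairs, makes $e$ internal, and yields a 3-cell with boundary $\partial\triangle'$, whose dual graph $\Gamma'$ arises by deleting the nodes $t_1,t_2$ and the link dual to $e$ and joining the four remaining cut links in two pairs. If all links are outgoing at one of the two nodes and incoming at the other, all links of $\Gamma'$ inherit their orientation; each reversal of a link involved (the one dual to $e$, or one of the two links joined) reverses the merged link. Let $x_1,x_2,x_3$ and $y_1,y_2,y_3$ be the spinors at the sides of $t_1$ and of $t_2$, sides that are identified having the same index, with $e$ of index $1$; let $z'$ be the other spinors. Let $$\mathcal A_{e^*}={}_0F_3\Big(;2,2,\tfrac12;\tfrac14\big(\textstyle\sum_{l=1}^3\langle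 x_l|y_l]\big)^2\Big),\qquad \mathcal A_{f^*}=\langle x_1|x_1\rangle-1 .$$ **Proposition 4.** For all $z'$ in a neighbourhood of $0$, $$\mathcal S_{\Gamma'}(z')=\int\prod_{l=1}^3d\mu(x_l)\,d\mu(y_l)\;\mathcal S_\Gamma(x,y,z')\,\mathcal A_{e^*}\,\mathcal A_{f^*},$$ where the integral is taken term by term in the expansion of $\mathcal S_\Gamma$ by total spins at the nodes. Precisely: 1. For $z$ near $0$ the integral defining $\mathcal S_\Gamma(z)$ converges absolutely and $\mathcal S_\Gamma(z)=\sum_k\mathcal S_{\Gamma,k}(z)$ (unconditionally summable). 2. For every $k$ and every $z'$, the function $\mathcal S_{\Gamma,k}(x,y,z')\,\mathcal A_{e^*}\,\mathcal A_{f^*}$ is integrable with respect to $\prod_l d\mu(x_l)d\mu(y_l)$. 3. For $z'$ near $0$ the integral defining $\mathcal S_{\Gamma'}(z')$ converges absolutely and, unconditionally summable, $$\sum_k\int\prod_{l=1}^3d\mu(x_l)\,d\mu(y_l)\;\mathcal S_{\Gamma,k}(x,y,z')\,\mathcal A_{e^*}\,\mathcal A_{f^*}=\mathcal S_{\Gamma'}(z').$$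 Moreover $\delta(g)=\int d\mu(z)\,(\langle z|z\rangle-1)\,e^{\langle z|g|z\rangle}$ on $\mathrm{SU}(2)$ in the following sense: for $g\ne\mathbb I$ the integral converges absolutely and equals $0$; and for every continuous $f:\mathrm{SU}(2)\to\mathbb C$, with $dg$ the normalized Haar measure, $$\lim_{r\to1^-}\int_{\mathrm{SU}(2)}dg\,f(g)\int d\mu(z)\,(\langle z|z\rangle-1)\,e^{r\langle z|g|z\rangle}=f(\mathbb I).$$ -/

import Mathlib

open MeasureTheory Filter Topology

noncomputable section

namespace SpinNet

/-! ### Spinors -/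

/-- A spinor `|z⟩ = (z⁰, z¹) ∈ ℂ²`. -/
abbrev Spinor := Fin 2 → ℂ

/-- `⟨w|z⟩`. -/
def braket (w z : Spinor) : ℂ := star (w 0) * z 0 + star (w 1) * z 1

/-- The dual spinor `|z] = (-z̄¹, z̄⁰)`. -/
def dual (z : Spinor) : Spinor := ![-star (z 1), star (z 0)]

/-- `[w|z⟩ = w⁰ z¹ - w¹ z⁰`, holomorphic in both spinors. -/
def holBraket (w z : Spinor) : ℂ := braket (dual w) z

/-- `⟨w|z]`, anti-holomorphic in both spinors. -/
def antiBraket (w z : Spinor) : ℂ := braket w (dual z)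

/-- The Gaussian probability measure `dμ(z) = π⁻² e^{-⟨z|z⟩} dz⁰ dz¹` on `ℂ²`. -/
def spinorMeasure : Measure Spinor :=
  volume.withDensity fun z =>
    ENNReal.ofReal (Real.exp (-(‖z 0‖ ^ 2 + ‖z 1‖ ^ 2)) / Real.pi ^ 2)

/-- The product Gaussian measure for the three spinors of one triangle. -/
def triangleMeasure : Measure (Fin 3 → Spinor) := Measure.pi fun _ => spinorMeasure

/-! ### Closed triangulated boundaries and their dual three-valent graphs -/

/-- The boundary of a 3-cell, made up of finitely many triangles `t : T` whose sides are labelled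
in cyclic order by `Fin 3` and glued in pairs by `adj`. The dual graph has the triangles as its
nodes; the sides `(t, i)` are its half-links and the pairs `{h, adj h}` its links. A link is
oriented: the half-link `h` with `out h = true` is at the source, the other at the target. -/
structure CellBoundary (T : Type*) where
  adj : T × Fin 3 → T × Fin 3
  adj_adj : ∀ h, adj (adj h) = h
  out : T × Fin 3 → Bool
  out_adj : ∀ h, out (adj h) = !out h

/-! ### The scaleless spin network state -/

section State

variable {T : Type*} [Fintype T]

/-- The link term `∑_l ⟨ξ_{s(l)}|ξ_{t(l)}]`. -/
def linkTerm (Γ : CellBoundary T) (ξ : T → Fin 3 → Spinor) : ℂ :=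
  ∑ h : T × Fin 3, if Γ.out h then antiBraket (ξ h.1 h.2) (ξ (Γ.adj h).1 (Γ.adj h).2) else 0

/-- The angle term of one node: `∑_α [z_{s(α)}|z_{t(α)}⟩ [ξ_{s(α)}|ξ_{t(α)}⟩` over the three
angles of a triangle. -/
def angleTerm (z ξ : Fin 3 → Spinor) : ℂ :=
  ∑ i : Fin 3, holBraket (z i) (z (i + 1)) * holBraket (ξ i) (ξ (i + 1))

/-- The Gaussian measure for one auxiliary spinor on each half-link. -/
def auxMeasure (T : Type*) [Fintype T] : Measure (T → Fin 3 → Spinor) :=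
  Measure.pi fun _ => triangleMeasure

/-- The integrand of the scaleless spin network state. -/
def stateIntegrand (Γ : CellBoundary T) (z ξ : T → Fin 3 → Spinor) : ℂ :=
  Complex.exp (linkTerm Γ ξ + ∑ t, angleTerm (z t) (ξ t))

/-- The scaleless spin network state (evaluated on the identity) as a function of one spinor on
each half-link. -/
def state (Γ : CellBoundary T) (z : T → Fin 3 → Spinor) : ℂ :=
  ∫ ξ, stateIntegrand Γ z ξ ∂auxMeasure T

/-- The component of the scaleless spin network state with total spin `J_t = k t` at each node
`t`: the part that is homogeneous of degree `2 k t` in the three spinors of the node `t`. -/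
def component (Γ : CellBoundary T) (k : T → ℕ) (z : T → Fin 3 → Spinor) : ℂ :=
  ∫ ξ, Complex.exp (linkTerm Γ ξ) *
    ∏ t, angleTerm (z t) (ξ t) ^ k t / ((k t).factorial : ℂ) ∂auxMeasure T

end State

/-! ### Edge and face amplitudes -/

/-- The generalized hypergeometric function
`₀F₃(; a, b, c; y) = ∑ₖ yᵏ / ((a)ₖ (b)ₖ (c)ₖ k!)`. -/
def hypergeometric03 (a b c y : ℂ) : ℂ :=
  ∑' k : ℕ, y ^ k / ((ascPochhammer ℂ k).eval a * (ascPochhammer ℂ k).eval b *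
    (ascPochhammer ℂ k).eval c * (k.factorial : ℂ))

/-- The face amplitude `⟨z|z⟩ - 1`. -/
def faceAmplitude (z : Spinor) : ℂ := braket z z - 1

/-! ### Gluing two triangles that share one edge -/

/-- Data for a gluing of Type II: two distinct triangles `t₁`, `t₂` that share exactly one edge,
which is the side `i₁` of `t₁` and the side `i₂` of `t₂`; each of their four other sides is
shared with a triangle different from both. -/
structure TypeII {T : Type*} (Γ : CellBoundary T) where
  t₁ : T
  t₂ : T
  ne : t₁ ≠ t₂
  i₁ : Fin 3
  i₂ : Fin 3
  shared : Γ.adj (t₁, i₁) = (t₂, i₂)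
  far₁ : ∀ i, i ≠ i₁ → (Γ.adj (t₁, i)).1 ≠ t₁ ∧ (Γ.adj (t₁, i)).1 ≠ t₂
  far₂ : ∀ i, i ≠ i₂ → (Γ.adj (t₂, i)).1 ≠ t₁ ∧ (Γ.adj (t₂, i)).1 ≠ t₂

namespace TypeII

theorem shared' {T : Type*} {Γ : CellBoundary T} (g : TypeII Γ) :
    Γ.adj (g.t₂, g.i₂) = (g.t₁, g.i₁) := by
  rw [← g.shared, Γ.adj_adj]

variable {T : Type*} [DecidableEq T] {Γ : CellBoundary T} (g : TypeII Γ)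

/-- The triangles that remain on the boundary after the gluing. -/
abbrev Rest : Type _ := {t : T // t ≠ g.t₁ ∧ t ≠ g.t₂}

/-- Folding `t₁` onto `t₂` along the shared edge identifies the side `i₁ + d` of `t₁` with the
side `i₂ - d` of `t₂`. This is the side identified with a given side of `t₁` or `t₂`. -/
def partner (s : T × Fin 3) : T × Fin 3 := (Equiv.swap g.t₁ g.t₂ s.1, g.i₁ + g.i₂ - s.2)

/-- Whether a triangle is one of the two that are glued. -/
def Glued (t : T) : Prop := t = g.t₁ ∨ t = g.t₂

instance (t : T) : Decidable (g.Glued t) := inferInstanceAs (Decidable (t = g.t₁ ∨ t = g.t₂))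

/-- The shared side, seen from `t₁` or from `t₂`. -/
def sharedSide (t : T) : T × Fin 3 := if t = g.t₁ then (g.t₁, g.i₁) else (g.t₂, g.i₂)

/-- The neighbour, after the gluing, of a side of a remaining triangle. If the side was glued to a
side of `t₁` or `t₂`, that side is identified with its partner, and the new neighbour is the side
that was glued to the partner. -/
def newAdj (h : T × Fin 3) : T × Fin 3 :=
  if g.Glued (Γ.adj h).1 then Γ.adj (g.partner (Γ.adj h)) else Γ.adj h

/-- The orientation of the links after the gluing. Untouched links keep their orientation. If all
links are outgoing at one of the two glued nodes and incoming at the other, then the merged links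
keep their orientation, too; every reversal of one of the links involved reverses the merged
link. -/
def newOut (h : T × Fin 3) : Bool :=
  if g.Glued (Γ.adj h).1 then
    xor (Γ.out (g.sharedSide (Γ.adj h).1)) (xor (Γ.out (Γ.adj h)) (Γ.out (g.partner (Γ.adj h))))
  else Γ.out h

theorem partner_partner (s : T × Fin 3) : g.partner (g.partner s) = s := by
  ext <;> simp [partner]

/-- A side of a remaining triangle that is glued to `t₁` or `t₂` gets a remaining neighbour. -/
theorem glued_partner {h : T × Fin 3} (hh : ¬ g.Glued h.1) (hs : g.Glued (Γ.adj h).1) :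
    ¬ g.Glued (Γ.adj (g.partner (Γ.adj h))).1 ∧ g.Glued (g.partner (Γ.adj h)).1 ∧
      g.sharedSide (g.partner (Γ.adj h)).1 = Γ.adj (g.sharedSide (Γ.adj h).1) := by
  obtain ⟨⟨t, i⟩, hti⟩ : ∃ s, s = Γ.adj h := ⟨_, rfl⟩
  have hb : Γ.adj (t, i) = h := by rw [hti, Γ.adj_adj]
  rw [← hti] at hs ⊢
  have e : ∀ a b c : Fin 3, a + b - c = b → c = a := by decide
  have e' : ∀ a b c : Fin 3, a + b - c = a → c = b := by decide
  rcases hs with hs | hs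
  · simp only at hs
    subst hs
    have hi : i ≠ g.i₁ := by
      rintro rfl
      rw [g.shared] at hb
      exact hh (Or.inr (by rw [← hb]))
    have := g.far₂ (g.i₁ + g.i₂ - i) (fun c => hi (e _ _ _ c))
    refine ⟨?_, ?_, ?_⟩
    · simpa [partner, Glued] using this
    · simp [partner, Glued]
    · simp [partner, sharedSide, g.ne.symm, g.shared]
  · simp only at hs
    subst hs
    have hi : i ≠ g.i₂ := by
      rintro rfl
      rw [g.shared'] at hb
      exact hh (Or.inl (by rw [← hb]))
    have := g.far₁ (g.i₁ + g.i₂ - i) (fun c => hi (e' _ _ _ c))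
    refine ⟨?_, ?_, ?_⟩
    · simpa [partner, Glued] using this
    · simp [partner, Glued]
    · simp [partner, sharedSide, g.ne.symm, g.shared']

theorem newAdj_notGlued {h : T × Fin 3} (hh : ¬ g.Glued h.1) : ¬ g.Glued (g.newAdj h).1 := by
  unfold newAdj
  split
  · exact (g.glued_partner hh ‹_›).1
  · assumption

theorem newAdj_newAdj {h : T × Fin 3} (hh : ¬ g.Glued h.1) : g.newAdj (g.newAdj h) = h := by
  by_cases hs : g.Glued (Γ.adj h).1
  · have h2 := (g.glued_partner hh hs).2.1
    simp [newAdj, hs, Γ.adj_adj, h2, partner_partner]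
  · simp [newAdj, hs, Γ.adj_adj, hh]

theorem newOut_newAdj {h : T × Fin 3} (hh : ¬ g.Glued h.1) :
    g.newOut (g.newAdj h) = !g.newOut h := by
  by_cases hs : g.Glued (Γ.adj h).1
  · obtain ⟨-, h2, h3⟩ := g.glued_partner hh hs
    simp only [newAdj, newOut, hs, if_true, Γ.adj_adj, h2, partner_partner, h3, Γ.out_adj]
    cases Γ.out (g.sharedSide (Γ.adj h).1) <;> cases Γ.out (g.partner (Γ.adj h)) <;>
      cases Γ.out h <;> rfl
  · simp [newAdj, newOut, hs, Γ.adj_adj, hh, Γ.out_adj]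

/-- The boundary of the 3-cell after the gluing: `t₁`, `t₂` and their shared edge have become
internal, and the other sides of `t₁` and `t₂` are identified in pairs. -/
def glue : CellBoundary g.Rest where
  adj h := (⟨(g.newAdj (h.1.1, h.2)).1,
    not_or.1 (g.newAdj_notGlued (h := (h.1.1, h.2)) (not_or.2 h.1.2))⟩,
    (g.newAdj (h.1.1, h.2)).2)
  adj_adj h := by
    have := g.newAdj_newAdj (h := (h.1.1, h.2)) (not_or.2 h.1.2)
    exact Prod.ext (Subtype.ext (congrArg Prod.fst this)) (congrArg (fun q : T × Fin 3 => q.2) this)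
  out h := g.newOut (h.1.1, h.2)
  out_adj h := g.newOut_newAdj (h := (h.1.1, h.2)) (not_or.2 h.1.2)

/-- The family on all triangles with the values `a` at `t₁`, `b` at `t₂` and `f` elsewhere. -/
def extend {α : Type*} (a b : α) (f : g.Rest → α) (t : T) : α :=
  if h₁ : t = g.t₁ then a else if h₂ : t = g.t₂ then b else f ⟨t, h₁, h₂⟩

/-- The edge amplitude `₀F₃(; 2, 2, 1/2; (∑_l ⟨x_l|y_l])² / 4)`, where the spinors `x` of `t₁` and
`y` of `t₂` are paired according to the identification of the sides. -/
def edgeAmplitude (x y : Fin 3 → Spinor) : ℂ :=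
  hypergeometric03 2 2 (1 / 2) ((∑ i, antiBraket (x i) (y (g.i₁ + g.i₂ - i))) ^ 2 / 4)

/-- The integrand of the gluing for the component `k` of the state: the component, times the edge
amplitude, times the face amplitude of the shared edge with base node `t₁`. The integration
variable `p` consists of the spinors of `t₁` and of `t₂`, and `z` are the other spinors. -/
def gluingIntegrand [Fintype T] (k : T → ℕ) (z : g.Rest → Fin 3 → Spinor)
    (p : (Fin 3 → Spinor) × (Fin 3 → Spinor)) : ℂ :=
  component Γ k (g.extend p.1 p.2 z) * g.edgeAmplitude p.1 p.2 * faceAmplitude (p.1 g.i₁)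

end TypeII

/-! ### The group `SU(2)` -/

/-- The group `SU(2)`. -/
abbrev SU2 : Type := Matrix.specialUnitaryGroup (Fin 2) ℂ

instance : IsTopologicalGroup SU2 where
  continuous_inv := by
    have h : Continuous fun g : SU2 => star (g : Matrix (Fin 2) (Fin 2) ℂ) :=
      continuous_star.comp continuous_subtype_val
    exact h.subtype_mk _

instance : CompactSpace SU2 := by
  let f : SU2 → Fin 2 → Fin 2 → ℂ := fun g => (g : Matrix (Fin 2) (Fin 2) ℂ)
  have hf : Topology.IsClosedEmbedding f := by
    refine Topology.IsClosedEmbedding.subtypeVal (X := Matrix (Fin 2) (Fin 2) ℂ) ?_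
    have h : {A : Matrix (Fin 2) (Fin 2) ℂ | A ∈ Matrix.specialUnitaryGroup (Fin 2) ℂ} =
        {A | A * star A = 1} ∩ {A | A.det = 1} := by
      ext A
      simp [Matrix.mem_specialUnitaryGroup_iff, Matrix.mem_unitaryGroup_iff]
    rw [h]
    exact (isClosed_eq (by fun_prop) continuous_const).inter
      (isClosed_eq (by fun_prop) continuous_const)
  have hK : IsCompact (Set.pi Set.univ fun _ : Fin 2 => Set.pi Set.univ fun _ : Fin 2 =>
      Metric.closedBall (0 : ℂ) 1) :=
    isCompact_univ_pi fun _ => isCompact_univ_pi fun _ => isCompact_closedBall 0 1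
  refine ⟨?_⟩
  rw [← Set.preimage_univ (f := f)]
  refine (hf.isCompact_preimage hK).of_isClosed_subset isClosed_univ ?_
  intro g _ i _ j _
  simpa using entry_norm_bound_of_unitary (Matrix.mem_specialUnitaryGroup_iff.1 g.2).1 i j

instance : MeasurableSpace SU2 := borel SU2

instance : BorelSpace SU2 := ⟨rfl⟩

/-- The normalized Haar measure on `SU(2)`. -/
def haarSU2 : Measure SU2 := Measure.haarMeasure ⊤

/-- `(⟨z|z⟩ - 1) e^{r ⟨z|g|z⟩}`. -/
def deltaIntegrand (r : ℝ) (g : SU2) (z : Spinor) : ℂ :=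
  (braket z z - 1) * Complex.exp (r * braket z ((g : Matrix (Fin 2) (Fin 2) ℂ).mulVec z))

end SpinNet

end

/-!
The proof computes the integral over the spinors `x`, `y` of the two glued triangles first, and the
integrals over their auxiliary spinors `ξ`, `η` next; what is left is the state of the glued
boundary, expanded in a series over the common total spin `k` of the two triangles.

**Gaussian integrals of entire functions.** The measure has the reproducing property
`∫ F(x) e^{⟨x|w⟩} dμ(x) = F(w)` (`integral_mul_cexp_pairing`): a translation by `w` reduces it to
the mean value property. For homogeneous `F` only the matching term of the exponential series
contributes, and inserting the face amplitude `⟨z|z⟩ - 1` multiplies a function of degree `d` in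
`z` by `d + 1` (`integral_sqNorm_sub_one_mul_cexp`).

**The amplitudes.** Write `X = Y + Q` for the angle term, where `Y` collects the two angles at the
shared side (`hubTerm`) and `Q` is the third one (`rimTerm`). The edge amplitude is
`∑ⱼ s^{2j} / ((j+1)!² (2j)!)`. Its term of degree `2 k` reproduces the kernel `X(y, η)^k / k!` at the
dual of `x`; this kernel is a Gaussian average over a matrix of determinant `⟨z|z⟩`
(`angleTerm_pow_div_factorial`), so the `x`-integral reproduces the other kernel. The result, for
`k₁ = k₂ = k`, is `∑_{d+b=k} (d+1) Y(ξ,η)^d Q(ξ,η)^b / ((k+1)! d! b!)`, and zero for `k₁ ≠ k₂`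
(`integral_amplitudes`).

**Contraction.** The exponential of the links reproduces `ξ` and the two cut spinors of `η`. With
`M = -ε ∑ₗ |uₗ⟩[·|vₗ⟩`, where `u`, `v` are the far ends of the cut links and `ε` is the sign of the
shared link, `Y` becomes `⟨z|M|z⟩` and `Q` becomes `det M`. The remaining integral over
the spinor `z` at the shared side gives the characters `h_d` of the symmetric powers of `M`
(`integral_cexp_cutLinkTerm_mul`). Summed over `k`, these yield the exponential of `tr M`, because
`τ^n / n!` decomposes into characters with ballot numbers as multiplicities (`hasSum_gluedTerm`);
and `tr M` is the sum of the two merged links (`TypeII.linkTerm_glue`). All interchanges are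
justified by domination: the link term is at most half of the squared norms of the auxiliary
spinors, and the characters cost only a little more (`norm_mergedTerm_le`), so the
total exponent stays below that of the Gaussian weight.

**The delta function.** For `u` in `SU(2)` with `tr u = 2 a` the Gaussian integral
`∫ e^{r⟨z|u|z⟩} dμ = 1 / (1 - 2ra + r²)`, taken with a weight of variable width and differentiated,
gives `∫ (⟨z|z⟩ - 1) e^{r⟨z|u|z⟩} dμ = (1 - r²) / (1 - 2ra + r²)²` (`integral_deltaIntegrand`). This
vanishes for `r = 1`, `u ≠ 1`; for `r < 1` it is nonnegative, has total mass `1`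
(`integral_deltaKernel`), and concentrates at the identity.
-/

open MeasureTheory Filter Topology

namespace SpinNet

/-! ### Brackets and norms of spinors -/

/-- The squared Hermitian norm `⟨z|z⟩` as a real number. -/
noncomputable def sqNorm (z : Spinor) : ℝ := ‖z 0‖ ^ 2 + ‖z 1‖ ^ 2

/-- The squared Hermitian norm of a family of spinors. -/
noncomputable def sqNormSum {ι : Type*} [Fintype ι] (x : ι → Spinor) : ℝ := ∑ i, sqNorm (x i)

theorem sqNorm_nonneg (z : Spinor) : 0 ≤ sqNorm z := by unfold sqNorm; positivity

theorem holBraket_apply (w z : Spinor) : holBraket w z = w 0 * z 1 - w 1 * z 0 := by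
  simp [holBraket, braket, dual]; ring

theorem antiBraket_apply (w z : Spinor) :
    antiBraket w z = star (w 1) * star (z 0) - star (w 0) * star (z 1) := by
  simp [antiBraket, braket, dual]; ring

theorem antiBraket_swap (w z : Spinor) : antiBraket z w = -antiBraket w z := by
  simp only [antiBraket_apply]; ring

theorem holBraket_swap (w z : Spinor) : holBraket z w = -holBraket w z := by
  simp only [holBraket_apply]; ring

theorem holBraket_dual_left (w z : Spinor) : holBraket (dual w) z = -braket w z := by
  simp [holBraket_apply, braket, dual]; ring

theorem sqNorm_dual (z : Spinor) : sqNorm (dual z) = sqNorm z := by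
  simp [sqNorm, dual]; ring

theorem braket_self (z : Spinor) : braket z z = (sqNorm z : ℂ) := by
  simp only [braket, sqNorm, Complex.ofReal_add, Complex.ofReal_pow, ← Complex.mul_conj',
    Complex.star_def]
  ring

theorem sqNorm_smul (c : ℂ) (z : Spinor) : sqNorm (c • z) = ‖c‖ ^ 2 * sqNorm z := by
  simp [sqNorm, mul_pow]; ring

/-- Lagrange's identity for the two brackets. -/
theorem norm_braket_sq_add (w z : Spinor) :
    ‖braket w z‖ ^ 2 + ‖holBraket w z‖ ^ 2 = sqNorm w * sqNorm z := by
  have h : ∀ c : ℂ, ((‖c‖ ^ 2 : ℝ) : ℂ) = c * star c := fun c => by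
    rw [Complex.ofReal_pow, ← Complex.mul_conj', Complex.star_def]
  rw [← Complex.ofReal_inj]
  simp only [sqNorm, Complex.ofReal_add, Complex.ofReal_mul, h]
  simp only [holBraket_apply, braket, star_add, star_sub, star_mul', star_star]
  ring

theorem norm_braket_sq_le (w z : Spinor) : ‖braket w z‖ ^ 2 ≤ sqNorm w * sqNorm z := by
  rw [← norm_braket_sq_add]; nlinarith [sq_nonneg ‖holBraket w z‖]

theorem norm_holBraket_sq_le (w z : Spinor) : ‖holBraket w z‖ ^ 2 ≤ sqNorm w * sqNorm z := by
  rw [← norm_braket_sq_add]; nlinarith [sq_nonneg ‖braket w z‖]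

theorem le_half_add_of_sq_le_mul {r a b : ℝ} (ha : 0 ≤ a) (hb : 0 ≤ b) (h : r ^ 2 ≤ a * b) :
    r ≤ (a + b) / 2 :=
  (abs_le.1 (abs_le_of_sq_le_sq (by nlinarith [sq_nonneg (a - b)]) (by positivity))).2

theorem norm_braket_le (w z : Spinor) : ‖braket w z‖ ≤ (sqNorm w + sqNorm z) / 2 :=
  le_half_add_of_sq_le_mul (sqNorm_nonneg _) (sqNorm_nonneg _) (norm_braket_sq_le w z)

theorem norm_antiBraket_le (w z : Spinor) : ‖antiBraket w z‖ ≤ (sqNorm w + sqNorm z) / 2 := by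
  simpa [antiBraket, sqNorm_dual] using norm_braket_le w (dual z)

theorem norm_holBraket_le (w z : Spinor) : ‖holBraket w z‖ ≤ (sqNorm w + sqNorm z) / 2 :=
  le_half_add_of_sq_le_mul (sqNorm_nonneg _) (sqNorm_nonneg _) (norm_holBraket_sq_le w z)

theorem norm_sq_le_sqNorm (z : Spinor) : ‖z‖ ^ 2 ≤ sqNorm z := by
  have h : ‖z‖ ≤ Real.sqrt (sqNorm z) := by
    refine (pi_norm_le_iff_of_nonneg (Real.sqrt_nonneg _)).2 fun i => Real.le_sqrt_of_sq_le ?_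
    fin_cases i <;> simp [sqNorm]
  calc ‖z‖ ^ 2 ≤ Real.sqrt (sqNorm z) ^ 2 := by gcongr
    _ = sqNorm z := Real.sq_sqrt (sqNorm_nonneg z)

theorem sqNorm_le (z : Spinor) : sqNorm z ≤ 2 * ‖z‖ ^ 2 := by
  have h0 := norm_le_pi_norm z 0
  have h1 := norm_le_pi_norm z 1
  unfold sqNorm
  nlinarith [norm_nonneg (z 0), norm_nonneg (z 1), norm_nonneg z]

theorem sqNormSum_nonneg {ι : Type*} [Fintype ι] (x : ι → Spinor) : 0 ≤ sqNormSum x :=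
  Finset.sum_nonneg fun i _ => sqNorm_nonneg (x i)

theorem norm_sq_le_sqNormSum {ι : Type*} [Fintype ι] (x : ι → Spinor) :
    ‖x‖ ^ 2 ≤ sqNormSum x := by
  have h : ‖x‖ ≤ Real.sqrt (sqNormSum x) := by
    refine (pi_norm_le_iff_of_nonneg (Real.sqrt_nonneg _)).2 fun i => Real.le_sqrt_of_sq_le ?_
    exact (norm_sq_le_sqNorm _).trans
      (Finset.single_le_sum (f := fun i => sqNorm (x i)) (fun i _ => sqNorm_nonneg _)
        (Finset.mem_univ i))
  calc ‖x‖ ^ 2 ≤ Real.sqrt (sqNormSum x) ^ 2 := by gcongr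
    _ = _ := Real.sq_sqrt (sqNormSum_nonneg x)

theorem continuous_sqNorm : Continuous sqNorm := by unfold sqNorm; fun_prop

/-! ### The Gaussian measure on families of spinors -/

/-- The density of `spinorMeasure` with respect to Lebesgue measure. -/
noncomputable def gaussDensity (z : Spinor) : ℝ := Real.exp (-sqNorm z) / Real.pi ^ 2

theorem gaussDensity_nonneg (z : Spinor) : 0 ≤ gaussDensity z := by
  unfold gaussDensity; positivity

theorem continuous_gaussDensity : Continuous gaussDensity := by
  unfold gaussDensity
  have := continuous_sqNorm
  fun_prop

theorem spinorMeasure_eq :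
    spinorMeasure = volume.withDensity fun z => ENNReal.ofReal (gaussDensity z) := rfl

theorem integrable_exp_neg_mul_sqNorm {b : ℝ} (hb : 0 < b) :
    Integrable fun z : Spinor => Real.exp (-b * sqNorm z) := by
  have h : Integrable fun z : ℂ => Real.exp (-b * ‖z‖ ^ 2) := by
    have := (GaussianFourier.integrable_cexp_neg_mul_sq_norm_add (V := ℂ) (b := b)
      (by simpa using hb) 0 0).re
    refine this.congr (ae_of_all _ fun z => ?_)
    have e : (-(b : ℂ) * (‖z‖ : ℂ) ^ 2 + 0 * ((inner ℝ (0 : ℂ) z : ℝ) : ℂ)) =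
        ((-b * ‖z‖ ^ 2 : ℝ) : ℂ) := by push_cast; ring
    simp only [e]
    exact Complex.exp_ofReal_re _
  have := Integrable.fintype_prod (ι := Fin 2) (f := fun _ z => Real.exp (-b * ‖z‖ ^ 2))
    (μ := fun _ => volume) fun _ => h
  refine this.congr (ae_of_all _ fun z => ?_)
  simp only [Fin.prod_univ_two, ← Real.exp_add, sqNorm]
  ring_nf

theorem integral_gaussDensity : ∫ z, gaussDensity z = 1 := by
  have h : ∫ z : ℂ, Real.exp (-1 * ‖z‖ ^ 2) = Real.pi := by
    rw [GaussianFourier.integral_rexp_neg_mul_sq_norm one_pos]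
    simp
  have := integral_fintype_prod_volume_eq_pow (ι := Fin 2) (E := ℂ)
    (fun z => Real.exp (-1 * ‖z‖ ^ 2))
  rw [h] at this
  have e : ∀ z : Spinor, gaussDensity z =
      (∏ i, Real.exp (-1 * ‖z i‖ ^ 2)) / Real.pi ^ 2 := fun z => by
    simp only [Fin.prod_univ_two, ← Real.exp_add, gaussDensity, sqNorm]
    ring_nf
  simp_rw [e, integral_div]
  rw [this]
  simp [Real.pi_ne_zero]

theorem integrable_gaussDensity : Integrable gaussDensity := by
  refine ((integrable_exp_neg_mul_sqNorm one_pos).div_const (Real.pi ^ 2)).congr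
    (ae_of_all _ fun z => ?_)
  simp [gaussDensity]

instance : IsProbabilityMeasure spinorMeasure := by
  refine ⟨?_⟩
  rw [spinorMeasure_eq, withDensity_apply _ MeasurableSet.univ, Measure.restrict_univ,
    ← ofReal_integral_eq_lintegral_ofReal integrable_gaussDensity
      (ae_of_all _ gaussDensity_nonneg), integral_gaussDensity, ENNReal.ofReal_one]

instance : IsProbabilityMeasure triangleMeasure :=
  inferInstanceAs (IsProbabilityMeasure (Measure.pi _))

instance {T : Type*} [Fintype T] : IsProbabilityMeasure (auxMeasure T) :=
  inferInstanceAs (IsProbabilityMeasure (Measure.pi _))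

theorem integral_spinorMeasure (F : Spinor → ℂ) :
    ∫ z, F z ∂spinorMeasure = ∫ z, (gaussDensity z : ℂ) * F z := by
  rw [spinorMeasure_eq, integral_withDensity_eq_integral_toReal_smul
    (continuous_gaussDensity.measurable.ennreal_ofReal) (ae_of_all _ fun _ => by simp)]
  simp [ENNReal.toReal_ofReal (gaussDensity_nonneg _)]

theorem integrable_spinorMeasure_exp {c : ℝ} (hc : c < 1) :
    Integrable (fun z => Real.exp (c * sqNorm z)) spinorMeasure := by
  rw [spinorMeasure_eq, integrable_withDensity_iff
    (continuous_gaussDensity.measurable.ennreal_ofReal) (ae_of_all _ fun _ => by simp)]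
  refine ((integrable_exp_neg_mul_sqNorm (sub_pos.2 hc)).div_const (Real.pi ^ 2)).congr
    (ae_of_all _ fun z => ?_)
  beta_reduce
  rw [ENNReal.toReal_ofReal (gaussDensity_nonneg _), gaussDensity, ← mul_div_assoc,
    ← Real.exp_add]
  ring_nf

theorem integrable_pi_exp {ι : Type*} [Fintype ι] {c : ℝ} (hc : c < 1) :
    Integrable (fun x : ι → Spinor => Real.exp (c * sqNormSum x))
      (Measure.pi fun _ => spinorMeasure) := by
  refine (Integrable.fintype_prod (ι := ι) (f := fun _ z => Real.exp (c * sqNorm z))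
    (μ := fun _ => spinorMeasure) fun _ => integrable_spinorMeasure_exp hc).congr
    (ae_of_all _ fun z => ?_)
  simp [sqNormSum, Finset.mul_sum, Real.exp_sum]

theorem integrable_auxMeasure_exp {T : Type*} [Fintype T] {c : ℝ} (hc : c < 1) :
    Integrable (fun x : T → Fin 3 → Spinor => Real.exp (c * ∑ t, sqNormSum (x t)))
      (auxMeasure T) := by
  refine (Integrable.fintype_prod (ι := T)
    (f := fun _ (z : Fin 3 → Spinor) => Real.exp (c * sqNormSum z))
    (μ := fun _ => triangleMeasure) fun _ => integrable_pi_exp hc).congr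
    (ae_of_all _ fun z => ?_)
  simp [Finset.mul_sum, Real.exp_sum]

theorem pi_withDensity_ofReal {ι α : Type*} [Fintype ι] [MeasurableSpace α] (μ : Measure α)
    [SigmaFinite μ] (f : α → ℝ) (hf : Integrable f μ) (h0 : ∀ x, 0 ≤ f x) :
    (Measure.pi fun _ : ι => μ.withDensity fun x => ENNReal.ofReal (f x)) =
      (Measure.pi fun _ : ι => μ).withDensity fun x => ENNReal.ofReal (∏ i, f (x i)) := by
  refine (Measure.pi_eq fun s hs => ?_).symm.symm
  rw [withDensity_apply _ (MeasurableSet.univ_pi hs), Measure.restrict_pi_pi,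
    ← ofReal_integral_eq_lintegral_ofReal
      (Integrable.fintype_prod (f := fun _ => f) fun i => hf.restrict)
      (ae_of_all _ fun x => Finset.prod_nonneg fun i _ => h0 _),
    integral_fintype_prod_eq_prod (f := fun _ : ι => f), ENNReal.ofReal_prod_of_nonneg
      (fun i _ => integral_nonneg h0)]
  refine Finset.prod_congr rfl fun i _ => ?_
  rw [withDensity_apply _ (hs i), ofReal_integral_eq_lintegral_ofReal hf.restrict
    (ae_of_all _ h0)]

theorem integral_pi_spinorMeasure {ι : Type*} [Fintype ι] (F : (ι → Spinor) → ℂ) :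
    ∫ x, F x ∂(Measure.pi fun _ : ι => spinorMeasure) =
      ∫ x : ι → Spinor, ((∏ i, gaussDensity (x i) : ℝ) : ℂ) * F x := by
  have hc : Continuous fun x : ι → Spinor => ∏ i, gaussDensity (x i) := by
    have := continuous_gaussDensity
    fun_prop
  have h0 : ∀ x : ι → Spinor, 0 ≤ ∏ i, gaussDensity (x i) := fun x =>
    Finset.prod_nonneg fun i _ => gaussDensity_nonneg _
  rw [spinorMeasure_eq, pi_withDensity_ofReal volume gaussDensity integrable_gaussDensity
    gaussDensity_nonneg, integral_withDensity_eq_integral_toReal_smul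
    hc.measurable.ennreal_ofReal (ae_of_all _ fun _ => by simp)]
  simp only [ENNReal.toReal_ofReal (h0 _), Complex.real_smul]
  rfl

theorem measurePreserving_smul_spinor {ζ : ℂ} (hζ : ‖ζ‖ = 1) :
    MeasurePreserving (fun z : Spinor => ζ • z) spinorMeasure spinorMeasure := by
  have hv : MeasurePreserving (fun z : Spinor => ζ • z) volume volume := by
    have h1 : MeasurePreserving (fun z : ℂ => ζ * z) volume volume := by
      have := (rotation (⟨ζ, by simpa [Submonoid.unitSphere] using hζ⟩ : Circle)).measurePreserving
      exact this
    exact volume_preserving_pi (fun _ : Fin 2 => h1)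
  refine ⟨by fun_prop, ?_⟩
  ext s hs
  rw [Measure.map_apply (by fun_prop) hs, spinorMeasure_eq, withDensity_apply _ hs,
    withDensity_apply _ (by measurability), ← hv.setLIntegral_comp_preimage hs
      continuous_gaussDensity.measurable.ennreal_ofReal]
  simp [gaussDensity, sqNorm_smul, hζ]

theorem measurePreserving_smul_pi {ι : Type*} [Fintype ι] {ζ : ℂ} (hζ : ‖ζ‖ = 1) :
    MeasurePreserving (fun x : ι → Spinor => ζ • x) (Measure.pi fun _ => spinorMeasure)
      (Measure.pi fun _ => spinorMeasure) :=
  measurePreserving_pi _ _ fun _ => measurePreserving_smul_spinor hζ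

theorem integral_smul_pi {ι : Type*} [Fintype ι] {ζ : ℂ} (hζ : ‖ζ‖ = 1)
    (F : (ι → Spinor) → ℂ) :
    ∫ x, F (ζ • x) ∂(Measure.pi fun _ => spinorMeasure) =
      ∫ x, F x ∂(Measure.pi fun _ => spinorMeasure) :=
  (measurePreserving_smul_pi hζ).integral_comp
    (Homeomorph.smulOfNeZero ζ (norm_ne_zero_iff.1 (by simp [hζ]))).measurableEmbedding F

/-! ### Functions of slow growth -/

/-- Continuous functions that grow more slowly than every Gaussian. -/
def SlowGrowth {E : Type*} [NormedAddCommGroup E] (F : E → ℂ) : Prop :=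
  Continuous F ∧ ∀ c > 0, ∃ C, ∀ x, ‖F x‖ ≤ C * Real.exp (c * ‖x‖ ^ 2)

/-- Measures that integrate some growing Gaussian. -/
def GaussianTail {E : Type*} [NormedAddCommGroup E] [MeasurableSpace E] (μ : Measure E) : Prop :=
  ∃ c > 0, Integrable (fun x => Real.exp (c * ‖x‖ ^ 2)) μ

namespace SlowGrowth

variable {E E' : Type*} [NormedAddCommGroup E] [NormedAddCommGroup E'] {F G : E → ℂ}

theorem of_norm_le_exp (hc : Continuous F) {a b : ℝ}
    (h : ∀ x, ‖F x‖ ≤ Real.exp (a + b * ‖x‖)) : SlowGrowth F := by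
  refine ⟨hc, fun c hc => ⟨Real.exp (a + b ^ 2 / (4 * c)), fun x => (h x).trans ?_⟩⟩
  rw [← Real.exp_add, Real.exp_le_exp]
  -- completing the square in `‖x‖`
  have : a + b ^ 2 / (4 * c) + c * ‖x‖ ^ 2 - (a + b * ‖x‖) = (2 * c * ‖x‖ - b) ^ 2 / (4 * c) := by
    field_simp
    ring
  have h2 : 0 ≤ (2 * c * ‖x‖ - b) ^ 2 / (4 * c) := by positivity
  linarith

theorem of_norm_le (hc : Continuous F) {a b : ℝ} (h : ∀ x, ‖F x‖ ≤ a + b * ‖x‖) :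
    SlowGrowth F :=
  of_norm_le_exp hc (a := a) (b := b) fun x => (h x).trans (by
    linarith [Real.add_one_le_exp (a + b * ‖x‖)])

theorem cexp (hc : Continuous F) {a b : ℝ} (h : ∀ x, ‖F x‖ ≤ a + b * ‖x‖) :
    SlowGrowth fun x => Complex.exp (F x) :=
  of_norm_le_exp (by fun_prop) (a := a) (b := b) fun x =>
    (Complex.norm_exp_le_exp_norm _).trans (Real.exp_le_exp.2 (h x))

theorem const (a : ℂ) : SlowGrowth fun _ : E => a :=
  of_norm_le continuous_const (a := ‖a‖) (b := 0) fun x => by simp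

theorem mul (hF : SlowGrowth F) (hG : SlowGrowth G) : SlowGrowth fun x => F x * G x := by
  refine ⟨hF.1.mul hG.1, fun c hc => ?_⟩
  obtain ⟨A, hA⟩ := hF.2 (c / 2) (by positivity)
  obtain ⟨B, hB⟩ := hG.2 (c / 2) (by positivity)
  refine ⟨A * B, fun x => ?_⟩
  rw [norm_mul]
  calc ‖F x‖ * ‖G x‖ ≤ (A * Real.exp (c / 2 * ‖x‖ ^ 2)) * (B * Real.exp (c / 2 * ‖x‖ ^ 2)) :=
        mul_le_mul (hA x) (hB x) (norm_nonneg _) ((norm_nonneg _).trans (hA x))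
    _ = A * B * (Real.exp (c / 2 * ‖x‖ ^ 2) * Real.exp (c / 2 * ‖x‖ ^ 2)) := by ring
    _ = _ := by rw [← Real.exp_add]; ring_nf

theorem add (hF : SlowGrowth F) (hG : SlowGrowth G) : SlowGrowth fun x => F x + G x := by
  refine ⟨hF.1.add hG.1, fun c hc => ?_⟩
  obtain ⟨A, hA⟩ := hF.2 c hc
  obtain ⟨B, hB⟩ := hG.2 c hc
  exact ⟨A + B, fun x => (norm_add_le _ _).trans (by linarith [hA x, hB x])⟩

theorem neg (hF : SlowGrowth F) : SlowGrowth fun x => -F x := by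
  simpa using (const (E := E) (-1)).mul hF

theorem sub (hF : SlowGrowth F) (hG : SlowGrowth G) : SlowGrowth fun x => F x - G x := by
  simpa only [sub_eq_add_neg] using hF.add hG.neg

theorem div_const (hF : SlowGrowth F) (a : ℂ) : SlowGrowth fun x => F x / a := by
  simpa only [div_eq_mul_inv] using hF.mul (const a⁻¹)

theorem pow (hF : SlowGrowth F) (n : ℕ) : SlowGrowth fun x => F x ^ n := by
  induction n with
  | zero => simpa using const (E := E) 1
  | succ n ih => simpa only [pow_succ] using ih.mul hF

theorem sum {ι : Type*} (s : Finset ι) {F : ι → E → ℂ} (h : ∀ i ∈ s, SlowGrowth (F i)) :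
    SlowGrowth fun x => ∑ i ∈ s, F i x := by
  classical
  induction s using Finset.induction_on with
  | empty => simpa using const (E := E) 0
  | insert a s ha ih =>
    simp only [Finset.sum_insert ha]
    exact (h a (by simp)).add (ih fun i hi => h i (by simp [hi]))

theorem prod {ι : Type*} (s : Finset ι) {F : ι → E → ℂ} (h : ∀ i ∈ s, SlowGrowth (F i)) :
    SlowGrowth fun x => ∏ i ∈ s, F i x := by
  classical
  induction s using Finset.induction_on with
  | empty => simpa using const (E := E) 1
  | insert a s ha ih =>
    simp only [Finset.prod_insert ha]
    exact (h a (by simp)).mul (ih fun i hi => h i (by simp [hi]))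

theorem star (hF : SlowGrowth F) : SlowGrowth fun x => star (F x) :=
  ⟨continuous_star.comp hF.1, fun c hc => by simpa using hF.2 c hc⟩

theorem comp (hF : SlowGrowth F) {L : E' → E} (hL : Continuous L) {a b : ℝ}
    (h : ∀ x, ‖L x‖ ≤ a + b * ‖x‖) : SlowGrowth fun x => F (L x) := by
  refine ⟨hF.1.comp hL, fun c hc => ?_⟩
  obtain ⟨C, hC⟩ := hF.2 (c / (2 * b ^ 2 + 1)) (by positivity)
  have hC0 : 0 ≤ C := by
    have := (norm_nonneg _).trans (hC 0)
    simpa using this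
  refine ⟨C * Real.exp (c * (2 * a ^ 2)), fun x => (hC _).trans ?_⟩
  rw [mul_assoc, ← Real.exp_add]
  gcongr
  have h1 : ‖L x‖ ^ 2 ≤ 2 * a ^ 2 + 2 * b ^ 2 * ‖x‖ ^ 2 := by
    calc ‖L x‖ ^ 2 ≤ (a + b * ‖x‖) ^ 2 := by gcongr; exact h x
      _ ≤ _ := by nlinarith [sq_nonneg (a - b * ‖x‖)]
  have h2 : 2 * a ^ 2 + 2 * b ^ 2 * ‖x‖ ^ 2 ≤ (2 * b ^ 2 + 1) * (2 * a ^ 2 + ‖x‖ ^ 2) := by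
    nlinarith [mul_nonneg (sq_nonneg a) (sq_nonneg b), sq_nonneg ‖x‖]
  calc c / (2 * b ^ 2 + 1) * ‖L x‖ ^ 2
      ≤ c / (2 * b ^ 2 + 1) * ((2 * b ^ 2 + 1) * (2 * a ^ 2 + ‖x‖ ^ 2)) := by
        gcongr; exact h1.trans h2
    _ = _ := by field_simp

theorem integrable [MeasurableSpace E] [OpensMeasurableSpace E]
    {μ : Measure E} (hμ : GaussianTail μ) (hF : SlowGrowth F) : Integrable F μ := by
  obtain ⟨c, hc, hi⟩ := hμ
  obtain ⟨C, hC⟩ := hF.2 c hc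
  have hm : AEStronglyMeasurable F μ :=
    (aestronglyMeasurable_iff_aemeasurable.2 hF.1.measurable.aemeasurable)
  exact (hi.const_mul C).mono' hm (ae_of_all _ hC)

end SlowGrowth

theorem slowGrowth_apply {ι : Type*} [Fintype ι] (i : ι) (j : Fin 2) :
    SlowGrowth fun x : ι → Spinor => x i j :=
  SlowGrowth.of_norm_le (by fun_prop) (a := 0) (b := 1) fun x => by
    simpa using (norm_le_pi_norm (x i) j).trans (norm_le_pi_norm x i)

theorem slowGrowth_spinor_apply (j : Fin 2) : SlowGrowth fun z : Spinor => z j :=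
  SlowGrowth.of_norm_le (by fun_prop) (a := 0) (b := 1) fun x => by
    simpa using norm_le_pi_norm x j

namespace SlowGrowth

variable {E : Type*} [NormedAddCommGroup E] {w z : E → Spinor}

theorem holBraket (hw : ∀ j, SlowGrowth fun x => w x j) (hz : ∀ j, SlowGrowth fun x => z x j) :
    SlowGrowth fun x => holBraket (w x) (z x) := by
  simp only [holBraket_apply]
  exact ((hw 0).mul (hz 1)).sub ((hw 1).mul (hz 0))

theorem braket (hw : ∀ j, SlowGrowth fun x => w x j) (hz : ∀ j, SlowGrowth fun x => z x j) :
    SlowGrowth fun x => braket (w x) (z x) :=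
  ((hw 0).star.mul (hz 0)).add ((hw 1).star.mul (hz 1))

theorem antiBraket (hw : ∀ j, SlowGrowth fun x => w x j) (hz : ∀ j, SlowGrowth fun x => z x j) :
    SlowGrowth fun x => antiBraket (w x) (z x) := by
  simp only [antiBraket_apply]
  exact ((hw 1).star.mul (hz 0).star).sub ((hw 0).star.mul (hz 1).star)

theorem dual (hz : ∀ j, SlowGrowth fun x => z x j) (j : Fin 2) :
    SlowGrowth fun x => dual (z x) j := by
  fin_cases j
  · simpa [SpinNet.dual] using (hz 1).star.neg
  · simpa [SpinNet.dual] using (hz 0).star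

theorem angleTerm {w z : E → Fin 3 → Spinor} (hw : ∀ i j, SlowGrowth fun x => w x i j)
    (hz : ∀ i j, SlowGrowth fun x => z x i j) :
    SlowGrowth fun x => angleTerm (w x) (z x) := by
  unfold SpinNet.angleTerm
  exact sum _ fun i _ => (holBraket (hw i) (hw _)).mul (holBraket (hz i) (hz _))

end SlowGrowth

theorem gaussianTail_spinor : GaussianTail spinorMeasure := by
  refine ⟨1 / 2, by norm_num, (integrable_spinorMeasure_exp (c := 1 / 2) (by norm_num)).mono'
    (by fun_prop) (ae_of_all _ fun x => ?_)⟩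
  rw [Real.norm_of_nonneg (Real.exp_nonneg _), Real.exp_le_exp]
  linarith [norm_sq_le_sqNorm x]

theorem gaussianTail_pi {ι : Type*} [Fintype ι] :
    GaussianTail (Measure.pi fun _ : ι => spinorMeasure) := by
  refine ⟨1 / 2, by norm_num, (integrable_pi_exp (c := 1 / 2) (by norm_num)).mono'
    (by fun_prop) (ae_of_all _ fun x => ?_)⟩
  rw [Real.norm_of_nonneg (Real.exp_nonneg _), Real.exp_le_exp]
  linarith [norm_sq_le_sqNormSum x]

theorem gaussianTail_triangle : GaussianTail triangleMeasure := gaussianTail_pi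

theorem GaussianTail.prod {E E' : Type*} [NormedAddCommGroup E] [NormedAddCommGroup E']
    [MeasurableSpace E] [MeasurableSpace E'] [BorelSpace E] [BorelSpace E']
    [SecondCountableTopology E] [SecondCountableTopology E']
    {μ : Measure E} {ν : Measure E'} [SFinite μ] [SFinite ν] (hμ : GaussianTail μ)
    (hν : GaussianTail ν) : GaussianTail (μ.prod ν) := by
  obtain ⟨a, ha, hia⟩ := hμ
  obtain ⟨b, hb, hib⟩ := hν
  refine ⟨min a b, by positivity, (hia.mul_prod hib).mono' (by fun_prop)
    (ae_of_all _ fun x => ?_)⟩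
  rw [Real.norm_of_nonneg (Real.exp_nonneg _), ← Real.exp_add, Real.exp_le_exp]
  have h1 : min a b * ‖x.1‖ ^ 2 ≤ a * ‖x.1‖ ^ 2 := by gcongr; exact min_le_left _ _
  have h2 : min a b * ‖x.2‖ ^ 2 ≤ b * ‖x.2‖ ^ 2 := by gcongr; exact min_le_right _ _
  have h3 : 0 ≤ a * ‖x.1‖ ^ 2 := by positivity
  have h4 : 0 ≤ b * ‖x.2‖ ^ 2 := by positivity
  rcases max_cases ‖x.1‖ ‖x.2‖ with h | h <;> rw [Prod.norm_def, h.1] <;> linarith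

/-! ### The reproducing property -/

/-- If the integral of a family of functions, entire in the parameter, does not change when the
parameter runs through the unit circle, then the parameter may be set to zero: the mean value
property, combined with Fubini's theorem. -/
theorem integral_eq_of_rotation {X : Type*} [MeasurableSpace X] {μ : Measure X} [SFinite μ]
    (Φ : ℂ → X → ℂ) (hd : ∀ x, Differentiable ℂ fun ζ => Φ ζ x)
    (hi : Integrable (fun p : ℝ × X => Φ (circleMap 0 1 p.1) p.2)
      ((volume.restrict (Set.uIoc 0 (2 * Real.pi))).prod μ))
    (hinv : ∀ θ : ℝ, ∫ x, Φ (circleMap 0 1 θ) x ∂μ = ∫ x, Φ 1 x ∂μ) :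
    ∫ x, Φ 1 x ∂μ = ∫ x, Φ 0 x ∂μ := by
  have hmv : ∀ x, ((2 * Real.pi)⁻¹ : ℝ) • ∫ θ in (0)..2 * Real.pi, Φ (circleMap 0 1 θ) x =
      Φ 0 x := fun x => (hd x).diffContOnCl.circleAverage (R := 1) (c := 0)
  have hpi : (0 : ℝ) ≤ 2 * Real.pi := by positivity
  simp_rw [← hmv]
  rw [integral_smul]
  rw [← intervalIntegral_integral_swap hi]
  simp_rw [hinv]
  rw [intervalIntegral.integral_const, smul_smul, sub_zero, inv_mul_cancel₀ (by positivity),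
    one_smul]

section Family

variable {ι : Type*} [Fintype ι]

/-- The Hermitian pairing `∑ᵢ ⟨xᵢ|wᵢ⟩` of two families of spinors. -/
noncomputable def pairing (x w : ι → Spinor) : ℂ := ∑ i, braket (x i) (w i)

theorem braket_smul_left (c : ℂ) (w z : Spinor) : braket (c • w) z = star c * braket w z := by
  simp [braket]; ring

theorem braket_smul_right (c : ℂ) (w z : Spinor) : braket w (c • z) = c * braket w z := by
  simp [braket]; ring

theorem pairing_smul_left (c : ℂ) (x w : ι → Spinor) :
    pairing (c • x) w = star c * pairing x w := by
  simp [pairing, braket_smul_left, Finset.mul_sum]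

theorem continuous_braket_left (w : Spinor) : Continuous fun z => braket z w := by
  unfold braket; fun_prop

theorem continuous_pairing_left (w : ι → Spinor) : Continuous fun x => pairing x w := by
  unfold pairing
  exact continuous_finsetSum _ fun i _ =>
    (continuous_braket_left (w i)).comp (continuous_apply i)

theorem norm_braket_le_mul (w z : Spinor) : ‖braket w z‖ ≤ 2 * ‖w‖ * ‖z‖ := by
  have e : ∀ j, ‖star (w j) * z j‖ ≤ ‖w‖ * ‖z‖ := fun j => by
    rw [norm_mul, norm_star]
    exact mul_le_mul (norm_le_pi_norm w j) (norm_le_pi_norm z j) (norm_nonneg _) (norm_nonneg _)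
  calc ‖braket w z‖ ≤ ‖star (w 0) * z 0‖ + ‖star (w 1) * z 1‖ := norm_add_le _ _
    _ ≤ _ := by linarith [e 0, e 1]

theorem norm_pairing_le_mul (x w : ι → Spinor) :
    ‖pairing x w‖ ≤ (2 * Fintype.card ι * ‖w‖) * ‖x‖ := by
  calc ‖pairing x w‖ ≤ ∑ i, ‖braket (x i) (w i)‖ := norm_sum_le _ _
    _ ≤ ∑ _i : ι, 2 * ‖x‖ * ‖w‖ := by
        refine Finset.sum_le_sum fun i _ => (norm_braket_le_mul _ _).trans ?_
        gcongr
        · exact norm_le_pi_norm x i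
        · exact norm_le_pi_norm w i
    _ = _ := by simp; ring

theorem slowGrowth_cexp_pairing (w : ι → Spinor) :
    SlowGrowth fun x => Complex.exp (pairing x w) :=
  SlowGrowth.cexp (continuous_pairing_left w) (a := 0)
    (b := 2 * Fintype.card ι * ‖w‖) fun x => by simpa using norm_pairing_le_mul x w

/-- The mean value property of the Gaussian measure. -/
theorem integral_pi_eq_apply_zero {H : (ι → Spinor) → ℂ} (hH : SlowGrowth H)
    (hd : Differentiable ℂ H) : ∫ x, H x ∂(Measure.pi fun _ => spinorMeasure) = H 0 := by
  have key := integral_eq_of_rotation (μ := Measure.pi fun _ : ι => spinorMeasure)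
    (fun ζ x => H (ζ • x))
    (fun x => hd.comp (differentiable_id.smul_const x)) ?_ fun θ => ?_
  · simpa using key
  · obtain ⟨c, hc, hi⟩ := gaussianTail_pi (ι := ι)
    obtain ⟨C, hC⟩ := hH.2 c hc
    have h1 : Integrable (fun _ : ℝ => C) (volume.restrict (Set.uIoc 0 (2 * Real.pi))) :=
      continuous_const.integrableOn_uIoc
    refine (h1.mul_prod hi).mono' ?_ (ae_of_all _ fun p => ?_)
    · have hcont : Continuous fun p : ℝ × (ι → Spinor) => H (circleMap 0 1 p.1 • p.2) :=
        hH.1.comp (((continuous_circleMap 0 1).comp continuous_fst).smul continuous_snd)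
      exact hcont.aestronglyMeasurable
    · refine (hC _).trans_eq ?_
      simp [norm_smul]
  · simp only [one_smul]
    exact integral_smul_pi (by simp) H

/-- The reproducing property of the Gaussian measure for entire functions. -/
theorem integral_mul_cexp_pairing {F : (ι → Spinor) → ℂ} (hF : SlowGrowth F)
    (hd : Differentiable ℂ F) (w : ι → Spinor) :
    ∫ x, F x * Complex.exp (pairing x w) ∂(Measure.pi fun _ => spinorMeasure) = F w := by
  have hw : Differentiable ℂ fun x : ι → Spinor => pairing w x := by
    unfold pairing braket; fun_prop
  have hslow : SlowGrowth fun x : ι → Spinor => F (x + w) * Complex.exp (-pairing w x) := by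
    refine (hF.comp (L := fun x => x + w) (by fun_prop) (a := ‖w‖) (b := 1) fun x => ?_).mul
      (SlowGrowth.cexp (hw.continuous.neg) (a := 0) (b := 2 * Fintype.card ι * ‖w‖) fun x => ?_)
    · linarith [norm_add_le x w]
    · rw [norm_neg]
      have := norm_pairing_le_mul w x
      linarith
  have h0 := integral_pi_eq_apply_zero hslow (by fun_prop)
  rw [integral_pi_spinorMeasure] at h0 ⊢
  -- the translation by `w` turns `e^{⟨x|w⟩}` into a holomorphic factor, up to the Gaussian density
  rw [← integral_add_right_eq_self _ w]
  have hz : pairing w 0 = 0 := by simp [pairing, braket]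
  simp only [zero_add, hz, neg_zero, Complex.exp_zero, mul_one] at h0
  rw [← h0]
  refine integral_congr_ae (ae_of_all _ fun x => ?_)
  have hg : ∀ y : ι → Spinor, ((∏ i, gaussDensity (y i) : ℝ) : ℂ) =
      Complex.exp (-pairing y y) / (((Real.pi : ℂ) ^ 2) ^ Fintype.card ι) := fun y => by
    simp only [gaussDensity, Finset.prod_div_distrib, ← Real.exp_sum, pairing, braket_self]
    push_cast
    simp
  have hp : -pairing (x + w) (x + w) + pairing (x + w) w = -pairing x x + -pairing w x := by
    simp only [pairing, ← Finset.sum_neg_distrib, ← Finset.sum_add_distrib]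
    refine Finset.sum_congr rfl fun i _ => ?_
    simp [braket]
    ring
  beta_reduce
  rw [hg, hg]
  have := congrArg Complex.exp hp
  rw [Complex.exp_add, Complex.exp_add] at this
  linear_combination F (x + w) / (((Real.pi : ℂ) ^ 2) ^ Fintype.card ι) * this

/-! ### Homogeneous functions -/

theorem exists_phase_ne_one {m n : ℕ} (h : m ≠ n) :
    ∃ ζ : ℂ, ‖ζ‖ = 1 ∧ ζ ^ n * star ζ ^ m ≠ 1 := by
  have h' : ((n : ℂ) - m) ≠ 0 := sub_ne_zero.2 (by exact_mod_cast h.symm)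
  have e : (Real.pi / ((n : ℂ) - m)) * Complex.I =
      ((Real.pi / ((n : ℝ) - m) : ℝ) : ℂ) * Complex.I := by
    push_cast; rfl
  refine ⟨Complex.exp (Real.pi / ((n : ℂ) - m) * Complex.I), ?_, ?_⟩
  · rw [e, Complex.norm_exp_ofReal_mul_I]
  · have hs : star (Complex.exp (Real.pi / ((n : ℂ) - m) * Complex.I)) =
        Complex.exp (-(Real.pi / ((n : ℂ) - m) * Complex.I)) := by
      rw [e, Complex.star_def, ← Complex.exp_conj]
      simp
    rw [hs, ← Complex.exp_nat_mul, ← Complex.exp_nat_mul, ← Complex.exp_add]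
    have : (n : ℂ) * (Real.pi / ((n : ℂ) - m) * Complex.I) +
        m * -(Real.pi / ((n : ℂ) - m) * Complex.I) = Real.pi * Complex.I := by
      field_simp
      ring
    rw [this, Complex.exp_pi_mul_I]
    norm_num

/-- Phase rotations kill functions of unequal holomorphic and anti-holomorphic degree. -/
theorem integral_pi_eq_zero_of_phase {G : (ι → Spinor) → ℂ} {m n : ℕ} (h : m ≠ n)
    (hG : ∀ ζ : ℂ, ‖ζ‖ = 1 → ∀ x, G (ζ • x) = ζ ^ n * star ζ ^ m * G x) :
    ∫ x, G x ∂(Measure.pi fun _ => spinorMeasure) = 0 := by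
  obtain ⟨ζ, h1, h2⟩ := exists_phase_ne_one h
  have h3 := integral_smul_pi h1 G
  simp_rw [hG ζ h1] at h3
  rw [integral_const_mul] at h3
  by_contra h4
  exact h2 (mul_right_cancel₀ h4 (h3.trans (one_mul _).symm))

/-- Of the exponential series in `∫ G(x) e^{⟨x|w⟩}` only the term matching the degree of `G`
survives. -/
theorem integral_mul_cexp_pairing_eq {G : (ι → Spinor) → ℂ} (hG : SlowGrowth G) {n : ℕ}
    (hn : ∀ ζ : ℂ, ‖ζ‖ = 1 → ∀ x, G (ζ • x) = ζ ^ n * G x) (w : ι → Spinor) :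
    ∫ x, G x * (pairing x w ^ n / n.factorial) ∂(Measure.pi fun _ => spinorMeasure) =
      ∫ x, G x * Complex.exp (pairing x w) ∂(Measure.pi fun _ => spinorMeasure) := by
  have hs : ∀ x, HasSum (fun m : ℕ => pairing x w ^ m / (m.factorial : ℂ))
      (Complex.exp (pairing x w)) := fun x => by
    rw [Complex.exp_eq_exp_ℂ]; exact NormedSpace.expSeries_div_hasSum_exp _
  have hs' : ∀ x, HasSum (fun m : ℕ => ‖pairing x w‖ ^ m / (m.factorial : ℝ))
      (Real.exp ‖pairing x w‖) := fun x => by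
    rw [Real.exp_eq_exp_ℝ]; exact NormedSpace.expSeries_div_hasSum_exp _
  have hsum := hasSum_integral_of_dominated_convergence
    (μ := Measure.pi fun _ : ι => spinorMeasure)
    (F := fun (m : ℕ) x => G x * (pairing x w ^ m / (m.factorial : ℂ)))
    (f := fun x => G x * Complex.exp (pairing x w))
    (fun m x => ‖G x‖ * (‖pairing x w‖ ^ m / (m.factorial : ℝ)))
    (fun m => (hG.1.mul (((continuous_pairing_left w).pow m).div_const _)).aestronglyMeasurable)
    (fun m => ae_of_all _ fun x => by simp)
    (ae_of_all _ fun x => ((hs' x).mul_left _).summable) ?_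
    (ae_of_all _ fun x => (hs x).mul_left _)
  · refine HasSum.unique ?_ hsum
    refine hasSum_single n fun m hm => ?_
    refine integral_pi_eq_zero_of_phase hm fun ζ hζ x => ?_
    rw [hn ζ hζ, pairing_smul_left]
    ring
  · have hr : SlowGrowth fun x => G x * Complex.exp (‖pairing x w‖ : ℝ) :=
      hG.mul (SlowGrowth.cexp (Complex.continuous_ofReal.comp
        (continuous_norm.comp (continuous_pairing_left w))) (a := 0)
        (b := 2 * Fintype.card ι * ‖w‖) fun x => by simpa using norm_pairing_le_mul x w)
    refine (hr.integrable gaussianTail_pi).norm.congr (ae_of_all _ fun x => ?_)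
    beta_reduce
    rw [((hs' x).mul_left _).tsum_eq, norm_mul, ← Complex.ofReal_exp, Complex.norm_real,
      Real.norm_of_nonneg (Real.exp_nonneg _)]

/-- The reproducing property for homogeneous functions. -/
theorem integral_mul_pairing_pow {F : (ι → Spinor) → ℂ} (hF : SlowGrowth F)
    (hd : Differentiable ℂ F) {n : ℕ}
    (hn : ∀ ζ : ℂ, ‖ζ‖ = 1 → ∀ x, F (ζ • x) = ζ ^ n * F x) (w : ι → Spinor) :
    ∫ x, F x * (pairing x w ^ n / n.factorial) ∂(Measure.pi fun _ => spinorMeasure) = F w := by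
  rw [integral_mul_cexp_pairing_eq hF hn, integral_mul_cexp_pairing hF hd]

end Family

/-- Differentiation of an integral with respect to the width of a Gaussian factor, at width one. -/
theorem hasDerivAt_integral_exp {X : Type*} [MeasurableSpace X] {μ : Measure X} {H : X → ℂ}
    {q : X → ℝ} (hH : AEStronglyMeasurable H μ) (hq : Measurable q) (h0 : ∀ x, 0 ≤ q x) {δ : ℝ}
    (hδ : 0 < δ) (hi : Integrable (fun x => ‖H x‖ * Real.exp (δ * q x)) μ) :
    HasDerivAt (fun s : ℝ => ∫ x, H x * Real.exp (-(s - 1) * q x) ∂μ)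
      (-∫ x, q x * H x ∂μ) 1 := by
  have hm : ∀ s : ℝ, AEStronglyMeasurable
      (fun x => H x * (Real.exp (-(s - 1) * q x) : ℂ)) μ := fun s =>
    hH.mul (by
      refine (Complex.measurable_ofReal.comp ?_).aestronglyMeasurable
      fun_prop)
  have hm' : AEStronglyMeasurable (fun x => -((q x : ℂ) * H x)) μ :=
    ((Complex.measurable_ofReal.comp hq).aestronglyMeasurable.mul hH).neg
  have hHi : Integrable H μ := hi.mono' hH (ae_of_all _ fun x =>
    le_mul_of_one_le_right (norm_nonneg _) (Real.one_le_exp (mul_nonneg hδ.le (h0 x))))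
  have key := hasDerivAt_integral_of_dominated_loc_of_deriv_le (𝕜 := ℝ) (μ := μ)
    (F := fun s x => H x * (Real.exp (-(s - 1) * q x) : ℂ))
    (F' := fun s x => -((q x : ℂ) * H x) * (Real.exp (-(s - 1) * q x) : ℂ)) (x₀ := 1)
    (bound := fun x => (2 / δ) * (‖H x‖ * Real.exp (δ * q x)))
    (Metric.ball_mem_nhds 1 (ε := δ / 2) (by positivity)) (Eventually.of_forall hm)
    (by simpa using hHi) (by simpa using hm') (ae_of_all _ fun x s hs => ?_)
    (hi.const_mul _) (ae_of_all _ fun x s hs => ?_)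
  · simpa [integral_neg] using key.2
  · have h1 : -(s - 1) ≤ δ / 2 := by
      have := Metric.mem_ball.1 hs
      rw [Real.dist_eq] at this
      linarith [neg_abs_le (s - 1)]
    -- half of the margin `δ` absorbs the factor `q x`, the other half the variation of `s`
    have h2 : q x ≤ 2 / δ * Real.exp (δ / 2 * q x) := by
      have h3 := Real.add_one_le_exp (δ / 2 * q x)
      calc q x = 2 / δ * (δ / 2 * q x) := by field_simp
        _ ≤ _ := by gcongr; linarith
    rw [norm_mul, norm_neg, norm_mul, Complex.norm_real, Complex.norm_real,
      Real.norm_of_nonneg (h0 x), Real.norm_of_nonneg (Real.exp_nonneg _)]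
    calc q x * ‖H x‖ * Real.exp (-(s - 1) * q x)
        ≤ (2 / δ * Real.exp (δ / 2 * q x)) * ‖H x‖ * Real.exp (δ / 2 * q x) := by
          gcongr
          exact h0 x
      _ = 2 / δ * (‖H x‖ * (Real.exp (δ / 2 * q x) * Real.exp (δ / 2 * q x))) := by ring
      _ = _ := by rw [← Real.exp_add]; ring_nf
  · have h1 : HasDerivAt (fun s : ℝ => -(s - 1) * q x) (-q x) s := by
      simpa using (((hasDerivAt_id s).sub_const 1).neg).mul_const (q x)
    have h2 := (h1.exp.ofReal_comp).const_mul (H x)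
    refine h2.congr_deriv ?_
    push_cast
    ring

theorem integral_comp_eval_unit (F : Spinor → ℂ) :
    ∫ x : Unit → Spinor, F (x ()) ∂(Measure.pi fun _ => spinorMeasure) =
      ∫ z, F z ∂spinorMeasure :=
  (measurePreserving_funUnique spinorMeasure Unit).integral_comp
    (MeasurableEquiv.funUnique Unit Spinor).measurableEmbedding F

/-! ### Integrals over a single spinor -/

theorem SlowGrowth.comp_eval_unit {F : Spinor → ℂ} (hF : SlowGrowth F) :
    SlowGrowth fun x : Unit → Spinor => F (x ()) :=
  hF.comp (L := fun x : Unit → Spinor => x ()) (by fun_prop) (a := 0) (b := 1) fun x => by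
    simpa using norm_le_pi_norm x ()

theorem integral_spinor_eq_zero_of_phase {G : Spinor → ℂ} {m n : ℕ} (h : m ≠ n)
    (hG : ∀ ζ : ℂ, ‖ζ‖ = 1 → ∀ z, G (ζ • z) = ζ ^ n * star ζ ^ m * G z) :
    ∫ z, G z ∂spinorMeasure = 0 := by
  rw [← integral_comp_eval_unit]
  exact integral_pi_eq_zero_of_phase h fun ζ hζ x => hG ζ hζ _

theorem integral_mul_cexp_braket_eq {G : Spinor → ℂ} (hG : SlowGrowth G) {n : ℕ}
    (hn : ∀ ζ : ℂ, ‖ζ‖ = 1 → ∀ z, G (ζ • z) = ζ ^ n * G z) (w : Spinor) :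
    ∫ z, G z * (braket z w ^ n / n.factorial) ∂spinorMeasure =
      ∫ z, G z * Complex.exp (braket z w) ∂spinorMeasure := by
  rw [← integral_comp_eval_unit, ← integral_comp_eval_unit]
  simpa [pairing] using integral_mul_cexp_pairing_eq hG.comp_eval_unit (n := n)
    (fun ζ hζ x => hn ζ hζ (x ())) (fun _ => w)

theorem integral_mul_braket_pow {F : Spinor → ℂ} (hF : SlowGrowth F)
    (hd : Differentiable ℂ F) {n : ℕ}
    (hn : ∀ ζ : ℂ, ‖ζ‖ = 1 → ∀ z, F (ζ • z) = ζ ^ n * F z) (w : Spinor) :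
    ∫ z, F z * (braket z w ^ n / n.factorial) ∂spinorMeasure = F w := by
  rw [← integral_comp_eval_unit]
  simpa [pairing] using integral_mul_pairing_pow hF.comp_eval_unit (by fun_prop) (n := n)
    (fun ζ hζ x => hn ζ hζ (x ())) (fun _ => w)

theorem slowGrowth_sqNorm : SlowGrowth fun z : Spinor => (sqNorm z : ℂ) := by
  simp only [← braket_self]
  exact SlowGrowth.braket slowGrowth_spinor_apply slowGrowth_spinor_apply

theorem SlowGrowth.integrable_mul_exp_sqNorm {H : Spinor → ℂ} (hH : SlowGrowth H) :
    Integrable (fun z => ‖H z‖ * Real.exp (1 / 2 * sqNorm z)) spinorMeasure := by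
  obtain ⟨C, hC⟩ := hH.2 (1 / 4) (by norm_num)
  have hc := continuous_sqNorm
  have hn := hH.1.norm
  refine ((integrable_spinorMeasure_exp (c := 3 / 4) (by norm_num)).const_mul C).mono'
    (by fun_prop) (ae_of_all _ fun z => ?_)
  have hC0 : 0 ≤ C := by simpa using (norm_nonneg _).trans (hC 0)
  rw [norm_mul, norm_norm, Real.norm_of_nonneg (Real.exp_nonneg _)]
  calc ‖H z‖ * Real.exp (1 / 2 * sqNorm z)
      ≤ (C * Real.exp (1 / 4 * sqNorm z)) * Real.exp (1 / 2 * sqNorm z) := by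
        gcongr
        refine (hC z).trans ?_
        gcongr
        exact norm_sq_le_sqNorm z
    _ = _ := by rw [mul_assoc, ← Real.exp_add]; ring_nf

theorem integral_mul_exp_sqNorm (H : Spinor → ℂ) (s : ℝ) :
    ∫ z, H z * Real.exp (-(s - 1) * sqNorm z) ∂spinorMeasure =
      (∫ z, Real.exp (-s * sqNorm z) * H z) / (Real.pi : ℂ) ^ 2 := by
  rw [integral_spinorMeasure, ← integral_div]
  refine integral_congr_ae (ae_of_all _ fun z => ?_)
  simp only [gaussDensity]
  have : Real.exp (-s * sqNorm z) =
      Real.exp (-sqNorm z) * Real.exp (-(s - 1) * sqNorm z) := by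
    rw [← Real.exp_add]; ring_nf
  rw [this]
  push_cast
  ring

/-- Radial integration: the factor `⟨z|z⟩` acts on functions of degree `2 d` as `d + 2`. -/
theorem integral_sqNorm_mul {G : Spinor → ℂ} (hG : SlowGrowth G) {d : ℕ}
    (hd : ∀ t : ℝ, 0 < t → ∀ z, G ((t : ℂ) • z) = (t : ℂ) ^ (2 * d) * G z) :
    ∫ z, sqNorm z * G z ∂spinorMeasure = (d + 2) * ∫ z, G z ∂spinorMeasure := by
  have hD := hasDerivAt_integral_exp hG.1.aestronglyMeasurable continuous_sqNorm.measurable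
    sqNorm_nonneg (by norm_num) hG.integrable_mul_exp_sqNorm
  -- rescaling `z` by `√s` in the four real dimensions of `ℂ²`
  have hZ : ∀ s : ℝ, 0 < s → ∫ z, G z * Real.exp (-(s - 1) * sqNorm z) ∂spinorMeasure =
      ((s ^ (d + 2))⁻¹ : ℝ) * ∫ z, G z ∂spinorMeasure := fun s hs => by
    have h1 := Measure.integral_comp_smul (volume : Measure Spinor)
      (fun z => (Real.exp (-1 * sqNorm z) : ℂ) * G z) (Real.sqrt s)
    have h2 : ∀ z : Spinor, (Real.sqrt s • z : Spinor) = ((Real.sqrt s : ℝ) : ℂ) • z :=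
      fun z => by ext j; simp
    have hfin : Module.finrank ℝ Spinor = 4 := by
      rw [Module.finrank_pi_fintype]; simp
    have hss : (Real.sqrt s) ^ 2 = s := Real.sq_sqrt hs.le
    simp_rw [h2, hd _ (Real.sqrt_pos.2 hs), sqNorm_smul, Complex.norm_real,
      Real.norm_of_nonneg (Real.sqrt_nonneg s)] at h1
    rw [hss, hfin, show (Real.sqrt s) ^ 4 = s ^ 2 by
      rw [show 4 = 2 * 2 from rfl, pow_mul, hss], pow_mul, ← Complex.ofReal_pow, hss] at h1
    have h3 := integral_mul_exp_sqNorm G s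
    have h4 := integral_mul_exp_sqNorm G 1
    simp only [sub_self, neg_zero, zero_mul, Real.exp_zero, Complex.ofReal_one, mul_one] at h4
    have h5 : ∀ z, (Real.exp (-1 * (s * sqNorm z)) : ℂ) * ((s : ℂ) ^ d * G z) =
        (s : ℂ) ^ d * (Real.exp (-s * sqNorm z) * G z) := fun z => by
      rw [show -1 * (s * sqNorm z) = -s * sqNorm z by ring]; ring
    simp_rw [h5] at h1
    rw [integral_const_mul, abs_of_pos (by positivity)] at h1
    have hs0 : (s : ℂ) ≠ 0 := by exact_mod_cast hs.ne'
    have h6 : (∫ z, (Real.exp (-s * sqNorm z) : ℂ) * G z) =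
        ((s ^ (d + 2))⁻¹ : ℝ) * ∫ z, (Real.exp (-1 * sqNorm z) : ℂ) * G z := by
      rw [Complex.real_smul] at h1
      push_cast at h1 ⊢
      field_simp
      field_simp at h1
      linear_combination h1
    rw [h3, h4, h6]
    ring
  have hZ' : HasDerivAt (fun s : ℝ => ((s ^ (d + 2))⁻¹ : ℝ) * ∫ z, G z ∂spinorMeasure)
      (-(d + 2) * ∫ z, G z ∂spinorMeasure) 1 := by
    have h1 : HasDerivAt (fun s : ℝ => (s ^ (d + 2))⁻¹) (-(d + 2)) 1 := by
      have := (hasDerivAt_pow (d + 2) (1 : ℝ)).fun_inv (by simp)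
      simpa using this
    refine (h1.ofReal_comp.mul_const (∫ z, G z ∂spinorMeasure)).congr_deriv ?_
    push_cast
    ring
  have heq : (fun s : ℝ => ∫ z, G z * Real.exp (-(s - 1) * sqNorm z) ∂spinorMeasure) =ᶠ[𝓝 1]
      fun s : ℝ => ((s ^ (d + 2))⁻¹ : ℝ) * ∫ z, G z ∂spinorMeasure := by
    filter_upwards [lt_mem_nhds one_pos] with s hs using hZ s hs
  have := (hZ'.congr_of_eventuallyEq heq).unique hD
  linear_combination this

theorem integral_sqNorm_pow (n : ℕ) :
    ∫ z, (sqNorm z : ℂ) ^ n ∂spinorMeasure = (n + 1).factorial := by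
  induction n with
  | zero => simp
  | succ n ih =>
    have := integral_sqNorm_mul (slowGrowth_sqNorm.pow n) (d := n) fun t ht z => by
      rw [sqNorm_smul, Complex.norm_real, Real.norm_of_nonneg ht.le]
      push_cast
      ring
    simp_rw [pow_succ', this, ih]
    rw [Nat.factorial_succ (n + 1)]
    push_cast
    ring

/-- The face amplitude multiplies holomorphic functions of degree `d`, tested against
exponentials, by the dimension `d + 1` of the representation of spin `d / 2`. -/
theorem integral_sqNorm_sub_one_mul_cexp {F : Spinor → ℂ} (hF : SlowGrowth F) {d : ℕ}
    (hd : ∀ ζ : ℂ, ∀ z, F (ζ • z) = ζ ^ d * F z) (w : Spinor) :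
    ∫ z, (sqNorm z - 1) * F z * Complex.exp (braket z w) ∂spinorMeasure =
      (d + 1) * ∫ z, F z * Complex.exp (braket z w) ∂spinorMeasure := by
  have hb : SlowGrowth fun z => braket z w ^ d / (d.factorial : ℂ) :=
    ((SlowGrowth.braket slowGrowth_spinor_apply (z := fun _ => w)
      fun j => SlowGrowth.const (w j)).pow d).div_const _
  -- with the exponential cut down to its term of degree `d`, the integrand has degree `2 d`
  rw [← integral_mul_cexp_braket_eq hF (fun ζ _ => hd ζ),
    ← integral_mul_cexp_braket_eq (n := d)
      ((slowGrowth_sqNorm.sub (SlowGrowth.const 1)).mul hF) fun ζ hζ z => by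
        rw [sqNorm_smul, hζ, hd]; push_cast; ring]
  have h1 := integral_sqNorm_mul (hF.mul hb) (d := d) fun t ht z => by
    rw [hd, braket_smul_left, Complex.star_def, Complex.conj_ofReal]; ring
  have hi := (hF.mul hb).integrable gaussianTail_spinor
  have hi' := (slowGrowth_sqNorm.mul (hF.mul hb)).integrable gaussianTail_spinor
  calc _ = ∫ z, ((sqNorm z : ℂ) * (F z * (braket z w ^ d / (d.factorial : ℂ))) -
        F z * (braket z w ^ d / (d.factorial : ℂ))) ∂spinorMeasure := by
        refine integral_congr_ae (ae_of_all _ fun z => ?_)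
        beta_reduce
        ring
    _ = _ := by rw [integral_sub hi' hi, h1]; ring

/-- Fubini's theorem for a family of spinors, the first of which is integrated first. -/
theorem integral_pi_fin_succ {n : ℕ} {F : (Fin (n + 1) → Spinor) → ℂ}
    (hF : Integrable F (Measure.pi fun _ => spinorMeasure)) :
    ∫ x, F x ∂(Measure.pi fun _ => spinorMeasure) =
      ∫ y : Fin n → Spinor, ∫ z, F (Fin.cons z y) ∂spinorMeasure
        ∂(Measure.pi fun _ => spinorMeasure) := by
  have hmp := (measurePreserving_piFinSuccAbove (α := fun _ : Fin (n + 1) => Spinor)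
    (fun _ => spinorMeasure) 0).symm
  rw [← hmp.integral_comp']
  refine (integral_prod_symm _ (hmp.integrable_comp_of_integrable hF)).trans ?_
  simp only [Function.comp_apply, MeasurableEquiv.piFinSuccAbove_symm_apply, Fin.insertNthEquiv,
    Equiv.coe_fn_mk, Fin.insertNth_zero]
  rfl

/-- The face amplitude of one spinor, inserted into the reproducing property of a family. -/
theorem integral_sqNorm_sub_one_mul_cexp_pairing {n : ℕ} {F : (Fin (n + 1) → Spinor) → ℂ}
    (hF : SlowGrowth F) (hdiff : Differentiable ℂ F) {d : ℕ}
    (hd : ∀ ζ : ℂ, ∀ z y, F (Fin.cons (ζ • z) y) = ζ ^ d * F (Fin.cons z y))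
    (w : Fin (n + 1) → Spinor) :
    ∫ x, (sqNorm (x 0) - 1) * F x * Complex.exp (pairing x w)
      ∂(Measure.pi fun _ => spinorMeasure) = (d + 1) * F w := by
  have hs : SlowGrowth fun x : Fin (n + 1) → Spinor => (sqNorm (x 0) : ℂ) := by
    simp only [← braket_self]
    exact SlowGrowth.braket (slowGrowth_apply 0) (slowGrowth_apply 0)
  have hi1 := (((hs.sub (SlowGrowth.const 1)).mul hF).mul
    (slowGrowth_cexp_pairing w)).integrable gaussianTail_pi
  have hi2 := (hF.mul (slowGrowth_cexp_pairing w)).integrable gaussianTail_pi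
  rw [← integral_mul_cexp_pairing hF hdiff w, integral_pi_fin_succ hi1,
    integral_pi_fin_succ hi2, ← integral_const_mul]
  refine integral_congr_ae (ae_of_all _ fun y => ?_)
  have hp : ∀ z, pairing (Fin.cons z y : Fin (n + 1) → Spinor) w =
      braket z (w 0) + pairing y fun i => w i.succ := fun z => by
    simp [pairing, Fin.sum_univ_succ]
  have hFy : SlowGrowth fun z => F (Fin.cons z y) := by
    refine hF.comp (L := fun z => (Fin.cons z y : Fin (n + 1) → Spinor)) (by fun_prop)
      (a := ‖y‖) (b := 1) fun z => ?_
    refine (pi_norm_le_iff_of_nonneg (by positivity)).2 fun i => ?_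
    refine Fin.cases ?_ (fun j => ?_) i
    · simp
    · simpa using (norm_le_pi_norm y j).trans (by linarith [norm_nonneg z])
  have key := integral_sqNorm_sub_one_mul_cexp hFy (fun ζ z => hd ζ z y) (w 0)
  simp only [hp, Complex.exp_add, Fin.cons_zero, ← mul_assoc]
  rw [integral_mul_const, integral_mul_const, key]
  ring

/-! ### The edge amplitude -/

/-- The coefficient of `s ^ (2 * j)` in the edge amplitude. -/
noncomputable def edgeCoeff (j : ℕ) : ℝ := (((j + 1).factorial : ℝ) ^ 2 * ((2 * j).factorial))⁻¹

/-- The edge amplitude as a function of `s = ∑ₗ ⟨xₗ|yₗ]`. -/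
noncomputable def edgeFun (s : ℂ) : ℂ := hypergeometric03 2 2 (1 / 2) (s ^ 2 / 4)

theorem ascPochhammer_two (k : ℕ) : (ascPochhammer ℂ k).eval 2 = (k + 1).factorial := by
  induction k with
  | zero => simp
  | succ k ih => rw [ascPochhammer_succ_eval, ih, Nat.factorial_succ (k + 1)]; push_cast; ring

theorem ascPochhammer_half (k : ℕ) :
    (ascPochhammer ℂ k).eval (1 / 2) * (k.factorial : ℂ) * 4 ^ k = (2 * k).factorial := by
  induction k with
  | zero => simp
  | succ k ih =>
    rw [ascPochhammer_succ_eval, show 2 * (k + 1) = 2 * k + 1 + 1 by ring,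
      Nat.factorial_succ (2 * k + 1), Nat.factorial_succ (2 * k), Nat.factorial_succ k]
    push_cast
    rw [← ih]
    ring

/-- The duplication `4 ^ k (1/2)ₖ k! = (2 k)!` turns the hypergeometric series into one in `s ^ 2`. -/
theorem edgeFun_eq_tsum (s : ℂ) : edgeFun s = ∑' j : ℕ, (edgeCoeff j : ℂ) * s ^ (2 * j) := by
  unfold edgeFun hypergeometric03 edgeCoeff
  refine tsum_congr fun j => ?_
  rw [ascPochhammer_two, mul_assoc, eq_div_of_mul_eq (pow_ne_zero j (by norm_num)) (ascPochhammer_half j)]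
  push_cast
  rw [div_pow, ← pow_mul, mul_comm]
  have : ((2 * j).factorial : ℂ) ≠ 0 := by exact_mod_cast (2 * j).factorial_ne_zero
  field_simp

theorem edgeCoeff_nonneg (j : ℕ) : 0 ≤ edgeCoeff j := by unfold edgeCoeff; positivity

/-- The coefficients decay so fast that the edge amplitude has exponential type zero: it is bounded
by the hyperbolic cosine of `c r` for every `c > 0`. -/
theorem edgeCoeff_mul_pow_le {c r : ℝ} (hc : 0 < c) (j : ℕ) :
    edgeCoeff j * r ^ (2 * j) ≤
      Real.exp (1 / c ^ 2) * ((c * r) ^ (2 * j) / (2 * j).factorial) := by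
  have h1 : (1 / c ^ 2) ^ j / ((j + 1).factorial : ℝ) ^ 2 ≤ Real.exp (1 / c ^ 2) := by
    refine le_trans ?_ (Real.pow_div_factorial_le_exp (1 / c ^ 2) (by positivity) j)
    gcongr
    have h2 : (j.factorial : ℝ) ≤ (j + 1).factorial := by
      exact_mod_cast Nat.factorial_le (Nat.le_succ j)
    have h3 : (1 : ℝ) ≤ (j + 1).factorial := by exact_mod_cast (j + 1).factorial_pos
    nlinarith
  have h4 : edgeCoeff j * r ^ (2 * j) = ((1 / c ^ 2) ^ j / ((j + 1).factorial : ℝ) ^ 2) *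
      ((c * r) ^ (2 * j) / (2 * j).factorial) := by
    unfold edgeCoeff
    rw [mul_pow, pow_mul c, div_pow, one_pow]
    field_simp
  rw [h4]
  have : 0 ≤ (c * r) ^ (2 * j) / ((2 * j).factorial : ℝ) := by
    rw [pow_mul]; positivity
  gcongr

theorem summable_edgeCoeff (r : ℝ) : Summable fun j : ℕ => edgeCoeff j * r ^ (2 * j) :=
  Summable.of_nonneg_of_le
    (fun j => mul_nonneg (edgeCoeff_nonneg j) (by rw [pow_mul]; positivity))
    (fun j => edgeCoeff_mul_pow_le one_pos j)
    ((Real.hasSum_cosh (1 * r)).summable.mul_left _)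

theorem tsum_edgeCoeff_le {c r : ℝ} (hc : 0 < c) (hr : 0 ≤ r) :
    ∑' j : ℕ, edgeCoeff j * r ^ (2 * j) ≤ Real.exp (1 / c ^ 2) * Real.exp (c * r) := by
  refine ((summable_edgeCoeff r).tsum_le_tsum (fun j => edgeCoeff_mul_pow_le hc j)
    ((Real.hasSum_cosh (c * r)).summable.mul_left _)).trans ?_
  rw [tsum_mul_left, (Real.hasSum_cosh (c * r)).tsum_eq]
  have : Real.cosh (c * r) ≤ Real.exp (c * r) := by
    rw [Real.cosh_eq]
    have : Real.exp (-(c * r)) ≤ Real.exp (c * r) := by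
      gcongr
      have : 0 ≤ c * r := by positivity
      linarith
    linarith
  gcongr

theorem norm_edge_term (s : ℂ) (j : ℕ) :
    ‖(edgeCoeff j : ℂ) * s ^ (2 * j)‖ = edgeCoeff j * ‖s‖ ^ (2 * j) := by
  rw [norm_mul, norm_pow, Complex.norm_real, Real.norm_of_nonneg (edgeCoeff_nonneg j)]

theorem hasSum_edgeFun (s : ℂ) :
    HasSum (fun j : ℕ => (edgeCoeff j : ℂ) * s ^ (2 * j)) (edgeFun s) := by
  rw [edgeFun_eq_tsum]
  refine Summable.hasSum (Summable.of_norm ?_)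
  simp only [norm_edge_term]
  exact summable_edgeCoeff _

theorem edgeFun_ofReal (r : ℝ) :
    edgeFun r = ((∑' j : ℕ, edgeCoeff j * r ^ (2 * j) : ℝ) : ℂ) := by
  rw [edgeFun_eq_tsum]
  push_cast
  rfl

theorem norm_edgeFun_le {c : ℝ} (hc : 0 < c) (s : ℂ) :
    ‖edgeFun s‖ ≤ Real.exp (1 / c ^ 2) * Real.exp (c * ‖s‖) := by
  refine le_trans ?_ (tsum_edgeCoeff_le hc (norm_nonneg s))
  rw [edgeFun_eq_tsum]
  refine (norm_tsum_le_tsum_norm ?_).trans_eq ?_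
  · simp only [norm_edge_term]
    exact summable_edgeCoeff _
  · simp only [norm_edge_term]

theorem continuous_edgeFun : Continuous edgeFun := by
  rw [continuous_iff_continuousAt]
  intro s
  have h : ContinuousOn edgeFun (Metric.ball 0 (‖s‖ + 1)) := by
    rw [show edgeFun = fun s => ∑' j : ℕ, (edgeCoeff j : ℂ) * s ^ (2 * j) from
      funext edgeFun_eq_tsum]
    refine continuousOn_tsum (fun j => by fun_prop) (summable_edgeCoeff (‖s‖ + 1))
      fun j x hx => ?_
    rw [norm_edge_term]
    have := edgeCoeff_nonneg j
    have hx' : ‖x‖ ≤ ‖s‖ + 1 := by simpa using (Metric.mem_ball.1 hx).le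
    gcongr
  exact h.continuousAt (Metric.isOpen_ball.mem_nhds (by simp))

theorem SlowGrowth.edgeFun_comp {E : Type*} [NormedAddCommGroup E] {s : E → ℂ}
    (hs : Continuous s) {K : ℝ} (hK : 0 ≤ K) (h : ∀ x, ‖s x‖ ≤ K * ‖x‖ ^ 2) :
    SlowGrowth fun x => edgeFun (s x) := by
  refine ⟨continuous_edgeFun.comp hs, fun c hc => ⟨Real.exp (1 / (c / (K + 1)) ^ 2), fun x =>
    (norm_edgeFun_le (c := c / (K + 1)) (by positivity) (s x)).trans ?_⟩⟩
  gcongr _ * Real.exp ?_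
  calc c / (K + 1) * ‖s x‖ ≤ c / (K + 1) * (K * ‖x‖ ^ 2) := by gcongr; exact h x
    _ ≤ c / (K + 1) * ((K + 1) * ‖x‖ ^ 2) := by gcongr; linarith
    _ = _ := by field_simp

/-- Expansion of the edge amplitude under an integral. -/
theorem hasSum_integral_edgeFun {E : Type*} [NormedAddCommGroup E] [MeasurableSpace E]
    [OpensMeasurableSpace E] [SecondCountableTopology E] {μ : Measure E} (hμ : GaussianTail μ)
    {G s : E → ℂ}
    (hG : SlowGrowth G) (hs : Continuous s) {K : ℝ} (hK : 0 ≤ K)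
    (h : ∀ x, ‖s x‖ ≤ K * ‖x‖ ^ 2) :
    HasSum (fun j : ℕ => ∫ x, G x * ((edgeCoeff j : ℂ) * s x ^ (2 * j)) ∂μ)
      (∫ x, G x * edgeFun (s x) ∂μ) := by
  have hr : ∀ x, HasSum (fun j => ‖G x‖ * (edgeCoeff j * ‖s x‖ ^ (2 * j)))
      (‖G x‖ * ∑' j, (edgeCoeff j * ‖s x‖ ^ (2 * j))) := fun x =>
    ((summable_edgeCoeff ‖s x‖).hasSum).mul_left _
  refine hasSum_integral_of_dominated_convergence
    (fun j x => ‖G x‖ * (edgeCoeff j * ‖s x‖ ^ (2 * j)))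
    (fun j => (hG.1.mul (continuous_const.mul (hs.pow _))).aestronglyMeasurable)
    (fun j => ae_of_all _ fun x => by rw [norm_mul, norm_edge_term])
    (ae_of_all _ fun x => (hr x).summable) ?_
    (ae_of_all _ fun x => (hasSum_edgeFun (s x)).mul_left _)
  have hslow : SlowGrowth fun x => G x * edgeFun (‖s x‖ : ℝ) :=
    hG.mul (SlowGrowth.edgeFun_comp (Complex.continuous_ofReal.comp hs.norm) hK fun x => by
      simpa using h x)
  refine (hslow.integrable hμ).norm.congr (ae_of_all _ fun x => ?_)
  beta_reduce
  rw [(hr x).tsum_eq, norm_mul, edgeFun_ofReal, Complex.norm_real, Real.norm_of_nonneg]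
  exact tsum_nonneg fun j => mul_nonneg (edgeCoeff_nonneg j) (by positivity)

/-! ### The intertwiner kernel -/

theorem angleTerm_eq (z ξ : Fin 3 → Spinor) : angleTerm z ξ =
    holBraket (z 0) (z 1) * holBraket (ξ 0) (ξ 1) + holBraket (z 1) (z 2) * holBraket (ξ 1) (ξ 2) +
      holBraket (z 2) (z 0) * holBraket (ξ 2) (ξ 0) := by
  simp only [angleTerm, Fin.sum_univ_three]
  rfl

/-- The part of the angle term that involves the side `0`. -/
noncomputable def hubTerm (x ξ : Fin 3 → Spinor) : ℂ :=
  holBraket (x 0) (x 1) * holBraket (ξ 0) (ξ 1) + holBraket (x 2) (x 0) * holBraket (ξ 2) (ξ 0)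

/-- The part of the angle term that does not involve the side `0`. -/
noncomputable def rimTerm (x ξ : Fin 3 → Spinor) : ℂ :=
  holBraket (x 1) (x 2) * holBraket (ξ 1) (ξ 2)

theorem angleTerm_eq_add (x ξ : Fin 3 → Spinor) : angleTerm x ξ = hubTerm x ξ + rimTerm x ξ := by
  rw [angleTerm_eq, hubTerm, rimTerm]; ring

/-- The `k`-th term of the exponential series of `h + r`, in which every monomial is weighted by
one plus its degree in `h`. -/
noncomputable def weightedPow (k : ℕ) (h r : ℂ) : ℂ :=
  ∑ m ∈ Finset.HasAntidiagonal.antidiagonal k,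
    ((m.1 : ℂ) + 1) * (h ^ m.1 / m.1.factorial * (r ^ m.2 / m.2.factorial))

theorem add_pow_div_factorial (k : ℕ) (h r : ℂ) :
    (h + r) ^ k / k.factorial = ∑ m ∈ Finset.HasAntidiagonal.antidiagonal k,
      (h ^ m.1 / m.1.factorial * (r ^ m.2 / m.2.factorial)) := by
  rw [(Commute.all h r).add_pow', Finset.sum_div]
  refine Finset.sum_congr rfl fun m hm => ?_
  rw [Finset.HasAntidiagonal.mem_antidiagonal] at hm
  have h1 : (k.choose m.1 : ℂ) * (m.1.factorial * m.2.factorial) = k.factorial := by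
    rw [← hm]
    exact_mod_cast (by
      rw [← mul_assoc, Nat.add_comm m.1, mul_right_comm]
      exact Nat.add_choose_mul_factorial_mul_factorial _ _)
  have h2 : (k.factorial : ℂ) ≠ 0 := by exact_mod_cast k.factorial_ne_zero
  have h3 : (m.1.factorial : ℂ) ≠ 0 := by exact_mod_cast m.1.factorial_ne_zero
  have h4 : (m.2.factorial : ℂ) ≠ 0 := by exact_mod_cast m.2.factorial_ne_zero
  rw [nsmul_eq_mul]
  field_simp
  linear_combination h ^ m.1 * r ^ m.2 * h1

theorem weightedPow_mul (k : ℕ) (c h r : ℂ) :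
    weightedPow k (c * h) (c * r) = c ^ k * weightedPow k h r := by
  unfold weightedPow
  rw [Finset.mul_sum]
  refine Finset.sum_congr rfl fun m hm => ?_
  rw [Finset.HasAntidiagonal.mem_antidiagonal] at hm
  rw [← hm, mul_pow, mul_pow, pow_add]
  ring

/-- The matrix with columns `|z⟩` and `|z]` applied to `v`. The matrix has determinant `⟨z|z⟩`;
divided by the norm of `z` it is the general element of `SU(2)`. -/
noncomputable def frame (z v : Spinor) : Spinor := v 0 • z + v 1 • dual z

theorem frame_zero (z v : Spinor) : frame z v 0 = v 0 * z 0 - v 1 * star (z 1) := by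
  simp only [frame, Pi.add_apply, Pi.smul_apply, smul_eq_mul, dual]
  simp
  ring

theorem frame_one (z v : Spinor) : frame z v 1 = v 0 * z 1 + v 1 * star (z 0) := by
  simp only [frame, Pi.add_apply, Pi.smul_apply, smul_eq_mul, dual]
  simp

theorem holBraket_frame (z v w : Spinor) :
    holBraket (frame z v) (frame z w) = sqNorm z * holBraket v w := by
  rw [← braket_self]
  simp only [holBraket_apply, frame_zero, frame_one, braket]
  ring

theorem hubTerm_frame (z : Spinor) (x ξ : Fin 3 → Spinor) :
    hubTerm (fun i => frame z (x i)) ξ = sqNorm z * hubTerm x ξ := by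
  simp only [hubTerm, holBraket_frame]; ring

theorem rimTerm_frame (z : Spinor) (x ξ : Fin 3 → Spinor) :
    rimTerm (fun i => frame z (x i)) ξ = sqNorm z * rimTerm x ξ := by
  simp only [rimTerm, holBraket_frame]; ring

theorem slowGrowth_frame {E : Type*} [NormedAddCommGroup E] {z : E → Spinor}
    (hz : ∀ j, SlowGrowth fun x => z x j) (v : Spinor) (j : Fin 2) :
    SlowGrowth fun x => frame (z x) v j := by
  have : (fun x => frame (z x) v j) = fun x => v 0 * z x j + v 1 * dual (z x) j := by
    ext x; simp [frame]
  rw [this]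
  exact ((SlowGrowth.const _).mul (hz j)).add
    ((SlowGrowth.const _).mul (SlowGrowth.dual hz j))

/-- Integral representation of the intertwiner kernel: an average over `SU(2)`, written as a
Gaussian average over the spinor that parametrizes the group element. -/
theorem angleTerm_pow_div_factorial (k : ℕ) (y η : Fin 3 → Spinor) :
    ∫ z, (∑ i, holBraket (y i) (frame z (η i))) ^ (2 * k) / ((2 * k).factorial : ℂ)
      ∂spinorMeasure = angleTerm y η ^ k / k.factorial := by
  -- the holomorphic and the anti-holomorphic part of the integrand
  set α : Spinor := ∑ i, η i 1 • y i with hα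
  set β : Spinor → ℂ := fun z => ∑ i, η i 0 * holBraket (y i) z with hβ
  have hsum : ∀ z, ∑ i, holBraket (y i) (frame z (η i)) = β z + braket z α := fun z => by
    simp only [hβ, hα, Fin.sum_univ_three, holBraket_apply, frame_zero, frame_one, braket,
      Pi.add_apply, Pi.smul_apply, smul_eq_mul]
    ring
  have hval : β α = angleTerm y η := by
    rw [angleTerm_eq]
    simp only [hβ, hα, Fin.sum_univ_three, holBraket_apply, Pi.add_apply, Pi.smul_apply,
      smul_eq_mul]
    ring
  have hβs : SlowGrowth β := SlowGrowth.sum _ fun i _ =>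
    (SlowGrowth.const _).mul (SlowGrowth.holBraket (fun j => SlowGrowth.const (y i j))
      slowGrowth_spinor_apply)
  have hαs : SlowGrowth fun z => braket z α :=
    SlowGrowth.braket (z := fun _ => α) slowGrowth_spinor_apply fun j => SlowGrowth.const (α j)
  have hβh : ∀ (ζ : ℂ) z, β (ζ • z) = ζ * β z := fun ζ z => by
    simp only [hβ, Finset.mul_sum, holBraket_apply]
    refine Finset.sum_congr rfl fun i _ => ?_
    simp
    ring
  have hβd : Differentiable ℂ fun z => β z ^ k := by
    simp only [hβ, holBraket_apply]
    fun_prop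
  -- of the binomial expansion only the middle term is of equal degree in `z` and its conjugate
  simp_rw [hsum]
  rw [integral_div]
  simp_rw [add_pow]
  rw [integral_finsetSum _ fun m _ => (((hβs.pow m).mul (hαs.pow (2 * k - m))).mul
    (SlowGrowth.const _)).integrable gaussianTail_spinor]
  rw [Finset.sum_eq_single k]
  · have h1 := integral_mul_braket_pow (hβs.pow k) hβd (n := k)
      (fun ζ _ z => by rw [hβh, mul_pow]) α
    simp_rw [← mul_div_assoc] at h1
    rw [integral_div] at h1
    have hk : (k.factorial : ℂ) ≠ 0 := by exact_mod_cast k.factorial_ne_zero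
    rw [div_eq_iff hk, hval] at h1
    rw [integral_mul_const, show 2 * k - k = k by lia, h1]
    have h2 : ((2 * k).choose k : ℂ) * (k.factorial * k.factorial) = (2 * k).factorial := by
      have := Nat.add_choose_mul_factorial_mul_factorial k k
      rw [← two_mul, mul_assoc] at this
      exact_mod_cast this
    have h3 : ((2 * k).factorial : ℂ) ≠ 0 := by exact_mod_cast (2 * k).factorial_ne_zero
    field_simp
    linear_combination angleTerm y η ^ k * h2
  · intro m hm hmk
    refine integral_spinor_eq_zero_of_phase (m := 2 * k - m) (n := m) (by
      have := Finset.mem_range.1 hm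
      lia) fun ζ hζ z => ?_
    rw [hβh, braket_smul_left]
    ring
  · intro h
    exact absurd (Finset.mem_range.2 (by lia)) h

/-! ### The action of the amplitudes on a pair of intertwiner kernels -/

/-- The argument `∑ₗ ⟨xₗ|yₗ]` of the edge amplitude, for sides that are identified if they have
the same label. -/
noncomputable def foldTerm (x y : Fin 3 → Spinor) : ℂ := ∑ i, antiBraket (x i) (y i)

theorem foldTerm_eq (x y : Fin 3 → Spinor) : foldTerm x y = -pairing y fun i => dual (x i) := by
  simp only [foldTerm, pairing, ← Finset.sum_neg_distrib]
  refine Finset.sum_congr rfl fun i _ => ?_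
  rw [← antiBraket, antiBraket_swap]

theorem continuous_foldTerm :
    Continuous fun p : (Fin 3 → Spinor) × (Fin 3 → Spinor) => foldTerm p.1 p.2 := by
  simp only [foldTerm, antiBraket_apply]
  fun_prop

theorem norm_foldTerm_le (p : (Fin 3 → Spinor) × (Fin 3 → Spinor)) :
    ‖foldTerm p.1 p.2‖ ≤ 6 * ‖p‖ ^ 2 := by
  have hd : ∀ z : Spinor, ‖dual z‖ ≤ ‖z‖ := fun z => by
    refine (pi_norm_le_iff_of_nonneg (norm_nonneg _)).2 fun i => ?_
    fin_cases i
    · simpa [dual] using norm_le_pi_norm z 1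
    · simpa [dual] using norm_le_pi_norm z 0
  calc ‖foldTerm p.1 p.2‖ ≤ ∑ i, ‖antiBraket (p.1 i) (p.2 i)‖ := norm_sum_le _ _
    _ ≤ ∑ _i : Fin 3, 2 * ‖p‖ * ‖p‖ := by
        refine Finset.sum_le_sum fun i _ => (norm_braket_le_mul _ _).trans ?_
        gcongr
        · exact (norm_le_pi_norm p.1 i).trans (norm_fst_le p)
        · exact (hd _).trans ((norm_le_pi_norm p.2 i).trans (norm_snd_le p))
    _ = _ := by simp; ring

theorem slowGrowth_fst_apply {E : Type*} [NormedAddCommGroup E] (i : Fin 3) (j : Fin 2) :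
    SlowGrowth fun p : (Fin 3 → Spinor) × E => p.1 i j :=
  (slowGrowth_apply i j).comp continuous_fst (a := 0) (b := 1) fun p => by
    simpa using norm_fst_le p

theorem slowGrowth_snd_apply {E : Type*} [NormedAddCommGroup E] (i : Fin 3) (j : Fin 2) :
    SlowGrowth fun p : E × (Fin 3 → Spinor) => p.2 i j :=
  (slowGrowth_apply i j).comp continuous_snd (a := 0) (b := 1) fun p => by
    simpa using norm_snd_le p

theorem slowGrowth_snd_spinor {E : Type*} [NormedAddCommGroup E] (j : Fin 2) :
    SlowGrowth fun p : E × Spinor => p.2 j :=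
  (slowGrowth_spinor_apply j).comp continuous_snd (a := 0) (b := 1) fun p => by
    simpa using norm_snd_le p

theorem SlowGrowth.sqNorm {E : Type*} [NormedAddCommGroup E] {z : E → Spinor}
    (hz : ∀ j, SlowGrowth fun x => z x j) : SlowGrowth fun x => (sqNorm (z x) : ℂ) := by
  simp only [← braket_self]
  exact SlowGrowth.braket hz hz

theorem angleTerm_smul (c : ℂ) (x ξ : Fin 3 → Spinor) :
    angleTerm (c • x) ξ = c ^ 2 * angleTerm x ξ := by
  simp only [angleTerm_eq, holBraket_apply, Pi.smul_apply, smul_eq_mul]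
  ring

theorem angleTerm_dual_smul (c : ℂ) (x ξ : Fin 3 → Spinor) :
    angleTerm (fun i => dual ((c • x) i)) ξ =
      star c ^ 2 * angleTerm (fun i => dual (x i)) ξ := by
  simp only [angleTerm_eq, holBraket_apply, Pi.smul_apply, smul_eq_mul, dual]
  simp
  ring

theorem differentiable_hubTerm (ξ : Fin 3 → Spinor) :
    Differentiable ℂ fun x => hubTerm x ξ := by
  simp only [hubTerm, holBraket_apply]; fun_prop

theorem differentiable_rimTerm (ξ : Fin 3 → Spinor) :
    Differentiable ℂ fun x => rimTerm x ξ := by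
  simp only [rimTerm, holBraket_apply]; fun_prop

theorem differentiable_angleTerm (ξ : Fin 3 → Spinor) :
    Differentiable ℂ fun x => angleTerm x ξ := by
  simp only [angleTerm_eq, holBraket_apply]; fun_prop

theorem slowGrowth_angleTerm (ξ : Fin 3 → Spinor) : SlowGrowth fun x => angleTerm x ξ :=
  SlowGrowth.angleTerm (z := fun _ => ξ) slowGrowth_apply fun i j => SlowGrowth.const (ξ i j)

theorem slowGrowth_hubTerm (ξ : Fin 3 → Spinor) : SlowGrowth fun x => hubTerm x ξ :=
  ((SlowGrowth.holBraket (slowGrowth_apply 0) (slowGrowth_apply 1)).mul (SlowGrowth.const _)).add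
    ((SlowGrowth.holBraket (slowGrowth_apply 2) (slowGrowth_apply 0)).mul (SlowGrowth.const _))

theorem slowGrowth_rimTerm (ξ : Fin 3 → Spinor) : SlowGrowth fun x => rimTerm x ξ :=
  (SlowGrowth.holBraket (slowGrowth_apply 1) (slowGrowth_apply 2)).mul (SlowGrowth.const _)

theorem slowGrowth_face : SlowGrowth fun x : Fin 3 → Spinor => (sqNorm (x 0) : ℂ) - 1 :=
  (SlowGrowth.sqNorm (slowGrowth_apply 0)).sub (SlowGrowth.const 1)

/-- Integration over the spinors of the second triangle: the power of `∑ₗ ⟨xₗ|yₗ]` reproduces the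
kernel at the dual spinors of the first one. -/
theorem integral_angleTerm_mul_foldTerm (k j : ℕ) (x η : Fin 3 → Spinor) :
    ∫ y, angleTerm y η ^ k / k.factorial * foldTerm x y ^ (2 * j) ∂triangleMeasure =
      if j = k then (2 * k).factorial * (angleTerm (fun i => dual (x i)) η ^ k / k.factorial)
      else 0 := by
  have hs : ∀ y, foldTerm x y ^ (2 * j) = pairing y (fun i => dual (x i)) ^ (2 * j) := fun y => by
    rw [foldTerm_eq, pow_mul, neg_sq, ← pow_mul]
  simp_rw [hs]
  split_ifs with h
  · subst h
    have := integral_mul_pairing_pow (((slowGrowth_angleTerm η).pow j).div_const j.factorial)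
      (by have := differentiable_angleTerm η; fun_prop) (n := 2 * j)
      (fun ζ _ y => by rw [angleTerm_smul]; ring) fun i => dual (x i)
    simp_rw [← mul_div_assoc] at this
    rw [integral_div, div_eq_iff (by exact_mod_cast (2 * j).factorial_ne_zero)] at this
    unfold triangleMeasure
    rw [this]
    ring
  · refine integral_pi_eq_zero_of_phase (m := 2 * j) (n := 2 * k) (by lia) fun ζ _ y => ?_
    rw [angleTerm_smul, pairing_smul_left]
    ring

/-- Integration over the spinors of the first triangle: the kernel is reproduced, and the face
amplitude of side `0` weights each monomial by its degree in that side. -/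
theorem integral_face_mul_angleTerm_pow (k : ℕ) (ξ w : Fin 3 → Spinor) :
    ∫ x, (((sqNorm (x 0) : ℂ) - 1) * (angleTerm x ξ ^ k / k.factorial)) *
      (pairing x w ^ (2 * k) / (2 * k).factorial) ∂triangleMeasure =
      weightedPow k (hubTerm w ξ) (rimTerm w ξ) := by
  unfold triangleMeasure
  rw [integral_mul_cexp_pairing_eq
    (slowGrowth_face.mul (((slowGrowth_angleTerm ξ).pow k).div_const _))
    (fun ζ hζ x => by
      rw [angleTerm_smul, Pi.smul_apply, sqNorm_smul, hζ]
      push_cast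
      ring)]
  have hF : ∀ m : ℕ × ℕ, SlowGrowth fun x : Fin 3 → Spinor =>
      hubTerm x ξ ^ m.1 / m.1.factorial * (rimTerm x ξ ^ m.2 / m.2.factorial) := fun m =>
    (((slowGrowth_hubTerm ξ).pow _).div_const _).mul (((slowGrowth_rimTerm ξ).pow _).div_const _)
  have hd : ∀ m : ℕ × ℕ, Differentiable ℂ fun x : Fin 3 → Spinor =>
      hubTerm x ξ ^ m.1 / m.1.factorial * (rimTerm x ξ ^ m.2 / m.2.factorial) := fun m => by
    have h1 := differentiable_hubTerm ξ
    have h2 := differentiable_rimTerm ξ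
    fun_prop
  simp_rw [angleTerm_eq_add, add_pow_div_factorial, Finset.mul_sum, Finset.sum_mul]
  rw [integral_finsetSum _ fun m _ =>
    ((slowGrowth_face.mul (hF m)).mul (slowGrowth_cexp_pairing w)).integrable gaussianTail_pi]
  refine Finset.sum_congr rfl fun m _ => ?_
  refine integral_sqNorm_sub_one_mul_cexp_pairing (hF m) (hd m) (fun ζ z y => ?_) w
  have h1 : ∀ u : Spinor, hubTerm (Fin.cons u y) ξ = holBraket u (y 0) * holBraket (ξ 0) (ξ 1) +
      holBraket (y 1) u * holBraket (ξ 2) (ξ 0) := fun u => rfl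
  have h2 : ∀ u : Spinor, rimTerm (Fin.cons u y) ξ =
      holBraket (y 0) (y 1) * holBraket (ξ 1) (ξ 2) := fun u => rfl
  have h3 : hubTerm (Fin.cons (ζ • z) y) ξ = ζ * hubTerm (Fin.cons z y) ξ := by
    rw [h1, h1]
    simp only [holBraket_apply, Pi.smul_apply, smul_eq_mul]
    ring
  rw [h3, h2, h2, mul_pow]
  ring

/-- The second kernel is written as a Gaussian average of powers of a pairing with `x`, against
which the first kernel is reproduced. -/
theorem integral_face_mul_angleTerm_mul_dual (k₁ k₂ : ℕ) (ξ η : Fin 3 → Spinor) :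
    ∫ x, ((sqNorm (x 0) : ℂ) - 1) * (angleTerm x ξ ^ k₁ / k₁.factorial) *
      (angleTerm (fun i => dual (x i)) η ^ k₂ / k₂.factorial) ∂triangleMeasure =
      if k₁ = k₂ then (k₁ + 1).factorial * weightedPow k₁ (hubTerm η ξ) (rimTerm η ξ) else 0 := by
  split_ifs with h
  · subst h
    have hrep : ∀ x : Fin 3 → Spinor, angleTerm (fun i => dual (x i)) η ^ k₁ / k₁.factorial =
        ∫ z, pairing x (fun i => frame z (η i)) ^ (2 * k₁) / ((2 * k₁).factorial : ℂ)
          ∂spinorMeasure := fun x => by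
      rw [← angleTerm_pow_div_factorial]
      refine integral_congr_ae (ae_of_all _ fun z => ?_)
      simp only [holBraket_dual_left, Finset.sum_neg_distrib]
      rw [pow_mul, neg_sq, ← pow_mul]
      rfl
    have hslow : SlowGrowth fun p : (Fin 3 → Spinor) × Spinor =>
        (((sqNorm (p.1 0) : ℂ) - 1) * (angleTerm p.1 ξ ^ k₁ / k₁.factorial)) *
        (pairing p.1 (fun i => frame p.2 (η i)) ^ (2 * k₁) / ((2 * k₁).factorial : ℂ)) := by
      refine (((SlowGrowth.sqNorm (slowGrowth_fst_apply 0)).sub (SlowGrowth.const 1)).mul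
        (((SlowGrowth.angleTerm (z := fun _ => ξ) slowGrowth_fst_apply
          fun i j => SlowGrowth.const (ξ i j)).pow _).div_const _)).mul
        (((SlowGrowth.sum _ fun i _ => ?_).pow _).div_const _)
      exact SlowGrowth.braket (slowGrowth_fst_apply i)
        (slowGrowth_frame slowGrowth_snd_spinor (η i))
    simp_rw [hrep, ← integral_const_mul]
    rw [integral_integral_swap]
    swap
    · exact hslow.integrable (gaussianTail_triangle.prod gaussianTail_spinor)
    simp_rw [integral_face_mul_angleTerm_pow, hubTerm_frame, rimTerm_frame, weightedPow_mul]
    rw [integral_mul_const, integral_sqNorm_pow]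
  · refine integral_pi_eq_zero_of_phase (m := 2 * k₂) (n := 2 * k₁) (by lia) fun ζ hζ x => ?_
    rw [angleTerm_smul, angleTerm_dual_smul, Pi.smul_apply, sqNorm_smul, hζ]
    push_cast
    ring

theorem hubTerm_swap (x ξ : Fin 3 → Spinor) : hubTerm x ξ = hubTerm ξ x := by
  simp only [hubTerm]; ring

theorem rimTerm_swap (x ξ : Fin 3 → Spinor) : rimTerm x ξ = rimTerm ξ x := by
  simp only [rimTerm]; ring

/-- The effect of the edge and face amplitudes on a pair of intertwiners: total spins that differ
are projected out, and equal ones are joined. -/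
theorem integral_amplitudes (k₁ k₂ : ℕ) (ξ η : Fin 3 → Spinor) :
    ∫ p : (Fin 3 → Spinor) × (Fin 3 → Spinor),
      (angleTerm p.1 ξ ^ k₁ / k₁.factorial * (angleTerm p.2 η ^ k₂ / k₂.factorial) *
        ((sqNorm (p.1 0) : ℂ) - 1)) * edgeFun (foldTerm p.1 p.2)
      ∂triangleMeasure.prod triangleMeasure =
      if k₁ = k₂ then weightedPow k₁ (hubTerm ξ η) (rimTerm ξ η) / (k₁ + 1).factorial else 0 := by
  have hA : SlowGrowth fun p : (Fin 3 → Spinor) × (Fin 3 → Spinor) =>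
      angleTerm p.1 ξ ^ k₁ / k₁.factorial * (angleTerm p.2 η ^ k₂ / k₂.factorial) *
        ((sqNorm (p.1 0) : ℂ) - 1) :=
    ((((SlowGrowth.angleTerm (z := fun _ => ξ) slowGrowth_fst_apply
      fun i j => SlowGrowth.const (ξ i j)).pow _).div_const _).mul
      (((SlowGrowth.angleTerm (z := fun _ => η) slowGrowth_snd_apply
      fun i j => SlowGrowth.const (η i j)).pow _).div_const _)).mul
      ((SlowGrowth.sqNorm (slowGrowth_fst_apply 0)).sub (SlowGrowth.const 1))
  have hs : SlowGrowth fun p : (Fin 3 → Spinor) × (Fin 3 → Spinor) => foldTerm p.1 p.2 :=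
    SlowGrowth.sum _ fun i _ => SlowGrowth.antiBraket (slowGrowth_fst_apply i)
      (slowGrowth_snd_apply i)
  have htail := gaussianTail_triangle.prod gaussianTail_triangle
  have hsum := hasSum_integral_edgeFun htail hA continuous_foldTerm (K := 6) (by norm_num)
    norm_foldTerm_le
  have hterm : ∀ j, ∫ p : (Fin 3 → Spinor) × (Fin 3 → Spinor),
      (angleTerm p.1 ξ ^ k₁ / k₁.factorial * (angleTerm p.2 η ^ k₂ / k₂.factorial) *
        ((sqNorm (p.1 0) : ℂ) - 1)) * ((edgeCoeff j : ℂ) * foldTerm p.1 p.2 ^ (2 * j))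
      ∂triangleMeasure.prod triangleMeasure =
      if j = k₂ then
        (if k₁ = k₂ then weightedPow k₁ (hubTerm ξ η) (rimTerm ξ η) / (k₁ + 1).factorial else 0)
      else 0 := fun j => by
    rw [integral_prod _ ((hA.mul ((SlowGrowth.const _).mul (hs.pow _))).integrable htail)]
    have hin : ∀ x, ∫ y, (angleTerm x ξ ^ k₁ / k₁.factorial *
        (angleTerm y η ^ k₂ / k₂.factorial) * ((sqNorm (x 0) : ℂ) - 1)) *
          ((edgeCoeff j : ℂ) * foldTerm x y ^ (2 * j)) ∂triangleMeasure =
        ((sqNorm (x 0) : ℂ) - 1) * (angleTerm x ξ ^ k₁ / k₁.factorial) * edgeCoeff j *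
          ∫ y, angleTerm y η ^ k₂ / k₂.factorial * foldTerm x y ^ (2 * j) ∂triangleMeasure :=
      fun x => by
        rw [← integral_const_mul]
        refine integral_congr_ae (ae_of_all _ fun y => ?_)
        beta_reduce
        ring
    simp_rw [hin, integral_angleTerm_mul_foldTerm]
    by_cases hj : j = k₂
    · subst hj
      simp only [if_true]
      have hx : ∀ x : Fin 3 → Spinor,
          ((sqNorm (x 0) : ℂ) - 1) * (angleTerm x ξ ^ k₁ / k₁.factorial) * edgeCoeff j *
            ((2 * j).factorial * (angleTerm (fun i => dual (x i)) η ^ j / j.factorial)) =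
          (edgeCoeff j * (2 * j).factorial) *
            (((sqNorm (x 0) : ℂ) - 1) * (angleTerm x ξ ^ k₁ / k₁.factorial) *
              (angleTerm (fun i => dual (x i)) η ^ j / j.factorial)) := fun x => by ring
      simp_rw [hx]
      rw [integral_const_mul, integral_face_mul_angleTerm_mul_dual]
      split_ifs with h
      · subst h
        have h1 : ((2 * k₁).factorial : ℂ) ≠ 0 := by
          exact_mod_cast (2 * k₁).factorial_ne_zero
        have h2 : ((k₁ + 1).factorial : ℂ) ≠ 0 := by
          exact_mod_cast (k₁ + 1).factorial_ne_zero
        rw [hubTerm_swap η, rimTerm_swap η, edgeCoeff]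
        push_cast
        field_simp
      · simp
    · simp [hj]
  simp_rw [hterm] at hsum
  rw [← hsum.tsum_eq, tsum_ite_eq]

/-! ### Decomposition of the exponential into characters -/

section Ballot

variable {h : ℕ → ℂ} {τ Δ : ℂ}

/-- The contribution of the representation of highest weight `n - 2 b` to `τ ^ n / n!`, where `h m`
is the character of the `m`-th symmetric power of a matrix of trace `τ` and determinant `Δ`. -/
noncomputable def ballotTerm (h : ℕ → ℂ) (Δ : ℂ) (n b : ℕ) : ℂ :=
  if 2 * b ≤ n then ((n - 2 * b : ℕ) + 1) * h (n - 2 * b) * Δ ^ b /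
    (b.factorial * (n - b + 1).factorial) else 0

theorem ballotTerm_add (h : ℕ → ℂ) (Δ : ℂ) (d b : ℕ) : ballotTerm h Δ (d + 2 * b) b =
    (d + 1) * h d * Δ ^ b / (b.factorial * (d + b + 1).factorial) := by
  unfold ballotTerm
  rw [if_pos (by omega), show d + 2 * b - 2 * b = d by omega, show d + 2 * b - b = d + b by omega]

/-- Multiplication by the character `τ` of the defining representation raises and lowers the
highest weight by one; the ballot numbers satisfy the resulting recursion. -/
theorem sum_ballotTerm (h0 : h 0 = 1) (h1 : h 1 = τ)
    (hrec : ∀ m, h (m + 2) = τ * h (m + 1) - Δ * h m) (n : ℕ) :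
    ∑ b ∈ Finset.range (n + 1), ballotTerm h Δ n b = τ ^ n / n.factorial := by
  induction n with
  | zero => simp [ballotTerm, h0]
  | succ n ih =>
    -- the two parts of `τ * ballotTerm h Δ n b`
    let up : ℕ → ℂ := fun b => if 2 * b ≤ n then ((n - 2 * b : ℕ) + 1) * h (n - 2 * b + 1) * Δ ^ b /
      (b.factorial * (n - b + 1).factorial) else 0
    let down : ℕ → ℂ := fun b => if 2 * b + 1 ≤ n then
      ((n - 2 * b : ℕ) + 1) * h (n - 2 * b - 1) * Δ ^ (b + 1) /
      (b.factorial * (n - b + 1).factorial) else 0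
    have hτ : ∀ b, τ * ballotTerm h Δ n b = up b + down b := fun b => by
      by_cases hb : 2 * b ≤ n
      · obtain ⟨j, rfl⟩ := Nat.exists_eq_add_of_le hb
        rcases j with _ | j
        · simp only [ballotTerm, up, down, add_zero, le_refl, if_true, Nat.sub_self, h0, h1,
            Nat.not_succ_le_self, if_false, zero_add]
          ring
        · simp only [ballotTerm, up, down]
          rw [if_pos (by omega), if_pos (by omega), if_pos (by omega),
            show 2 * b + (j + 1) - 2 * b = j + 1 by omega, show j + 1 - 1 = j by omega, hrec]
          ring
      · simp only [ballotTerm, up, down]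
        rw [if_neg hb, if_neg hb, if_neg (by omega)]
        ring
    have hz : ((n : ℂ) + 1) * ballotTerm h Δ (n + 1) 0 = up 0 := by
      have : ((n + 1).factorial : ℂ) ≠ 0 := by exact_mod_cast (n + 1).factorial_ne_zero
      have h' : ((n : ℂ) + 2) ≠ 0 := by exact_mod_cast (n + 1).succ_ne_zero
      simp only [ballotTerm, up, Nat.zero_le, if_true, mul_zero, Nat.sub_zero, pow_zero,
        Nat.factorial_zero]
      rw [Nat.factorial_succ (n + 1)]
      push_cast
      rw [show (n : ℂ) + 1 + 1 = n + 2 by ring]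
      field_simp
    have hs : ∀ b, ((n : ℂ) + 1) * ballotTerm h Δ (n + 1) (b + 1) = up (b + 1) + down b :=
        fun b => by
      by_cases hb : 2 * b + 1 ≤ n
      · obtain ⟨j, rfl⟩ := Nat.exists_eq_add_of_le hb
        have hup : up (b + 1) = j * h j * Δ ^ (b + 1) /
            ((b + 1).factorial * (b + j + 1).factorial) := by
          rcases j with _ | j
          · simp only [up]
            rw [if_neg (by omega)]
            simp
          · simp only [up]
            rw [if_pos (by omega), show 2 * b + 1 + (j + 1) - 2 * (b + 1) = j by omega,
              show 2 * b + 1 + (j + 1) - (b + 1) = b + (j + 1) by omega]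
            push_cast
            ring
        have hdown : down b = (j + 2) * h j * Δ ^ (b + 1) /
            (b.factorial * (b + j + 2).factorial) := by
          simp only [down]
          rw [if_pos (by omega), show 2 * b + 1 + j - 2 * b - 1 = j by omega,
            show 2 * b + 1 + j - 2 * b = j + 1 by omega,
            show 2 * b + 1 + j - b + 1 = b + j + 2 by omega]
          push_cast
          ring
        have hG : ballotTerm h Δ (2 * b + 1 + j + 1) (b + 1) = (j + 1) * h j * Δ ^ (b + 1) /
            ((b + 1).factorial * (b + j + 2).factorial) := by
          rw [show 2 * b + 1 + j + 1 = j + 2 * (b + 1) by omega, ballotTerm_add,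
            show j + (b + 1) + 1 = b + j + 2 by omega]
        have e1 : (b.factorial : ℂ) ≠ 0 := by exact_mod_cast b.factorial_ne_zero
        have e2 : ((b + j + 1).factorial : ℂ) ≠ 0 := by
          exact_mod_cast (b + j + 1).factorial_ne_zero
        have e3 : ((b : ℂ) + 1) ≠ 0 := by exact_mod_cast b.succ_ne_zero
        have e4 : ((b : ℂ) + j + 2) ≠ 0 := by exact_mod_cast (b + j + 1).succ_ne_zero
        rw [hup, hdown, hG, Nat.factorial_succ b, Nat.factorial_succ (b + j + 1)]
        push_cast
        rw [show (b : ℂ) + j + 1 + 1 = b + j + 2 by ring]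
        field_simp
        ring
      · simp only [ballotTerm, up, down]
        rw [if_neg (by omega), if_neg (by omega), if_neg hb]
        ring
    have hlast : up (n + 1) = 0 := by
      simp only [up]
      rw [if_neg (by omega)]
    have hn : ((n : ℂ) + 1) ≠ 0 := by exact_mod_cast n.succ_ne_zero
    have hf : (n.factorial : ℂ) ≠ 0 := by exact_mod_cast n.factorial_ne_zero
    have key : ((n : ℂ) + 1) * ∑ b ∈ Finset.range (n + 1 + 1), ballotTerm h Δ (n + 1) b =
        τ * ∑ b ∈ Finset.range (n + 1), ballotTerm h Δ n b := by
      rw [Finset.mul_sum, Finset.mul_sum, Finset.sum_range_succ', hz]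
      simp_rw [hs, hτ]
      rw [Finset.sum_add_distrib, Finset.sum_add_distrib]
      have := Finset.sum_range_succ' up (n + 1)
      rw [Finset.sum_range_succ, hlast] at this
      linear_combination -this
    rw [ih] at key
    rw [Nat.factorial_succ]
    push_cast
    field_simp at key ⊢
    linear_combination key

/-- The joint contribution of the degrees `d` and `b` of the hub and rim terms, `h d` being the
`d`-th character and `Δ` the determinant. -/
noncomputable def gluedTerm (h : ℕ → ℂ) (Δ : ℂ) (m : ℕ × ℕ) : ℂ :=
  (m.1 + 1) * h m.1 * Δ ^ m.2 / (m.2.factorial * (m.1 + m.2 + 1).factorial)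

theorem add_one_le_four_mul (d : ℕ) : (d : ℝ) + 1 ≤ 4 * (5 / 4) ^ d := by
  have := one_add_mul_le_pow (a := (1 / 4 : ℝ)) (by norm_num) d
  rw [show (1 : ℝ) + 1 / 4 = 5 / 4 by norm_num] at this
  linarith

/-- The bound on `gluedTerm` in terms of the total degree and the rim degree. -/
noncomputable def gluedBound (t : ℝ) (m : ℕ × ℕ) : ℝ :=
  4 * ((5 / 4 * t) ^ m.1 / m.1.factorial * ((t / 5) ^ m.2 / m.2.factorial))

/-- The dimension factors cost a factor `5 / 4` in `t`, by `d + 1 ≤ 4 (5 / 4) ^ d`; the bound on `Δ`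
is split as `t ^ 2 / 4 = (5 / 4 t) (t / 5)`, so that `5 / 4 t` occurs to the power `d + b`. -/
theorem norm_gluedTerm_le {t : ℝ} (ht : 0 ≤ t) (hh : ∀ d, ‖h d‖ ≤ (d + 1) * t ^ d)
    (hΔ : ‖Δ‖ ≤ t ^ 2 / 4) (m : ℕ × ℕ) :
    ‖gluedTerm h Δ m‖ ≤ gluedBound t (m.1 + m.2, m.2) := by
  obtain ⟨d, b⟩ := m
  have hn : ‖gluedTerm h Δ (d, b)‖ =
      ((d : ℝ) + 1) * ‖h d‖ * ‖Δ‖ ^ b / (b.factorial * (d + b + 1).factorial) := by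
    have : ‖(d : ℂ) + 1‖ = (d : ℝ) + 1 := by
      rw [← Nat.cast_succ, Complex.norm_natCast, Nat.cast_succ]
    simp [gluedTerm, this]
  rw [hn, gluedBound]
  calc ((d : ℝ) + 1) * ‖h d‖ * ‖Δ‖ ^ b / (b.factorial * (d + b + 1).factorial)
      ≤ ((d : ℝ) + 1) * ((d + 1) * t ^ d) * (t ^ 2 / 4) ^ b /
          (b.factorial * (d + b + 1).factorial) := by
        gcongr
        exact hh d
    _ ≤ ((d : ℝ) + b + 1) * ((d + 1) * t ^ d) * (t ^ 2 / 4) ^ b /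
          (b.factorial * (d + b + 1).factorial) := by
        gcongr
        linarith [Nat.cast_nonneg (α := ℝ) b]
    _ = ((d : ℝ) + 1) * (t ^ d * (t ^ 2 / 4) ^ b / (b.factorial * (d + b).factorial)) := by
        rw [Nat.factorial_succ (d + b)]
        push_cast
        field_simp
    _ ≤ (4 * (5 / 4) ^ d) * (t ^ d * (t ^ 2 / 4) ^ b / (b.factorial * (d + b).factorial)) := by
        gcongr
        exact add_one_le_four_mul d
    _ = _ := by
        have : (t ^ 2 / 4) ^ b = (5 / 4 * t) ^ b * (t / 5) ^ b := by
          rw [← mul_pow]; ring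
        rw [this, pow_add, mul_pow _ t d]
        field_simp

theorem hasSum_gluedBound (t : ℝ) :
    HasSum (gluedBound t) (4 * (Real.exp (5 / 4 * t) * Real.exp (t / 5))) := by
  have h1 : ∀ x : ℝ, HasSum (fun m : ℕ => x ^ m / (m.factorial : ℝ)) (Real.exp x) := fun x => by
    rw [Real.exp_eq_exp_ℝ]; exact NormedSpace.expSeries_div_hasSum_exp _
  have hs : ∀ x : ℝ, Summable fun m : ℕ => ‖x ^ m / (m.factorial : ℝ)‖ := fun x =>
    (h1 x).summable.norm
  have hprod : Summable fun m : ℕ × ℕ =>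
      (5 / 4 * t) ^ m.1 / (m.1.factorial : ℝ) * ((t / 5) ^ m.2 / (m.2.factorial : ℝ)) :=
    summable_mul_of_summable_norm (f := fun m : ℕ => (5 / 4 * t) ^ m / (m.factorial : ℝ))
      (g := fun m : ℕ => (t / 5) ^ m / (m.factorial : ℝ)) (hs (5 / 4 * t)) (hs (t / 5))
  exact (HasSum.mul (h1 (5 / 4 * t)) (h1 (t / 5)) hprod).mul_left 4

theorem summable_gluedTerm {t : ℝ} (ht : 0 ≤ t) (hh : ∀ d, ‖h d‖ ≤ (d + 1) * t ^ d)
    (hΔ : ‖Δ‖ ≤ t ^ 2 / 4) : Summable (gluedTerm h Δ) := by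
  refine Summable.of_norm_bounded (g := fun m : ℕ × ℕ => gluedBound t (m.1 + m.2, m.2)) ?_
    (norm_gluedTerm_le ht hh hΔ)
  refine (hasSum_gluedBound t).summable.comp_injective (i := fun m : ℕ × ℕ => (m.1 + m.2, m.2)) ?_
  rintro ⟨a, b⟩ ⟨a', b'⟩ hab
  simp only [Prod.mk.injEq] at hab ⊢
  lia

/-- Sorted by `n = d + 2 b`, the terms make up the decomposition of `τ ^ n / n!` into characters. -/
theorem hasSum_gluedTerm {t : ℝ} (ht : 0 ≤ t) (hh : ∀ d, ‖h d‖ ≤ (d + 1) * t ^ d)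
    (hΔ : ‖Δ‖ ≤ t ^ 2 / 4) (h0 : h 0 = 1) (h1 : h 1 = τ)
    (hrec : ∀ m, h (m + 2) = τ * h (m + 1) - Δ * h m) :
    HasSum (gluedTerm h Δ) (Complex.exp τ) := by
  have hs := (summable_gluedTerm ht hh hΔ).hasSum
  -- regroup by the total number of brackets `n = d + 2 b`
  have hinj : Function.Injective fun m : ℕ × ℕ => (m.1 + 2 * m.2, m.2) := by
    rintro ⟨a, b⟩ ⟨a', b'⟩ hab
    simp only [Prod.mk.injEq] at hab ⊢
    lia
  have hs' : HasSum (fun q : ℕ × ℕ => ballotTerm h Δ q.1 q.2) (∑' m, gluedTerm h Δ m) := by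
    rw [← hinj.hasSum_iff]
    · refine hs.congr_fun fun m => ?_
      simp only [Function.comp_apply, ballotTerm_add, gluedTerm]
    · rintro ⟨n, b⟩ hnb
      simp only [ballotTerm]
      rw [if_neg]
      intro hle
      exact hnb ⟨(n - 2 * b, b), by simp only [Prod.mk.injEq]; lia⟩
  have hn := hs'.prod_fiberwise (g := fun n => τ ^ n / (n.factorial : ℂ)) fun n => by
    rw [← sum_ballotTerm h0 h1 hrec n]
    refine hasSum_sum_of_ne_finset_zero fun b hb => ?_
    simp only [ballotTerm]
    rw [if_neg]
    simp only [Finset.mem_range] at hb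
    lia
  have hexp : HasSum (fun n : ℕ => τ ^ n / (n.factorial : ℂ)) (Complex.exp τ) := by
    rw [Complex.exp_eq_exp_ℂ]; exact NormedSpace.expSeries_div_hasSum_exp _
  rwa [hn.unique hexp] at hs

theorem hasSum_sum_antidiagonal {f : ℕ × ℕ → ℂ} {a : ℂ} (hf : HasSum f a) :
    HasSum (fun k => ∑ m ∈ Finset.HasAntidiagonal.antidiagonal k, f m) a := by
  have h1 := (Finset.HasAntidiagonal.sigmaAntidiagonalEquivProd (A := ℕ)).hasSum_iff.2 hf
  refine h1.sigma fun k => ?_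
  rw [← Finset.sum_attach]
  exact hasSum_fintype _

/-- The bound on the part of fixed total degree `k`, summable with sum the exponential of
`(1 / 5 + 5 / 4) t`, up to a factor. -/
theorem norm_sum_gluedTerm_le {t : ℝ} (ht : 0 ≤ t) (hh : ∀ d, ‖h d‖ ≤ (d + 1) * t ^ d)
    (hΔ : ‖Δ‖ ≤ t ^ 2 / 4) (k : ℕ) :
    ‖∑ m ∈ Finset.HasAntidiagonal.antidiagonal k, gluedTerm h Δ m‖ ≤
      4 * Real.exp (t / 5) * ((5 / 4 * t) ^ k / k.factorial) := by
  calc _ ≤ ∑ m ∈ Finset.HasAntidiagonal.antidiagonal k, ‖gluedTerm h Δ m‖ := norm_sum_le _ _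
    _ ≤ ∑ m ∈ Finset.HasAntidiagonal.antidiagonal k, gluedBound t (k, m.2) := by
        refine Finset.sum_le_sum fun m hm => ?_
        rw [← Finset.HasAntidiagonal.mem_antidiagonal.1 hm]
        exact norm_gluedTerm_le ht hh hΔ m
    _ = ∑ b ∈ Finset.range (k + 1), gluedBound t (k, b) := by
        rw [← Finset.Nat.sum_antidiagonal_swap, Finset.Nat.sum_antidiagonal_eq_sum_range_succ_mk]
        rfl
    _ = 4 * ((5 / 4 * t) ^ k / k.factorial) *
          ∑ b ∈ Finset.range (k + 1), (t / 5) ^ b / b.factorial := by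
        rw [Finset.mul_sum]
        refine Finset.sum_congr rfl fun b _ => ?_
        simp only [gluedBound]
        ring
    _ ≤ 4 * ((5 / 4 * t) ^ k / k.factorial) * Real.exp (t / 5) := by
        gcongr
        exact Real.sum_le_exp_of_nonneg (by positivity) _
    _ = _ := by ring

end Ballot

/-! ### Gaussian integrals and characters -/

/-- The sesquilinear form `⟨z|M|z⟩`. -/
noncomputable def quadForm (M : Matrix (Fin 2) (Fin 2) ℂ) (z : Spinor) : ℂ :=
  braket z (M.mulVec z)

theorem quadForm_apply (M : Matrix (Fin 2) (Fin 2) ℂ) (z : Spinor) :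
    quadForm M z = star (z 0) * (M 0 0 * z 0 + M 0 1 * z 1) +
      star (z 1) * (M 1 0 * z 0 + M 1 1 * z 1) := by
  simp [quadForm, braket, Matrix.mulVec, dotProduct, Fin.sum_univ_two]

theorem continuous_quadForm (M : Matrix (Fin 2) (Fin 2) ℂ) : Continuous (quadForm M) := by
  simp only [show quadForm M = fun z => quadForm M z from rfl, quadForm_apply]
  fun_prop

/-- The Gaussian integral over `ℂ` with linear terms. -/
theorem integral_complex_gaussian {a : ℂ} (ha : 0 < a.re) (p q : ℂ) :
    ∫ z : ℂ, Complex.exp (-(a * (star z * z) + p * star z + q * z)) =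
      Real.pi / a * Complex.exp (p * q / a) := by
  have ha0 : a ≠ 0 := fun h => by simp [h] at ha
  have hpi : (Real.pi : ℂ) ≠ 0 := by exact_mod_cast Real.pi_ne_zero
  rw [← Complex.volume_preserving_equiv_real_prod.symm.integral_comp'
    (g := fun z : ℂ => Complex.exp (-(a * (star z * z) + p * star z + q * z)))]
  have hsplit : ∀ x : ℝ × ℝ, Complex.exp (-(a * (star (Complex.measurableEquivRealProd.symm x) *
      Complex.measurableEquivRealProd.symm x) + p * star (Complex.measurableEquivRealProd.symm x) +
      q * Complex.measurableEquivRealProd.symm x)) =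
      Complex.exp (-a * (x.1 : ℂ) ^ 2 + -(p + q) * x.1 + 0) *
      Complex.exp (-a * (x.2 : ℂ) ^ 2 + (Complex.I * (p - q)) * x.2 + 0) := fun x => by
    have : (Complex.measurableEquivRealProd.symm x) = (x.1 : ℂ) + x.2 * Complex.I := by
      apply Complex.ext <;> simp
    rw [this, ← Complex.exp_add]
    congr 1
    simp
    ring_nf
    rw [Complex.I_sq]
    ring
  simp_rw [hsplit]
  rw [Measure.volume_eq_prod, integral_prod_mul (μ := (volume : Measure ℝ))
    (ν := (volume : Measure ℝ))
    (fun x : ℝ => Complex.exp (-a * (x : ℂ) ^ 2 + -(p + q) * x + 0))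
    (fun x : ℝ => Complex.exp (-a * (x : ℂ) ^ 2 + (Complex.I * (p - q)) * x + 0)),
    integral_cexp_quadratic (by simpa using ha), integral_cexp_quadratic (by simpa using ha)]
  have hroot : ((Real.pi : ℂ) / - -a) ^ (1 / 2 : ℂ) * (Real.pi / - -a) ^ (1 / 2 : ℂ) =
      Real.pi / a := by
    rw [← Complex.cpow_add _ _ (div_ne_zero hpi (by simpa using ha0))]
    norm_num
  have hexp : Complex.exp (0 - (-(p + q)) ^ 2 / (4 * -a)) *
      Complex.exp (0 - (Complex.I * (p - q)) ^ 2 / (4 * -a)) = Complex.exp (p * q / a) := by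
    rw [← Complex.exp_add, mul_pow, Complex.I_sq]
    congr 1
    field_simp
    ring
  rw [← hroot, ← hexp]
  ring

theorem integrable_exp_neg_quadForm {N : Matrix (Fin 2) (Fin 2) ℂ} {c : ℝ} (hc : 0 < c)
    (hN : ∀ z, c * sqNorm z ≤ (quadForm N z).re) :
    Integrable fun z => Complex.exp (-quadForm N z) := by
  have hcont := continuous_quadForm N
  refine (integrable_exp_neg_mul_sqNorm hc).mono' (by fun_prop) (ae_of_all _ fun z => ?_)
  rw [Complex.norm_exp, Real.exp_le_exp, Complex.neg_re]
  linarith [hN z]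

/-- The Gaussian integral over `ℂ²` of a form with positive real part, by completing the square in
the first variable. -/
theorem integral_exp_neg_quadForm {N : Matrix (Fin 2) (Fin 2) ℂ} {c : ℝ} (hc : 0 < c)
    (hN : ∀ z, c * sqNorm z ≤ (quadForm N z).re) :
    ∫ z, Complex.exp (-quadForm N z) = Real.pi ^ 2 / N.det := by
  have ha : 0 < (N 0 0).re := by
    have := hN ![1, 0]
    rw [quadForm_apply] at this
    simp [sqNorm] at this
    linarith
  have ha0 : N 0 0 ≠ 0 := fun h => by simp [h] at ha
  -- the Schur complement of the first entry has positive real part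
  have hd : 0 < (N 1 1 - N 0 1 * N 1 0 / N 0 0).re := by
    have := hN ![-N 0 1 / N 0 0, 1]
    rw [quadForm_apply] at this
    have e : star (-N 0 1 / N 0 0) * (N 0 0 * (-N 0 1 / N 0 0) + N 0 1 * 1) +
        star (1 : ℂ) * (N 1 0 * (-N 0 1 / N 0 0) + N 1 1 * 1) =
        N 1 1 - N 0 1 * N 1 0 / N 0 0 := by
      rw [show N 0 0 * (-N 0 1 / N 0 0) + N 0 1 * 1 = 0 by field_simp; ring, star_one]
      field_simp
      ring
    have h2 : c ≤ c * sqNorm ![-N 0 1 / N 0 0, 1] := by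
      have : 1 ≤ sqNorm ![-N 0 1 / N 0 0, 1] := by
        simp [sqNorm]
        positivity
      nlinarith
    simp only [Matrix.cons_val_zero, Matrix.cons_val_one] at this
    rw [e] at this
    linarith
  have hd0 : N 1 1 - N 0 1 * N 1 0 / N 0 0 ≠ 0 := fun h => by simp [h] at hd
  have hmp := (volume_preserving_finTwoArrow ℂ).symm
  rw [← hmp.integral_comp' (g := fun z : Spinor => Complex.exp (-quadForm N z))]
  have hi : Integrable ((fun z : Spinor => Complex.exp (-quadForm N z)) ∘
      (MeasurableEquiv.finTwoArrow (α := ℂ)).symm) :=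
    hmp.integrable_comp_of_integrable (integrable_exp_neg_quadForm hc hN)
  refine (integral_prod_symm _ hi).trans ?_
  have h1 : ∀ y : ℂ, ∫ x : ℂ, Complex.exp (-quadForm N
      ((MeasurableEquiv.finTwoArrow (α := ℂ)).symm (x, y))) =
      Real.pi / N 0 0 * Complex.exp (-((N 1 1 - N 0 1 * N 1 0 / N 0 0) * (star y * y) +
        0 * star y + 0 * y)) := fun y => by
    have h2 : ∀ x : ℂ, Complex.exp (-quadForm N
        ((MeasurableEquiv.finTwoArrow (α := ℂ)).symm (x, y))) =
        Complex.exp (-(N 0 0 * (star x * x) + N 0 1 * y * star x + N 1 0 * star y * x)) *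
          Complex.exp (-(N 1 1 * (star y * y))) := fun x => by
      rw [← Complex.exp_add, quadForm_apply]
      congr 1
      simp
      ring
    simp_rw [h2]
    rw [integral_mul_const, integral_complex_gaussian ha, mul_assoc, ← Complex.exp_add]
    congr 2
    field_simp
    ring
  simp only [Function.comp_apply, h1]
  rw [integral_const_mul, integral_complex_gaussian hd, Matrix.det_fin_two]
  have hdet : N 0 0 * N 1 1 - N 0 1 * N 1 0 ≠ 0 := fun h => hd0 (by field_simp; linear_combination h)
  have : N 1 1 - N 0 1 * N 1 0 / N 0 0 = (N 0 0 * N 1 1 - N 0 1 * N 1 0) / N 0 0 := by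
    field_simp
  rw [this]
  simp
  field_simp

theorem quadForm_smul_one_sub (s : ℂ) (M : Matrix (Fin 2) (Fin 2) ℂ) (z : Spinor) :
    quadForm (s • 1 - M) z = s * sqNorm z - quadForm M z := by
  rw [← braket_self]
  simp [quadForm_apply, braket]
  ring

/-- The Gaussian average of `e^{⟨z|M|z⟩}` with a Gaussian weight of inverse width `s`. -/
theorem integral_exp_quadForm {M : Matrix (Fin 2) (Fin 2) ℂ} {c s : ℝ} (hs : c < s)
    (hM : ∀ z, (quadForm M z).re ≤ c * sqNorm z) :
    ∫ z, Complex.exp (quadForm M z) * Real.exp (-(s - 1) * sqNorm z) ∂spinorMeasure =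
      1 / ((s : ℂ) ^ 2 - s * M.trace + M.det) := by
  rw [integral_mul_exp_sqNorm]
  have h := integral_exp_neg_quadForm (N := (s : ℂ) • 1 - M) (sub_pos.2 hs) fun z => by
    rw [quadForm_smul_one_sub, Complex.sub_re, ← Complex.ofReal_mul, Complex.ofReal_re]
    linarith [hM z]
  have h' : ∀ z, (Real.exp (-s * sqNorm z) : ℂ) * Complex.exp (quadForm M z) =
      Complex.exp (-quadForm ((s : ℂ) • 1 - M) z) := fun z => by
    rw [quadForm_smul_one_sub, Complex.ofReal_exp, ← Complex.exp_add]
    congr 1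
    push_cast
    ring
  simp_rw [h']
  rw [h, div_div, mul_comm, ← div_div, div_self (by
    exact_mod_cast pow_ne_zero 2 Real.pi_ne_zero)]
  congr 1
  rw [Matrix.det_fin_two, Matrix.trace_fin_two, Matrix.det_fin_two]
  simp
  ring

/-- The Gaussian moment `∫ ⟨z|M|z⟩ᵐ / m!`, which is the character of the `m`-th symmetric power
of `M`. -/
noncomputable def symCharacter (M : Matrix (Fin 2) (Fin 2) ℂ) (m : ℕ) : ℂ :=
  ∫ z, quadForm M z ^ m / m.factorial ∂spinorMeasure

theorem slowGrowth_quadForm (M : Matrix (Fin 2) (Fin 2) ℂ) : SlowGrowth (quadForm M) := by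
  have h := slowGrowth_spinor_apply
  simp only [show quadForm M = fun z => quadForm M z from rfl, quadForm_apply]
  exact ((h 0).star.mul (((SlowGrowth.const _).mul (h 0)).add ((SlowGrowth.const _).mul (h 1)))).add
    ((h 1).star.mul (((SlowGrowth.const _).mul (h 0)).add ((SlowGrowth.const _).mul (h 1))))

theorem norm_symCharacter_le {M : Matrix (Fin 2) (Fin 2) ℂ} {t : ℝ}
    (hM : ∀ z, ‖quadForm M z‖ ≤ t * sqNorm z) (m : ℕ) :
    ‖symCharacter M m‖ ≤ (m + 1) * t ^ m := by
  have hm : ∫ z, sqNorm z ^ m ∂spinorMeasure = ((m + 1).factorial : ℝ) := by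
    have := integral_sqNorm_pow m
    rw [← Complex.ofReal_inj, ← integral_complex_ofReal]
    push_cast
    exact this
  have hi : Integrable (fun z => sqNorm z ^ m) spinorMeasure := by
    have := ((slowGrowth_sqNorm.pow m).integrable gaussianTail_spinor).re
    refine this.congr (ae_of_all _ fun z => ?_)
    simp [← Complex.ofReal_pow]
  have hf : (m.factorial : ℝ) ≠ 0 := by exact_mod_cast m.factorial_ne_zero
  calc ‖symCharacter M m‖ ≤ ∫ z, t ^ m / m.factorial * sqNorm z ^ m ∂spinorMeasure := by
        refine norm_integral_le_of_norm_le (hi.const_mul _) (ae_of_all _ fun z => ?_)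
        rw [norm_div, norm_pow, Complex.norm_natCast]
        calc ‖quadForm M z‖ ^ m / (m.factorial : ℝ) ≤ (t * sqNorm z) ^ m / m.factorial := by
              gcongr; exact hM z
          _ = _ := by ring
    _ = _ := by
        rw [integral_const_mul, hm, Nat.factorial_succ]
        push_cast
        field_simp

theorem quadForm_smul (r : ℂ) (M : Matrix (Fin 2) (Fin 2) ℂ) (z : Spinor) :
    quadForm (r • M) z = r * quadForm M z := by
  simp [quadForm_apply]; ring

/-- The generating function of the characters of the symmetric powers. -/
theorem hasSum_symCharacter {M : Matrix (Fin 2) (Fin 2) ℂ} {t : ℝ}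
    (hM : ∀ z, ‖quadForm M z‖ ≤ t * sqNorm z) {r : ℂ} (hr : ‖r‖ * t < 1) :
    HasSum (fun m => r ^ m * symCharacter M m) (1 / (1 - r * M.trace + r ^ 2 * M.det)) := by
  have hrM : ∀ z, ‖r * quadForm M z‖ ≤ ‖r‖ * t * sqNorm z := fun z => by
    rw [norm_mul, mul_assoc]
    gcongr
    exact hM z
  have hval := integral_exp_quadForm (M := r • M) (s := 1) hr fun z => by
    rw [quadForm_smul]
    exact (Complex.re_le_norm _).trans (hrM z)
  simp only [sub_self, neg_zero, zero_mul, Real.exp_zero, Complex.ofReal_one, mul_one,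
    quadForm_smul] at hval
  have hdet : (1 : ℂ) ^ 2 - 1 * (r • M).trace + (r • M).det =
      1 - r * M.trace + r ^ 2 * M.det := by
    rw [Matrix.trace_smul, Matrix.det_smul]
    simp
  rw [hdet] at hval
  have hs : ∀ z, HasSum (fun m : ℕ => (r * quadForm M z) ^ m / (m.factorial : ℂ))
      (Complex.exp (r * quadForm M z)) := fun z => by
    rw [Complex.exp_eq_exp_ℂ]; exact NormedSpace.expSeries_div_hasSum_exp _
  have hs' : ∀ z, HasSum (fun m : ℕ => ‖r * quadForm M z‖ ^ m / (m.factorial : ℝ))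
      (Real.exp ‖r * quadForm M z‖) := fun z => by
    rw [Real.exp_eq_exp_ℝ]; exact NormedSpace.expSeries_div_hasSum_exp _
  have hc := continuous_quadForm M
  rw [← hval]
  have := hasSum_integral_of_dominated_convergence (μ := spinorMeasure)
    (F := fun (m : ℕ) z => (r * quadForm M z) ^ m / (m.factorial : ℂ))
    (f := fun z => Complex.exp (r * quadForm M z))
    (fun m z => ‖r * quadForm M z‖ ^ m / (m.factorial : ℝ))
    (fun m => by fun_prop)
    (fun m => ae_of_all _ fun z => by simp)
    (ae_of_all _ fun z => (hs' z).summable) ?_ (ae_of_all _ hs)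
  · refine this.congr_fun fun m => ?_
    rw [symCharacter, ← integral_const_mul]
    refine integral_congr_ae (ae_of_all _ fun z => ?_)
    beta_reduce
    rw [mul_pow]
    ring
  · simp only [fun z => (hs' z).tsum_eq]
    refine (integrable_spinorMeasure_exp hr).mono' (by fun_prop) (ae_of_all _ fun z => ?_)
    rw [Real.norm_of_nonneg (Real.exp_nonneg _)]
    exact Real.exp_le_exp.2 (hrM z)

/-- A power series that vanishes near the origin has vanishing coefficients. -/
theorem eq_zero_of_hasSum_pow_mul {a : ℕ → ℂ} {ρ : ℝ} (hρ : 0 < ρ)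
    (h : ∀ r : ℂ, ‖r‖ < ρ → HasSum (fun m => r ^ m * a m) 0) (m : ℕ) : a m = 0 := by
  have hp : HasFPowerSeriesOnBall (0 : ℂ → ℂ) (FormalMultilinearSeries.ofScalars ℂ a) 0
      (ENNReal.ofReal (ρ / 2)) := by
    refine ⟨?_, by simpa using hρ, fun {y} hy => ?_⟩
    · rw [ENNReal.ofReal]
      refine FormalMultilinearSeries.le_radius_of_summable_norm _ ?_
      have h1 := (h (ρ / 2 : ℝ) (by
        rw [Complex.norm_real, Real.norm_of_nonneg (by positivity)]; linarith)).summable.norm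
      refine h1.congr fun m => ?_
      rw [FormalMultilinearSeries.ofScalars_norm, norm_mul, norm_pow, Complex.norm_real,
        Real.norm_of_nonneg (by positivity), Real.coe_toNNReal _ (by positivity), mul_comm]
    · have hy' : ‖y‖ < ρ := by
        rw [Metric.eball_ofReal] at hy
        have := mem_ball_zero_iff.1 hy
        linarith
      refine (h y hy').congr_fun fun m => ?_
      rw [FormalMultilinearSeries.ofScalars_apply_eq, smul_eq_mul, mul_comm]
  have := hp.hasFPowerSeriesAt.eq_zero
  have h2 := congrArg (fun p => p.coeff m) this
  rw [FormalMultilinearSeries.coeff_ofScalars] at h2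
  exact h2

theorem symCharacter_zero (M : Matrix (Fin 2) (Fin 2) ℂ) : symCharacter M 0 = 1 := by
  simp [symCharacter]

/-- The recurrence of the characters, read off from the generating function. -/
theorem symCharacter_recurrence {M : Matrix (Fin 2) (Fin 2) ℂ} {t : ℝ} (ht : 0 ≤ t)
    (hM : ∀ z, ‖quadForm M z‖ ≤ t * sqNorm z) :
    symCharacter M 1 = M.trace ∧ ∀ m, symCharacter M (m + 2) =
      M.trace * symCharacter M (m + 1) - M.det * symCharacter M m := by
  set h := symCharacter M with hh
  set τ := M.trace
  set Δ := M.det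
  -- the coefficients of `(1 - r τ + r² Δ) ∑ rᵐ hₘ - 1`
  let e : ℕ → ℂ := fun m => match m with
    | 0 => h 0 - 1
    | 1 => h 1 - τ * h 0
    | m + 2 => h (m + 2) - τ * h (m + 1) + Δ * h m
  have hnear : ∀ᶠ r : ℂ in 𝓝 0, 1 - r * τ + r ^ 2 * Δ ≠ 0 := by
    have hc : Continuous fun r : ℂ => 1 - r * τ + r ^ 2 * Δ := by fun_prop
    exact hc.continuousAt.eventually_ne (by simp)
  obtain ⟨ε, hε, hball⟩ := Metric.eventually_nhds_iff.1 hnear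
  have he : ∀ m, e m = 0 := by
    refine eq_zero_of_hasSum_pow_mul (ρ := min ε (1 / (t + 1))) (by positivity) fun r hr => ?_
    have hrt : ‖r‖ * t < 1 := by
      have hr' := hr.trans_le (min_le_right _ _)
      rw [lt_div_iff₀ (by positivity)] at hr'
      nlinarith [norm_nonneg r]
    have hs := hasSum_symCharacter hM hrt
    have hD : 1 - r * τ + r ^ 2 * Δ ≠ 0 :=
      hball (by simpa using hr.trans_le (min_le_left _ _))
    have hmul : (1 - r * τ + r ^ 2 * Δ) * (1 / (1 - r * τ + r ^ 2 * Δ)) = 1 := by field_simp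
    set S := 1 / (1 - r * τ + r ^ 2 * Δ) with hS
    have h2 := (hasSum_nat_add_iff' 2).2 hs
    have h1 := (hasSum_nat_add_iff' 1).2 hs
    rw [← hasSum_nat_add_iff' 2]
    have hcomb := (h2.sub (h1.mul_left (r * τ))).add (hs.mul_left (r ^ 2 * Δ))
    have hval : S - ∑ i ∈ Finset.range 2, r ^ i * symCharacter M i -
        r * τ * (S - ∑ i ∈ Finset.range 1, r ^ i * symCharacter M i) + r ^ 2 * Δ * S =
        0 - ∑ i ∈ Finset.range 2, r ^ i * e i := by
      simp only [Finset.sum_range_succ, Finset.sum_range_zero, e, ← hh]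
      linear_combination hmul
    rw [← hval]
    refine hcomb.congr_fun fun m => ?_
    simp only [e, ← hh]
    ring
  refine ⟨?_, fun m => ?_⟩
  · have := he 1
    simp only [e] at this
    rw [hh, symCharacter_zero, ← hh] at this
    linear_combination this
  · have := he (m + 2)
    simp only [e] at this
    linear_combination this

/-! ### Contraction of the auxiliary spinors of the glued triangles -/

/-- The matrix that sends `z` to `-ε ∑ₗ [z|vₗ⟩ |uₗ⟩`. -/
noncomputable def holonomy (ε : ℂ) (u v : Fin 2 → Spinor) : Matrix (Fin 2) (Fin 2) ℂ :=
  Matrix.of fun i => ![-ε * ∑ l, u l i * v l 1, ε * ∑ l, u l i * v l 0]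

theorem quadForm_holonomy (ε : ℂ) (u v : Fin 2 → Spinor) (z : Spinor) :
    quadForm (holonomy ε u v) z = -ε * ∑ l, braket z (u l) * holBraket z (v l) := by
  simp only [quadForm_apply, holonomy, Matrix.of_apply, Fin.sum_univ_two, holBraket_apply, braket]
  simp
  ring

theorem trace_holonomy (ε : ℂ) (u v : Fin 2 → Spinor) :
    (holonomy ε u v).trace = -ε * ∑ l, holBraket (u l) (v l) := by
  simp only [Matrix.trace_fin_two, holonomy, Matrix.of_apply, Fin.sum_univ_two, holBraket_apply]
  simp
  ring

theorem det_holonomy (ε : ℂ) (u v : Fin 2 → Spinor) :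
    (holonomy ε u v).det = ε ^ 2 * (holBraket (u 0) (u 1) * holBraket (v 0) (v 1)) := by
  simp only [Matrix.det_fin_two, holonomy, Matrix.of_apply, Fin.sum_univ_two, holBraket_apply]
  simp
  ring

/-- Half the sum of the squared norms of the four cut spinors. -/
noncomputable def cutNorm (u v : Fin 2 → Spinor) : ℝ := (sqNormSum u + sqNormSum v) / 2

theorem cutNorm_eq (u v : Fin 2 → Spinor) :
    cutNorm u v = ∑ l, (sqNorm (u l) + sqNorm (v l)) / 2 := by
  simp [cutNorm, sqNormSum, Fin.sum_univ_two]; ring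

theorem cutNorm_nonneg (u v : Fin 2 → Spinor) : 0 ≤ cutNorm u v := by
  unfold cutNorm
  linarith [sqNormSum_nonneg u, sqNormSum_nonneg v]

theorem norm_quadForm_holonomy_le {ε : ℂ} (hε : ‖ε‖ = 1) (u v : Fin 2 → Spinor) (z : Spinor) :
    ‖quadForm (holonomy ε u v) z‖ ≤ cutNorm u v * sqNorm z := by
  rw [quadForm_holonomy, norm_mul, norm_neg, hε, one_mul, cutNorm_eq, Finset.sum_mul]
  refine (norm_sum_le _ _).trans (Finset.sum_le_sum fun l _ => ?_)
  have hz := sqNorm_nonneg z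
  have hu := sqNorm_nonneg (u l)
  have hv := sqNorm_nonneg (v l)
  refine (abs_le.1 (abs_le_of_sq_le_sq ?_ (by positivity))).2
  calc ‖braket z (u l) * holBraket z (v l)‖ ^ 2
      = ‖braket z (u l)‖ ^ 2 * ‖holBraket z (v l)‖ ^ 2 := by rw [norm_mul, mul_pow]
    _ ≤ (sqNorm z * sqNorm (u l)) * (sqNorm z * sqNorm (v l)) := by
        gcongr
        · exact norm_braket_sq_le _ _
        · exact norm_holBraket_sq_le _ _
    _ ≤ _ := by
        have : 0 ≤ sqNorm z ^ 2 * (sqNorm (u l) - sqNorm (v l)) ^ 2 := by positivity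
        nlinarith

theorem norm_det_holonomy_le {ε : ℂ} (hε : ‖ε‖ = 1) (u v : Fin 2 → Spinor) :
    ‖(holonomy ε u v).det‖ ≤ cutNorm u v ^ 2 / 4 := by
  rw [det_holonomy, norm_mul, norm_pow, hε, one_pow, one_mul, cutNorm_eq, Fin.sum_univ_two]
  have h0 := sqNorm_nonneg (u 0)
  have h1 := sqNorm_nonneg (u 1)
  have h2 := sqNorm_nonneg (v 0)
  have h3 := sqNorm_nonneg (v 1)
  set a := (sqNorm (u 0) + sqNorm (v 0)) / 2 with ha
  set b := (sqNorm (u 1) + sqNorm (v 1)) / 2 with hb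
  have hab : ‖holBraket (u 0) (u 1) * holBraket (v 0) (v 1)‖ ≤ a * b := by
    refine (abs_le.1 (abs_le_of_sq_le_sq ?_ (by positivity))).2
    calc _ = ‖holBraket (u 0) (u 1)‖ ^ 2 * ‖holBraket (v 0) (v 1)‖ ^ 2 := by
          rw [norm_mul, mul_pow]
      _ ≤ (sqNorm (u 0) * sqNorm (u 1)) * (sqNorm (v 0) * sqNorm (v 1)) := by
          gcongr
          · exact norm_holBraket_sq_le _ _
          · exact norm_holBraket_sq_le _ _
      _ = (sqNorm (u 0) * sqNorm (v 0)) * (sqNorm (u 1) * sqNorm (v 1)) := by ring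
      _ ≤ a ^ 2 * b ^ 2 := by
          gcongr
          · rw [ha]; nlinarith [sq_nonneg (sqNorm (u 0) - sqNorm (v 0))]
          · rw [hb]; nlinarith [sq_nonneg (sqNorm (u 1) - sqNorm (v 1))]
      _ = _ := by ring
  nlinarith [sq_nonneg (a - b)]

/-- The part of the exponential of the merged links that stems from total spin `k` at the two glued
triangles. -/
noncomputable def mergedTerm (ε : ℂ) (u v : Fin 2 → Spinor) (k : ℕ) : ℂ :=
  ∑ m ∈ Finset.HasAntidiagonal.antidiagonal k,
    gluedTerm (symCharacter (holonomy ε u v)) (holonomy ε u v).det m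

theorem hasSum_mergedTerm {ε : ℂ} (hε : ‖ε‖ = 1) (u v : Fin 2 → Spinor) :
    HasSum (mergedTerm ε u v) (Complex.exp (-ε * ∑ l, holBraket (u l) (v l))) := by
  have hM := norm_quadForm_holonomy_le hε u v
  have ht := cutNorm_nonneg u v
  obtain ⟨h1, hrec⟩ := symCharacter_recurrence ht hM
  rw [← trace_holonomy]
  exact hasSum_sum_antidiagonal (hasSum_gluedTerm ht (norm_symCharacter_le hM)
    (norm_det_holonomy_le hε u v) (symCharacter_zero _) h1 hrec)

/-- The sum over `k` of the bounds is four times the exponential of `29 / 20` times the norm of the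
cut spinors. -/
theorem norm_mergedTerm_le {ε : ℂ} (hε : ‖ε‖ = 1) (u v : Fin 2 → Spinor) (k : ℕ) :
    ‖mergedTerm ε u v k‖ ≤
      4 * Real.exp (cutNorm u v / 5) * ((5 / 4 * cutNorm u v) ^ k / k.factorial) :=
  norm_sum_gluedTerm_le (cutNorm_nonneg u v)
    (norm_symCharacter_le (norm_quadForm_holonomy_le hε u v)) (norm_det_holonomy_le hε u v) k

/-- Fubini's theorem for a family of spinors, the first of which is integrated last. -/
theorem integral_pi_fin_succ' {n : ℕ} {F : (Fin (n + 1) → Spinor) → ℂ}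
    (hF : Integrable F (Measure.pi fun _ => spinorMeasure)) :
    ∫ x, F x ∂(Measure.pi fun _ => spinorMeasure) =
      ∫ z, ∫ y : Fin n → Spinor, F (Fin.cons z y) ∂(Measure.pi fun _ => spinorMeasure)
        ∂spinorMeasure := by
  have hmp := (measurePreserving_piFinSuccAbove (α := fun _ : Fin (n + 1) => Spinor)
    (fun _ => spinorMeasure) 0).symm
  rw [← hmp.integral_comp']
  refine (integral_prod _ (hmp.integrable_comp_of_integrable hF)).trans ?_
  simp only [Function.comp_apply, MeasurableEquiv.piFinSuccAbove_symm_apply, Fin.insertNthEquiv,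
    Equiv.coe_fn_mk, Fin.insertNth_zero]
  rfl

theorem SlowGrowth.weightedPow {E : Type*} [NormedAddCommGroup E] {h r : E → ℂ}
    (hh : SlowGrowth h) (hr : SlowGrowth r) (k : ℕ) :
    SlowGrowth fun x => weightedPow k (h x) (r x) :=
  SlowGrowth.sum _ fun _ _ => (SlowGrowth.const _).mul
    (((hh.pow _).div_const _).mul ((hr.pow _).div_const _))

theorem _root_.Differentiable.weightedPow {E : Type*} [NormedAddCommGroup E] [NormedSpace ℂ E]
    {h r : E → ℂ} (hh : Differentiable ℂ h) (hr : Differentiable ℂ r) (k : ℕ) :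
    Differentiable ℂ fun x => SpinNet.weightedPow k (h x) (r x) := by
  unfold SpinNet.weightedPow
  fun_prop

theorem integrable_cexp_mul_slowGrowth {S L : (Fin 3 → Spinor) × (Fin 3 → Spinor) → ℂ}
    (hS : SlowGrowth S) (hL : Continuous L)
    (h : ∀ p, ‖L p‖ ≤ (sqNormSum p.1 + sqNormSum p.2) / 2) :
    Integrable (fun p => Complex.exp (L p) * S p) (triangleMeasure.prod triangleMeasure) := by
  obtain ⟨C, hC⟩ := hS.2 (1 / 4) (by norm_num)
  have hc := hS.1
  have hi := integrable_pi_exp (ι := Fin 3) (c := 3 / 4) (by norm_num)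
  refine ((hi.mul_prod hi).const_mul C).mono' (by fun_prop) (ae_of_all _ fun p => ?_)
  have hC0 : 0 ≤ C := by simpa using (norm_nonneg _).trans (hC 0)
  have hp : ‖p‖ ^ 2 ≤ sqNormSum p.1 + sqNormSum p.2 := by
    have h1 := norm_sq_le_sqNormSum p.1
    have h2 := norm_sq_le_sqNormSum p.2
    have h3 := sqNormSum_nonneg p.1
    have h4 := sqNormSum_nonneg p.2
    rcases max_cases ‖p.1‖ ‖p.2‖ with h | h <;> rw [Prod.norm_def, h.1] <;> linarith
  rw [norm_mul]
  calc ‖Complex.exp (L p)‖ * ‖S p‖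
      ≤ Real.exp ((sqNormSum p.1 + sqNormSum p.2) / 2) *
        (C * Real.exp (1 / 4 * (sqNormSum p.1 + sqNormSum p.2))) := by
        gcongr
        · exact (Complex.norm_exp_le_exp_norm _).trans (Real.exp_le_exp.2 (h p))
        · exact (hC p).trans (by gcongr)
    _ = C * (Real.exp (3 / 4 * sqNormSum p.1) * Real.exp (3 / 4 * sqNormSum p.2)) := by
        rw [mul_left_comm, ← Real.exp_add, ← Real.exp_add]
        ring_nf

/-- The exponent of the links at the two glued triangles: the shared link and the four cut links,
whose far ends are encoded in `u` and `v`. -/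
noncomputable def cutLinkTerm (ε : ℂ) (u v : Fin 2 → Spinor)
    (p : (Fin 3 → Spinor) × (Fin 3 → Spinor)) : ℂ :=
  ε * antiBraket (p.1 0) (p.2 0) + pairing (fun l : Fin 2 => p.1 l.succ) u +
    pairing (fun l : Fin 2 => p.2 l.succ) v

theorem norm_le_of_fin_cons {n : ℕ} (z : Spinor) (y : Fin n → Spinor) :
    ‖(Fin.cons z y : Fin (n + 1) → Spinor)‖ ≤ ‖z‖ + ‖y‖ := by
  refine (pi_norm_le_iff_of_nonneg (by positivity)).2 fun i => ?_
  refine Fin.cases ?_ (fun j => ?_) i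
  · simp
  · simpa using (norm_le_pi_norm y j).trans (by linarith [norm_nonneg z])

/-- The hub term after the contraction of all spinors but the one at the shared side. -/
theorem hubTerm_cons (ε : ℂ) (u v : Fin 2 → Spinor) (z : Spinor) :
    hubTerm (Fin.cons (ε • dual z) u) (Fin.cons z v) = quadForm (holonomy ε u v) z := by
  have h : hubTerm (Fin.cons (ε • dual z) u) (Fin.cons z v) =
      holBraket (ε • dual z) (u 0) * holBraket z (v 0) +
        holBraket (u 1) (ε • dual z) * holBraket (v 1) z := rfl
  rw [h, quadForm_holonomy, Fin.sum_univ_two, holBraket_swap (ε • dual z), holBraket_swap z]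
  have h2 : ∀ w, holBraket (ε • dual z) w = -ε * braket z w := fun w => by
    have := holBraket_dual_left z w
    rw [neg_mul, ← mul_neg, ← this]
    simp only [holBraket_apply, Pi.smul_apply, smul_eq_mul]
    ring
  rw [h2, h2]
  ring

theorem rimTerm_cons (a b : Spinor) (u v : Fin 2 → Spinor) :
    rimTerm (Fin.cons a u) (Fin.cons b v) =
      holBraket (u 0) (u 1) * holBraket (v 0) (v 1) := rfl

theorem slowGrowth_cexp_cutPairing (u v : Fin 2 → Spinor) :
    SlowGrowth fun p : (Fin 3 → Spinor) × (Fin 3 → Spinor) =>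
      Complex.exp (pairing (fun l : Fin 2 => p.1 l.succ) u +
        pairing (fun l : Fin 2 => p.2 l.succ) v) := by
  refine SlowGrowth.cexp (((continuous_pairing_left u).comp (by fun_prop)).add
    ((continuous_pairing_left v).comp (by fun_prop))) (a := 0)
    (b := 4 * ‖u‖ + 4 * ‖v‖) fun p => ?_
  have hn : ∀ x : Fin 3 → Spinor, ‖fun l : Fin 2 => x l.succ‖ ≤ ‖x‖ := fun x =>
    (pi_norm_le_iff_of_nonneg (norm_nonneg _)).2 fun l => norm_le_pi_norm x _
  have h1 := norm_pairing_le_mul (fun l : Fin 2 => p.1 l.succ) u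
  have h2 := norm_pairing_le_mul (fun l : Fin 2 => p.2 l.succ) v
  have h3 := (hn p.1).trans (norm_fst_le p)
  have h4 := (hn p.2).trans (norm_snd_le p)
  simp only [Fintype.card_fin, Nat.cast_ofNat] at h1 h2
  refine (norm_add_le _ _).trans ?_
  have h5 := mul_le_mul_of_nonneg_left h3 (norm_nonneg u)
  have h6 := mul_le_mul_of_nonneg_left h4 (norm_nonneg v)
  linarith

theorem integrable_cexp_cutLinkTerm_mul {ε : ℂ} (hε : ‖ε‖ = 1) (u v : Fin 2 → Spinor)
    {S : (Fin 3 → Spinor) × (Fin 3 → Spinor) → ℂ} (hS : SlowGrowth S) :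
    Integrable (fun p => Complex.exp (cutLinkTerm ε u v p) * S p)
      (triangleMeasure.prod triangleMeasure) := by
  have hL : Continuous fun p : (Fin 3 → Spinor) × (Fin 3 → Spinor) =>
      ε * antiBraket (p.1 0) (p.2 0) := by
    simp only [antiBraket_apply]; fun_prop
  have := integrable_cexp_mul_slowGrowth ((slowGrowth_cexp_cutPairing u v).mul hS) hL fun p => ?_
  · refine this.congr (ae_of_all _ fun p => ?_)
    simp only [cutLinkTerm, Complex.exp_add]
    ring
  · rw [norm_mul, hε, one_mul]
    refine (norm_antiBraket_le _ _).trans ?_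
    have h : ∀ x : Fin 3 → Spinor, sqNorm (x 0) ≤ sqNormSum x := fun x =>
      Finset.single_le_sum (f := fun i => sqNorm (x i)) (fun i _ => sqNorm_nonneg _)
        (Finset.mem_univ 0)
    linarith [h p.1, h p.2]

/-- Integration over the auxiliary spinors of the glued triangles turns the kernel into the
corresponding part of the exponential of the merged links. -/
theorem integral_cexp_cutLinkTerm_mul {ε : ℂ} (hε : ‖ε‖ = 1) (hε2 : ε ^ 2 = 1)
    (u v : Fin 2 → Spinor) (k : ℕ) :
    ∫ p, Complex.exp (cutLinkTerm ε u v p) *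
      (weightedPow k (hubTerm p.1 p.2) (rimTerm p.1 p.2) / (k + 1).factorial)
      ∂triangleMeasure.prod triangleMeasure = mergedTerm ε u v k := by
  have hh : SlowGrowth fun p : (Fin 3 → Spinor) × (Fin 3 → Spinor) => hubTerm p.1 p.2 :=
    have a := fun i => slowGrowth_fst_apply (E := Fin 3 → Spinor) i
    have b := fun i => slowGrowth_snd_apply (E := Fin 3 → Spinor) i
    ((SlowGrowth.holBraket (a 0) (a 1)).mul (SlowGrowth.holBraket (b 0) (b 1))).add
      ((SlowGrowth.holBraket (a 2) (a 0)).mul (SlowGrowth.holBraket (b 2) (b 0)))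
  have hr : SlowGrowth fun p : (Fin 3 → Spinor) × (Fin 3 → Spinor) => rimTerm p.1 p.2 :=
    have a := fun i => slowGrowth_fst_apply (E := Fin 3 → Spinor) i
    have b := fun i => slowGrowth_snd_apply (E := Fin 3 → Spinor) i
    (SlowGrowth.holBraket (a 1) (a 2)).mul (SlowGrowth.holBraket (b 1) (b 2))
  have hW := (hh.weightedPow hr k).div_const ((k + 1).factorial : ℂ)
  have hi := integrable_cexp_cutLinkTerm_mul hε u v hW
  rw [integral_prod_symm _ hi]
  -- the exponential reproduces the auxiliary spinors of the first triangle
  have h1 : ∀ η : Fin 3 → Spinor, ∫ ξ, Complex.exp (cutLinkTerm ε u v (ξ, η)) *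
      (weightedPow k (hubTerm ξ η) (rimTerm ξ η) / (k + 1).factorial) ∂triangleMeasure =
      (weightedPow k (hubTerm (Fin.cons (ε • dual (η 0)) u) η)
        (rimTerm (Fin.cons (ε • dual (η 0)) u) η) / (k + 1).factorial) *
      Complex.exp (pairing (fun l : Fin 2 => η l.succ) v) := fun η => by
    have hp : ∀ ξ, cutLinkTerm ε u v (ξ, η) = pairing ξ (Fin.cons (ε • dual (η 0)) u) +
        pairing (fun l : Fin 2 => η l.succ) v := fun ξ => by
      simp [cutLinkTerm, pairing, Fin.sum_univ_succ, braket_smul_right, antiBraket]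
    rw [← integral_mul_cexp_pairing (F := fun ξ =>
      weightedPow k (hubTerm ξ η) (rimTerm ξ η) / ((k + 1).factorial : ℂ))
      (((slowGrowth_hubTerm η).weightedPow (slowGrowth_rimTerm η) k).div_const _)
      (by
        have := (differentiable_hubTerm η).weightedPow (differentiable_rimTerm η) k
        fun_prop), ← integral_mul_const]
    refine integral_congr_ae (ae_of_all _ fun ξ => ?_)
    beta_reduce
    rw [hp, Complex.exp_add]
    ring
  simp_rw [h1]
  have hi2 : Integrable (fun η : Fin 3 → Spinor =>
      (weightedPow k (hubTerm (Fin.cons (ε • dual (η 0)) u) η)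
        (rimTerm (Fin.cons (ε • dual (η 0)) u) η) / (k + 1).factorial) *
      Complex.exp (pairing (fun l : Fin 2 => η l.succ) v)) triangleMeasure :=
    hi.integral_prod_right.congr (ae_of_all _ h1)
  unfold triangleMeasure at hi2 ⊢
  rw [integral_pi_fin_succ' hi2]
  -- it also reproduces the two cut auxiliary spinors of the second triangle
  have h2 : ∀ z : Spinor, ∫ y : Fin 2 → Spinor,
      (weightedPow k (hubTerm (Fin.cons (ε • dual ((Fin.cons z y : Fin 3 → Spinor) 0)) u)
        (Fin.cons z y)) (rimTerm (Fin.cons (ε • dual ((Fin.cons z y : Fin 3 → Spinor) 0)) u)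
          (Fin.cons z y)) / (k + 1).factorial) *
      Complex.exp (pairing (fun l : Fin 2 => (Fin.cons z y : Fin 3 → Spinor) l.succ) v)
        ∂(Measure.pi fun _ => spinorMeasure) =
      weightedPow k (quadForm (holonomy ε u v) z) (holonomy ε u v).det / (k + 1).factorial :=
    fun z => by
      simp only [Fin.cons_zero, Fin.cons_succ]
      have hc : Continuous fun y : Fin 2 → Spinor => (Fin.cons z y : Fin 3 → Spinor) := by fun_prop
      have hd : Differentiable ℂ fun y : Fin 2 → Spinor => (Fin.cons z y : Fin 3 → Spinor) := by
        rw [differentiable_pi]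
        intro i
        refine Fin.cases ?_ (fun j => ?_) i
        · simp
        · simp only [Fin.cons_succ]
          fun_prop
      have hcons : ∀ {F : (Fin 3 → Spinor) → ℂ}, SlowGrowth F →
          SlowGrowth fun y : Fin 2 → Spinor => F (Fin.cons z y) := fun hF =>
        hF.comp hc (a := ‖z‖) (b := 1) fun y => by
          simpa using norm_le_of_fin_cons z y
      rw [integral_mul_cexp_pairing (F := fun y : Fin 2 → Spinor =>
        weightedPow k (hubTerm (Fin.cons (ε • dual z) u) (Fin.cons z y))
          (rimTerm (Fin.cons (ε • dual z) u) (Fin.cons z y)) / ((k + 1).factorial : ℂ))]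
      · rw [hubTerm_cons, rimTerm_cons, det_holonomy, hε2, one_mul]
      · simp_rw [hubTerm_swap (Fin.cons (ε • dual z) u), rimTerm_swap (Fin.cons (ε • dual z) u)]
        exact ((hcons (slowGrowth_hubTerm _)).weightedPow (hcons (slowGrowth_rimTerm _)) k).div_const
          _
      · simp_rw [hubTerm_swap (Fin.cons (ε • dual z) u), rimTerm_swap (Fin.cons (ε • dual z) u)]
        have := ((differentiable_hubTerm (Fin.cons (ε • dual z) u)).comp hd).weightedPow
          ((differentiable_rimTerm (Fin.cons (ε • dual z) u)).comp hd) k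
        simp only [Function.comp_def] at this
        fun_prop
  simp_rw [h2]
  -- the moments in the auxiliary spinor at the shared side are the characters
  rw [integral_div]
  unfold weightedPow mergedTerm
  have hq := slowGrowth_quadForm (holonomy ε u v)
  rw [integral_finsetSum _ fun m _ => ((SlowGrowth.const _).mul
    (((hq.pow m.1).div_const _).mul (SlowGrowth.const _))).integrable gaussianTail_spinor,
    Finset.sum_div]
  refine Finset.sum_congr rfl fun m hm => ?_
  rw [integral_const_mul, integral_mul_const, gluedTerm, symCharacter,
    Finset.HasAntidiagonal.mem_antidiagonal.1 hm]
  field_simp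

/-! ### Convergence of the spin network state -/

/-- The sign `±1` of a Boolean, `true` being positive. -/
def boolSign (b : Bool) : ℂ := if b then 1 else -1

theorem norm_boolSign (b : Bool) : ‖boolSign b‖ = 1 := by cases b <;> simp [boolSign]

theorem boolSign_sq (b : Bool) : boolSign b ^ 2 = 1 := by cases b <;> simp [boolSign]

theorem boolSign_not (b : Bool) : boolSign (!b) = -boolSign b := by cases b <;> simp [boolSign]

theorem boolSign_xor (a b c : Bool) :
    boolSign (xor a (xor b c)) = boolSign a * boolSign b * boolSign c := by
  cases a <;> cases b <;> cases c <;> simp [boolSign]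

/-- The gluing of the sides, as a permutation of the half-links. -/
def CellBoundary.adjEquiv {T : Type*} (Γ : CellBoundary T) : T × Fin 3 ≃ T × Fin 3 :=
  ⟨Γ.adj, Γ.adj, Γ.adj_adj, Γ.adj_adj⟩

theorem CellBoundary.sum_adj {T M : Type*} [Fintype T] [AddCommMonoid M] (Γ : CellBoundary T)
    (f : T × Fin 3 → M) : ∑ h, f (Γ.adj h) = ∑ h, f h :=
  Γ.adjEquiv.sum_comp f

/-- The contribution of the link of a half-link `h` to the link term; it does not depend on which
half of the link is taken. -/
def halfLink {T : Type*} (Γ : CellBoundary T) (ξ : T → Fin 3 → Spinor) (h : T × Fin 3) : ℂ :=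
  boolSign (Γ.out h) * antiBraket (ξ h.1 h.2) (ξ (Γ.adj h).1 (Γ.adj h).2)

theorem halfLink_adj {T : Type*} (Γ : CellBoundary T) (ξ : T → Fin 3 → Spinor) (h : T × Fin 3) :
    halfLink Γ ξ (Γ.adj h) = halfLink Γ ξ h := by
  rw [halfLink, Γ.adj_adj, Γ.out_adj, boolSign_not, antiBraket_swap, neg_mul_neg, halfLink]

/-- Every link is counted twice in the sum over all half-links. -/
theorem linkTerm_eq {T : Type*} [Fintype T] (Γ : CellBoundary T) (ξ : T → Fin 3 → Spinor) :
    linkTerm Γ ξ = (∑ h, halfLink Γ ξ h) / 2 := by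
  have h1 : linkTerm Γ ξ = ∑ h, if Γ.out h then halfLink Γ ξ h else 0 :=
    Finset.sum_congr rfl fun h _ => by
      by_cases hh : Γ.out h <;> simp [halfLink, hh, boolSign]
  have h2 : linkTerm Γ ξ = ∑ h, if Γ.out h then 0 else halfLink Γ ξ h := by
    rw [h1, ← Γ.sum_adj]
    refine Finset.sum_congr rfl fun h _ => ?_
    rw [Γ.out_adj, halfLink_adj]
    cases Γ.out h <;> simp
  have h3 : linkTerm Γ ξ + linkTerm Γ ξ = ∑ h, halfLink Γ ξ h := by
    nth_rewrite 1 [h1]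
    rw [h2, ← Finset.sum_add_distrib]
    refine Finset.sum_congr rfl fun h _ => ?_
    split_ifs <;> simp
  rw [← h3]
  ring

theorem norm_halfLink_le {T : Type*} (Γ : CellBoundary T) (ξ : T → Fin 3 → Spinor)
    (h : T × Fin 3) : ‖halfLink Γ ξ h‖ ≤
      (sqNorm (ξ h.1 h.2) + sqNorm (ξ (Γ.adj h).1 (Γ.adj h).2)) / 2 := by
  rw [halfLink, norm_mul, norm_boolSign, one_mul]
  exact norm_antiBraket_le _ _

theorem norm_linkTerm_le {T : Type*} [Fintype T] (Γ : CellBoundary T) (ξ : T → Fin 3 → Spinor) :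
    ‖linkTerm Γ ξ‖ ≤ (∑ t, sqNormSum (ξ t)) / 2 := by
  rw [linkTerm_eq, norm_div, Complex.norm_ofNat]
  gcongr
  refine (norm_sum_le _ _).trans ((Finset.sum_le_sum fun h _ => norm_halfLink_le Γ ξ h).trans ?_)
  rw [← Finset.sum_div, Finset.sum_add_distrib, Γ.sum_adj fun h => sqNorm (ξ h.1 h.2),
    Fintype.sum_prod_type]
  simp only [sqNormSum]
  linarith

theorem continuous_linkTerm {T : Type*} [Fintype T] (Γ : CellBoundary T) :
    Continuous (linkTerm Γ) := by
  unfold linkTerm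
  simp only [antiBraket_apply]
  refine continuous_finsetSum _ fun h _ => ?_
  split_ifs <;> fun_prop

theorem continuous_angleTerm (z : Fin 3 → Spinor) : Continuous (angleTerm z) := by
  unfold angleTerm
  simp only [holBraket_apply]
  fun_prop

theorem norm_angleTerm_le (z ξ : Fin 3 → Spinor) :
    ‖angleTerm z ξ‖ ≤ 2 * ‖z‖ ^ 2 * sqNormSum ξ := by
  have hz : ∀ i, sqNorm (z i) ≤ 2 * ‖z‖ ^ 2 := fun i =>
    (sqNorm_le _).trans (by gcongr; exact norm_le_pi_norm z i)
  have h : ∀ i, ‖holBraket (z i) (z (i + 1)) * holBraket (ξ i) (ξ (i + 1))‖ ≤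
      2 * ‖z‖ ^ 2 * ((sqNorm (ξ i) + sqNorm (ξ (i + 1))) / 2) := fun i => by
    rw [norm_mul]
    gcongr
    · exact (norm_holBraket_le _ _).trans (by linarith [hz i, hz (i + 1)])
    · exact norm_holBraket_le _ _
  refine (norm_sum_le _ _).trans ((Finset.sum_le_sum fun i _ => h i).trans_eq ?_)
  rw [← Finset.mul_sum, ← Finset.sum_div, Finset.sum_add_distrib,
    show ∑ i, sqNorm (ξ (i + 1)) = ∑ i, sqNorm (ξ i) from
      Equiv.sum_comp (Equiv.addRight (1 : Fin 3)) fun i => sqNorm (ξ i), sqNormSum]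
  ring

/-- Near the origin the angle terms use up only a small part of the Gaussian weight. -/
theorem eventually_norm_angleTerm_le {T : Type*} [Fintype T] :
    ∀ᶠ z in 𝓝 (0 : T → Fin 3 → Spinor), ∀ ξ : T → Fin 3 → Spinor,
      ∑ t, ‖angleTerm (z t) (ξ t)‖ ≤ 1 / 10 * ∑ t, sqNormSum (ξ t) := by
  filter_upwards [Metric.ball_mem_nhds (0 : T → Fin 3 → Spinor) (ε := 1 / 5) (by norm_num)]
    with z hz ξ
  rw [Finset.mul_sum]
  refine Finset.sum_le_sum fun t _ => (norm_angleTerm_le _ _).trans ?_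
  have h0 := sqNormSum_nonneg (ξ t)
  gcongr
  have : ‖z t‖ ≤ 1 / 5 := (norm_le_pi_norm z t).trans (by simpa using (mem_ball_zero_iff.1 hz).le)
  nlinarith [norm_nonneg (z t)]

/-- The exponential series in several variables, indexed by multi-indices. -/
theorem hasSum_prod_pow_div_factorial {𝕜 : Type*} [RCLike 𝕜] {ι : Type*} [Fintype ι]
    (x : ι → 𝕜) :
    HasSum (fun k : ι → ℕ => ∏ i, x i ^ k i / ((k i).factorial : 𝕜))
      (∏ i, NormedSpace.exp (x i)) := by
  suffices H : ∀ x : ι → 𝕜, HasSum (fun k : ι → ℕ => ∏ i, x i ^ k i / ((k i).factorial : 𝕜))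
      (∏ i, NormedSpace.exp (x i)) ∧
      Summable fun k : ι → ℕ => ‖∏ i, x i ^ k i / ((k i).factorial : 𝕜)‖ from (H x).1
  clear x
  refine Fintype.induction_empty_option (P := fun ι _ => ∀ x : ι → 𝕜,
    HasSum (fun k : ι → ℕ => ∏ i, x i ^ k i / ((k i).factorial : 𝕜))
      (∏ i, NormedSpace.exp (x i)) ∧
      Summable fun k : ι → ℕ => ‖∏ i, x i ^ k i / ((k i).factorial : 𝕜)‖) ?_ ?_ ?_ ι
  · intro α β _ e h x
    let _ := Fintype.ofEquiv β e.symm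
    obtain ⟨h1, h2⟩ := h (x ∘ e)
    have hf : ∀ k : α → ℕ, ∏ i, (x ∘ e) i ^ k i / ((k i).factorial : 𝕜) =
        ∏ i, x i ^ (k (e.symm i)) / ((k (e.symm i)).factorial : 𝕜) := fun k => by
      rw [← e.prod_comp]
      simp
    have hs : ∏ i, NormedSpace.exp ((x ∘ e) i) = ∏ i, NormedSpace.exp (x i) :=
      e.prod_comp fun i => NormedSpace.exp (x i)
    simp only [hf] at h1 h2
    rw [hs] at h1
    exact ⟨(e.symm.arrowCongr (Equiv.refl ℕ)).symm.hasSum_iff.1 h1,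
      (e.symm.arrowCongr (Equiv.refl ℕ)).symm.summable_iff.1 h2⟩
  · intro x
    exact ⟨by simp, Summable.of_finite⟩
  · intro α _ h x
    obtain ⟨h1, h2⟩ := h fun i => x (some i)
    have hx : HasSum (fun n : ℕ => x none ^ n / (n.factorial : 𝕜)) (NormedSpace.exp (x none)) :=
      NormedSpace.expSeries_div_hasSum_exp (x none)
    have hx' := NormedSpace.norm_expSeries_div_summable (x none)
    have hs := summable_mul_of_summable_norm hx' h2
    have hs' := hx'.mul_of_nonneg h2 (fun _ => norm_nonneg _) (fun _ => norm_nonneg _)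
    have hp := hx.mul h1 hs
    let e := Equiv.piOptionEquivProd (α := α) (β := fun _ => ℕ)
    refine ⟨?_, ?_⟩
    · rw [Fintype.prod_option, ← e.symm.hasSum_iff]
      refine hp.congr_fun fun k => ?_
      simp [e, Fintype.prod_option, Equiv.piOptionEquivProd]
      exact mul_div_mul_comm _ _ _ _
    · rw [← e.symm.summable_iff]
      refine hs'.congr fun k => ?_
      simp [e, Fintype.prod_option, Equiv.piOptionEquivProd]
      exact (mul_div_mul_comm _ _ _ _).symm

theorem hasSum_exp_sum {ι : Type*} [Fintype ι] (x : ι → ℂ) :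
    HasSum (fun k : ι → ℕ => ∏ i, x i ^ k i / ((k i).factorial : ℂ))
      (Complex.exp (∑ i, x i)) := by
  rw [Complex.exp_sum, Complex.exp_eq_exp_ℂ]
  exact hasSum_prod_pow_div_factorial x

theorem hasSum_real_exp_sum {ι : Type*} [Fintype ι] (x : ι → ℝ) :
    HasSum (fun k : ι → ℕ => ∏ i, x i ^ k i / ((k i).factorial : ℝ))
      (Real.exp (∑ i, x i)) := by
  rw [Real.exp_sum, Real.exp_eq_exp_ℝ]
  exact hasSum_prod_pow_div_factorial x

/-- The link term takes at most `1 / 2` and the angle terms at most `1 / 10` of the Gaussian weight. -/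
theorem eventually_hasSum_state {T : Type*} [Fintype T] (Γ : CellBoundary T) :
    ∀ᶠ z in 𝓝 (0 : T → Fin 3 → Spinor),
      Integrable (stateIntegrand Γ z) (auxMeasure T) ∧
      HasSum (fun k : T → ℕ => component Γ k z) (state Γ z) := by
  filter_upwards [eventually_norm_angleTerm_le] with z hz
  have hl := continuous_linkTerm Γ
  have ha : ∀ t, Continuous fun ξ : T → Fin 3 → Spinor => angleTerm (z t) (ξ t) := fun t =>
    (continuous_angleTerm (z t)).comp (continuous_apply t)
  have hb := integrable_auxMeasure_exp (T := T) (c := 3 / 5) (by norm_num)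
  have hexp : ∀ ξ : T → Fin 3 → Spinor, Real.exp ‖linkTerm Γ ξ‖ *
      Real.exp (∑ t, ‖angleTerm (z t) (ξ t)‖) ≤ Real.exp (3 / 5 * ∑ t, sqNormSum (ξ t)) :=
    fun ξ => by
      rw [← Real.exp_add, Real.exp_le_exp]
      linarith [norm_linkTerm_le Γ ξ, hz ξ]
  have hsum : ∀ ξ : T → Fin 3 → Spinor, HasSum (fun k : T → ℕ => Real.exp ‖linkTerm Γ ξ‖ *
      ∏ t, ‖angleTerm (z t) (ξ t)‖ ^ k t / ((k t).factorial : ℝ))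
      (Real.exp ‖linkTerm Γ ξ‖ * Real.exp (∑ t, ‖angleTerm (z t) (ξ t)‖)) := fun ξ =>
    (hasSum_real_exp_sum _).mul_left _
  refine ⟨hb.mono' ?_ (ae_of_all _ fun ξ => ?_), ?_⟩
  · unfold stateIntegrand
    fun_prop
  · rw [stateIntegrand, Complex.exp_add, norm_mul]
    refine le_trans ?_ (hexp ξ)
    gcongr
    · exact Complex.norm_exp_le_exp_norm _
    · exact (Complex.norm_exp_le_exp_norm _).trans (Real.exp_le_exp.2 (norm_sum_le _ _))
  · refine hasSum_integral_of_dominated_convergence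
      (fun (k : T → ℕ) ξ => Real.exp ‖linkTerm Γ ξ‖ *
        ∏ t, ‖angleTerm (z t) (ξ t)‖ ^ k t / ((k t).factorial : ℝ))
      (fun k => ?_) (fun k => ae_of_all _ fun ξ => ?_)
      (ae_of_all _ fun ξ => (hsum ξ).summable) ?_ (ae_of_all _ fun ξ => ?_)
    · fun_prop
    · rw [norm_mul, norm_prod]
      simp only [norm_div, norm_pow, Complex.norm_natCast]
      gcongr
      exact Complex.norm_exp_le_exp_norm _
    · simp_rw [fun ξ => (hsum ξ).tsum_eq]
      refine hb.mono' (by fun_prop) (ae_of_all _ fun ξ => ?_)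
      rw [Real.norm_of_nonneg (by positivity)]
      exact hexp ξ
    · rw [stateIntegrand, Complex.exp_add]
      exact (hasSum_exp_sum _).mul_left _

/-- The exponential of the link term is integrable against functions of slow growth, possibly
depending on further variables. -/
theorem integrable_cexp_linkTerm_mul {T : Type*} [Fintype T] (Γ : CellBoundary T) {E : Type*}
    [NormedAddCommGroup E] [MeasurableSpace E] [BorelSpace E] [SecondCountableTopology E]
    {μ : Measure E} [SFinite μ] (hμ : GaussianTail μ) {F : E × (T → Fin 3 → Spinor) → ℂ}
    (hF : SlowGrowth F) :
    Integrable (fun q => Complex.exp (linkTerm Γ q.2) * F q) (μ.prod (auxMeasure T)) := by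
  obtain ⟨a, ha, hia⟩ := hμ
  obtain ⟨C, hC⟩ := hF.2 (min a (1 / 4)) (by positivity)
  have hC0 : 0 ≤ C := by simpa using (norm_nonneg _).trans (hC 0)
  have hl := continuous_linkTerm Γ
  have hc := hF.1
  have hb := integrable_auxMeasure_exp (T := T) (c := 3 / 4) (by norm_num)
  refine ((hia.mul_prod hb).const_mul C).mono' (by fun_prop) (ae_of_all _ fun q => ?_)
  have hq : ‖q.2‖ ^ 2 ≤ ∑ t, sqNormSum (q.2 t) := by
    rcases isEmpty_or_nonempty T with hT | hT
    · simp [Subsingleton.elim q.2 0]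
    · obtain ⟨t, ht⟩ := Finite.exists_max fun t => ‖q.2 t‖
      have h1 : ‖q.2‖ ≤ ‖q.2 t‖ := (pi_norm_le_iff_of_nonneg (norm_nonneg _)).2 ht
      calc ‖q.2‖ ^ 2 ≤ ‖q.2 t‖ ^ 2 := by gcongr
        _ ≤ sqNormSum (q.2 t) := norm_sq_le_sqNormSum _
        _ ≤ _ := Finset.single_le_sum (f := fun t => sqNormSum (q.2 t))
          (fun t _ => sqNormSum_nonneg _) (Finset.mem_univ t)
  have hn : min a (1 / 4) * ‖q‖ ^ 2 ≤ a * ‖q.1‖ ^ 2 + 1 / 4 * ‖q.2‖ ^ 2 := by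
    have h1 : min a (1 / 4) * ‖q.1‖ ^ 2 ≤ a * ‖q.1‖ ^ 2 := by gcongr; exact min_le_left _ _
    have h2 : min a (1 / 4) * ‖q.2‖ ^ 2 ≤ 1 / 4 * ‖q.2‖ ^ 2 := by
      gcongr; exact min_le_right _ _
    have h3 : 0 ≤ a * ‖q.1‖ ^ 2 := by positivity
    have h4 : 0 ≤ 1 / 4 * ‖q.2‖ ^ 2 := by positivity
    rcases max_cases ‖q.1‖ ‖q.2‖ with h | h <;> rw [Prod.norm_def, h.1] <;> linarith
  rw [norm_mul]
  calc ‖Complex.exp (linkTerm Γ q.2)‖ * ‖F q‖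
      ≤ Real.exp ((∑ t, sqNormSum (q.2 t)) / 2) *
        (C * Real.exp (a * ‖q.1‖ ^ 2 + 1 / 4 * ∑ t, sqNormSum (q.2 t))) := by
        gcongr
        · exact (Complex.norm_exp_le_exp_norm _).trans
            (Real.exp_le_exp.2 (norm_linkTerm_le Γ q.2))
        · refine (hC q).trans ?_
          gcongr
          linarith
    _ = C * (Real.exp (a * ‖q.1‖ ^ 2) * Real.exp (3 / 4 * ∑ t, sqNormSum (q.2 t))) := by
        rw [mul_left_comm, ← Real.exp_add, ← Real.exp_add]
        ring_nf

/-! ### The links of the glued boundary -/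

namespace TypeII

variable {T : Type*} {Γ : CellBoundary T} (g : TypeII Γ)

/-- The half-links of the first glued triangle, counted from the shared side. -/
def side₁ (d : Fin 3) : T × Fin 3 := (g.t₁, g.i₁ + d)

/-- The half-links of the second glued triangle, counted from the shared side in the opposite
direction, so that equal labels are identified in the gluing. -/
def side₂ (d : Fin 3) : T × Fin 3 := (g.t₂, g.i₂ - d)

theorem adj_side₁_zero : Γ.adj (g.side₁ 0) = g.side₂ 0 := by
  simp [side₁, side₂, g.shared]

theorem adj_side₂_zero : Γ.adj (g.side₂ 0) = g.side₁ 0 := by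
  rw [← adj_side₁_zero, Γ.adj_adj]

theorem glued_side₁ (d : Fin 3) : g.Glued (g.side₁ d).1 := Or.inl rfl

theorem glued_side₂ (d : Fin 3) : g.Glued (g.side₂ d).1 := Or.inr rfl

theorem not_glued_adj_side₁ (l : Fin 2) : ¬ g.Glued (Γ.adj (g.side₁ l.succ)).1 :=
  not_or.2 (g.far₁ _ (by simp [Fin.succ_ne_zero]))

theorem not_glued_adj_side₂ (l : Fin 2) : ¬ g.Glued (Γ.adj (g.side₂ l.succ)).1 :=
  not_or.2 (g.far₂ _ (by simp [Fin.succ_ne_zero]))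

/-- The half-links of the remaining triangles, as half-links before the gluing. -/
def restSide (h : g.Rest × Fin 3) : T × Fin 3 := (h.1.1, h.2)

theorem not_glued_restSide (h : g.Rest × Fin 3) : ¬ g.Glued (g.restSide h).1 := not_or.2 h.1.2

/-- The sign of the orientation of the shared link, as seen from the first glued triangle. -/
def sharedSign : ℂ := boolSign (Γ.out (g.side₁ 0))

theorem norm_sharedSign : ‖g.sharedSign‖ = 1 := norm_boolSign _

variable [DecidableEq T]

theorem partner_side₁ (d : Fin 3) : g.partner (g.side₁ d) = g.side₂ d := by
  simp only [partner, side₁, side₂, Equiv.swap_apply_left, Prod.mk.injEq, true_and]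
  abel

theorem partner_side₂ (d : Fin 3) : g.partner (g.side₂ d) = g.side₁ d := by
  rw [← partner_side₁, partner_partner]

section Fintype

variable [Fintype T]

/-- A product over all triangles splits off the factors of the two glued ones. -/
theorem prod_triangles {M : Type*} [CommMonoid M] (f : T → M) :
    ∏ t, f t = f g.t₁ * f g.t₂ * ∏ t : g.Rest, f t := by
  rw [← Finset.mul_prod_erase _ _ (Finset.mem_univ g.t₁),
    ← Finset.mul_prod_erase _ _ (Finset.mem_erase.2 ⟨g.ne.symm, Finset.mem_univ g.t₂⟩), mul_assoc]
  congr 2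
  refine Finset.prod_subtype _ (fun t => ?_) f
  simp [and_comm]

theorem sum_triangles {M : Type*} [AddCommMonoid M] (f : T → M) :
    ∑ t, f t = f g.t₁ + f g.t₂ + ∑ t : g.Rest, f t :=
  g.prod_triangles (M := Multiplicative M) f

theorem sum_sides {M : Type*} [AddCommMonoid M] (f : T × Fin 3 → M) :
    ∑ h, f h = ∑ d, f (g.side₁ d) + ∑ d, f (g.side₂ d) + ∑ h, f (g.restSide h) := by
  rw [Fintype.sum_prod_type, g.sum_triangles, Fintype.sum_prod_type]
  congr 2
  · exact (Equiv.sum_comp (Equiv.addLeft g.i₁) fun i => f (g.t₁, i)).symm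
  · exact (Equiv.sum_comp (Equiv.subLeft g.i₂) fun i => f (g.t₂, i)).symm

/-- The half-links of remaining triangles that are cut by the gluing correspond to the sides other
than the shared one of the two glued triangles. -/
theorem sum_cut {M : Type*} [AddCommMonoid M] (φ : T × Fin 3 → M) :
    ∑ h, (if g.Glued (Γ.adj (g.restSide h)).1 then φ (Γ.adj (g.restSide h)) else 0) =
      ∑ l : Fin 2, φ (g.side₁ l.succ) + ∑ l : Fin 2, φ (g.side₂ l.succ) := by
  have h := Γ.sum_adj fun h => if g.Glued h.1 then 0 else
    if g.Glued (Γ.adj h).1 then φ (Γ.adj h) else 0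
  rw [g.sum_sides, g.sum_sides] at h
  simp only [Γ.adj_adj, glued_side₁, glued_side₂, if_true, not_glued_restSide, if_false,
    Finset.sum_const_zero, zero_add, ite_self, add_zero] at h
  rw [← h, Fin.sum_univ_succ, Fin.sum_univ_succ (n := 2) (f := fun d =>
    if g.Glued (Γ.adj (g.side₂ d)).1 then 0 else φ (g.side₂ d))]
  simp only [adj_side₁_zero, adj_side₂_zero, glued_side₁, glued_side₂, not_glued_adj_side₁,
    not_glued_adj_side₂, if_true, if_false, zero_add]

end Fintype

/-- The family on all triangles with the values `p.1` and `p.2` at the two glued ones, where sides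
are labelled as in `side₁` and `side₂`, and `f` elsewhere. -/
def unfold {α : Type*} (p : (Fin 3 → α) × (Fin 3 → α)) (f : g.Rest → Fin 3 → α) :
    T → Fin 3 → α :=
  g.extend (fun i => p.1 (i - g.i₁)) (fun i => p.2 (g.i₂ - i)) f

section unfold

variable {α : Type*} (p : (Fin 3 → α) × (Fin 3 → α)) (f : g.Rest → Fin 3 → α)

theorem unfold_t₁ : g.unfold p f g.t₁ = fun i => p.1 (i - g.i₁) := by simp [unfold, extend]

theorem unfold_t₂ : g.unfold p f g.t₂ = fun i => p.2 (g.i₂ - i) := by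
  simp [unfold, extend, g.ne.symm]

theorem unfold_rest (t : g.Rest) : g.unfold p f t = f t := by
  simp [unfold, extend, t.2.1, t.2.2]

theorem unfold_side₁ (d : Fin 3) : g.unfold p f (g.side₁ d).1 (g.side₁ d).2 = p.1 d := by
  simp [side₁, unfold_t₁]

theorem unfold_side₂ (d : Fin 3) : g.unfold p f (g.side₂ d).1 (g.side₂ d).2 = p.2 d := by
  simp [side₂, unfold_t₂]

theorem unfold_not_glued (p' : (Fin 3 → α) × (Fin 3 → α)) {t : T} (ht : ¬ g.Glued t) :
    g.unfold p f t = g.unfold p' f t :=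
  (g.unfold_rest p f ⟨t, not_or.1 ht⟩).trans (g.unfold_rest p' f ⟨t, not_or.1 ht⟩).symm

end unfold

/-- The spinor at a half-link of a remaining triangle, extended by zero to the glued ones. -/
def outer (f : g.Rest → Fin 3 → Spinor) (h : T × Fin 3) : Spinor := g.unfold 0 f h.1 h.2

theorem outer_restSide (f : g.Rest → Fin 3 → Spinor) (h : g.Rest × Fin 3) :
    g.outer f (g.restSide h) = f h.1 h.2 := by
  simp [outer, restSide, unfold_rest]

/-- The far ends of the links that are cut at the first glued triangle, as seen from there. -/
def cut₁ (f : g.Rest → Fin 3 → Spinor) (l : Fin 2) : Spinor :=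
  boolSign (Γ.out (g.side₁ l.succ)) • dual (g.outer f (Γ.adj (g.side₁ l.succ)))

/-- The far ends of the links that are cut at the second glued triangle, as seen from there. -/
def cut₂ (f : g.Rest → Fin 3 → Spinor) (l : Fin 2) : Spinor :=
  boolSign (Γ.out (g.side₂ l.succ)) • dual (g.outer f (Γ.adj (g.side₂ l.succ)))

variable [Fintype T]

/-- The link term of the links that do not touch the glued triangles. -/
noncomputable def restLinkTerm (f : g.Rest → Fin 3 → Spinor) : ℂ :=
  (∑ h, if g.Glued (Γ.adj (g.restSide h)).1 then 0 else
    halfLink Γ (g.unfold 0 f) (g.restSide h)) / 2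

theorem braket_boolSign_smul_dual (b : Bool) (w z : Spinor) :
    braket w (boolSign b • dual z) = boolSign b * antiBraket w z := by
  rw [braket_smul_right, antiBraket]

theorem linkTerm_unfold (p : (Fin 3 → Spinor) × (Fin 3 → Spinor))
    (f : g.Rest → Fin 3 → Spinor) :
    linkTerm Γ (g.unfold p f) =
      g.restLinkTerm f + cutLinkTerm g.sharedSign (g.cut₁ f) (g.cut₂ f) p := by
  have hout : ∀ {h : T × Fin 3}, ¬ g.Glued h.1 → g.unfold p f h.1 h.2 = g.outer f h :=
    fun hh => by rw [outer, g.unfold_not_glued p f 0 hh]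
  have h1 : ∀ l : Fin 2, halfLink Γ (g.unfold p f) (g.side₁ l.succ) =
      braket (p.1 l.succ) (g.cut₁ f l) := fun l => by
    rw [cut₁, braket_boolSign_smul_dual, halfLink, unfold_side₁, hout (g.not_glued_adj_side₁ l)]
  have h2 : ∀ l : Fin 2, halfLink Γ (g.unfold p f) (g.side₂ l.succ) =
      braket (p.2 l.succ) (g.cut₂ f l) := fun l => by
    rw [cut₂, braket_boolSign_smul_dual, halfLink, unfold_side₂, hout (g.not_glued_adj_side₂ l)]
  have h3 : halfLink Γ (g.unfold p f) (g.side₁ 0) = g.sharedSign * antiBraket (p.1 0) (p.2 0) := by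
    rw [halfLink, adj_side₁_zero, unfold_side₁, unfold_side₂, sharedSign]
  have h4 : halfLink Γ (g.unfold p f) (g.side₂ 0) = g.sharedSign * antiBraket (p.1 0) (p.2 0) := by
    rw [← adj_side₁_zero, halfLink_adj, h3]
  have h5 : ∑ h, halfLink Γ (g.unfold p f) (g.restSide h) =
      (∑ h, if g.Glued (Γ.adj (g.restSide h)).1 then
        halfLink Γ (g.unfold p f) (Γ.adj (g.restSide h)) else 0) +
      ∑ h, if g.Glued (Γ.adj (g.restSide h)).1 then 0 else
        halfLink Γ (g.unfold 0 f) (g.restSide h) := by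
    rw [← Finset.sum_add_distrib]
    refine Finset.sum_congr rfl fun h _ => ?_
    split_ifs with hh
    · rw [halfLink_adj, add_zero]
    · rw [zero_add, halfLink, halfLink, g.unfold_not_glued p f 0 (g.not_glued_restSide h),
        g.unfold_not_glued p f 0 hh]
  rw [linkTerm_eq, g.sum_sides, h5, g.sum_cut, Fin.sum_univ_succ, Fin.sum_univ_succ (n := 2), h3,
    h4]
  simp only [h1, h2, restLinkTerm, cutLinkTerm, pairing]
  ring

/-- The link term after the gluing: the shared link connects the cut links to merged ones. -/
theorem linkTerm_glue (f : g.Rest → Fin 3 → Spinor) :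
    linkTerm g.glue f = g.restLinkTerm f +
      -g.sharedSign * ∑ l, holBraket (g.cut₁ f l) (g.cut₂ f l) := by
  have hadj : ∀ h : g.Rest × Fin 3, f (g.glue.adj h).1 (g.glue.adj h).2 =
      g.outer f (g.newAdj (g.restSide h)) := fun h => by
    rw [← g.outer_restSide f]
    rfl
  let φ : T × Fin 3 → ℂ := fun s =>
    boolSign (xor (Γ.out (g.sharedSide s.1)) (xor (Γ.out s) (Γ.out (g.partner s)))) *
      antiBraket (g.outer f (Γ.adj s)) (g.outer f (Γ.adj (g.partner s)))
  have h0 : ∀ h, halfLink g.glue f h =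
      (if g.Glued (Γ.adj (g.restSide h)).1 then φ (Γ.adj (g.restSide h)) else 0) +
      if g.Glued (Γ.adj (g.restSide h)).1 then 0 else
        halfLink Γ (g.unfold 0 f) (g.restSide h) := fun h => by
    have ho : g.glue.out h = g.newOut (g.restSide h) := rfl
    rw [halfLink, hadj, ho, newOut, newAdj, ← g.outer_restSide f]
    split_ifs with hh
    · simp only [φ, Γ.adj_adj, add_zero]
    · rw [zero_add]
      rfl
  have h1 : ∀ l : Fin 2, φ (g.side₁ l.succ) =
      -g.sharedSign * holBraket (g.cut₁ f l) (g.cut₂ f l) := fun l => by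
    have hs : g.sharedSide (g.side₁ l.succ).1 = g.side₁ 0 := by simp [sharedSide, side₁]
    simp only [φ, partner_side₁, boolSign_xor, hs, cut₁, cut₂, sharedSign, holBraket_apply,
      antiBraket_apply, Pi.smul_apply, smul_eq_mul, dual, Matrix.cons_val_zero,
      Matrix.cons_val_one]
    ring
  have h2 : ∀ l : Fin 2, φ (g.side₂ l.succ) =
      -g.sharedSign * holBraket (g.cut₁ f l) (g.cut₂ f l) := fun l => by
    have hs : g.sharedSide (g.side₂ l.succ).1 = Γ.adj (g.side₁ 0) := by
      simp [sharedSide, side₂, side₁, g.ne.symm, g.shared]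
    simp only [φ, partner_side₂, boolSign_xor, hs, Γ.out_adj, boolSign_not, cut₁, cut₂,
      sharedSign, holBraket_apply,
      antiBraket_apply, Pi.smul_apply, smul_eq_mul, dual, Matrix.cons_val_zero,
      Matrix.cons_val_one]
    ring
  rw [linkTerm_eq, Finset.sum_congr rfl fun h _ => h0 h, Finset.sum_add_distrib, g.sum_cut]
  simp only [h1, h2, ← Finset.mul_sum, restLinkTerm]
  ring

theorem cutNorm_eq_sum (f : g.Rest → Fin 3 → Spinor) :
    cutNorm (g.cut₁ f) (g.cut₂ f) =
      (∑ h, if g.Glued (Γ.adj (g.restSide h)).1 then sqNorm (f h.1 h.2) else 0) / 2 := by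
  have h := g.sum_cut fun s => sqNorm (g.outer f (Γ.adj s))
  simp only [Γ.adj_adj, outer_restSide] at h
  rw [h]
  simp [cutNorm, sqNormSum, cut₁, cut₂, sqNorm_smul, norm_boolSign, sqNorm_dual]

/-- The links that do not touch the glued triangles and the cut links are controlled by
complementary halves of the auxiliary spinors. -/
theorem norm_restLinkTerm_add_le (f : g.Rest → Fin 3 → Spinor) :
    ‖g.restLinkTerm f‖ + cutNorm (g.cut₁ f) (g.cut₂ f) ≤ (∑ t, sqNormSum (f t)) / 2 := by
  -- squared norms at the half-links of links between remaining triangles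
  let ψ : T × Fin 3 → ℝ := fun h => if g.Glued h.1 ∨ g.Glued (Γ.adj h).1 then 0 else
    sqNorm (g.outer f h)
  have hψ := Γ.sum_adj ψ
  rw [g.sum_sides, g.sum_sides] at hψ
  simp only [ψ, Γ.adj_adj, glued_side₁, glued_side₂, true_or, or_true, if_true,
    not_glued_restSide, false_or, or_false, Finset.sum_const_zero, zero_add] at hψ
  have h1 : ‖g.restLinkTerm f‖ ≤ (∑ h, if g.Glued (Γ.adj (g.restSide h)).1 then 0 else
      sqNorm (f h.1 h.2)) / 2 := by
    rw [restLinkTerm, norm_div, Complex.norm_ofNat]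
    gcongr
    calc _ ≤ ∑ h, ((if g.Glued (Γ.adj (g.restSide h)).1 then 0 else
            sqNorm (g.outer f (g.restSide h))) + if g.Glued (Γ.adj (g.restSide h)).1 then 0 else
            sqNorm (g.outer f (Γ.adj (g.restSide h)))) / 2 := by
          refine (norm_sum_le _ _).trans (Finset.sum_le_sum fun h _ => ?_)
          split_ifs
          · simp
          · exact norm_halfLink_le Γ (g.unfold 0 f) (g.restSide h)
      _ = _ := by
          rw [← Finset.sum_div, Finset.sum_add_distrib, hψ]
          simp only [outer_restSide]
          ring
  have h2 : ∑ t, sqNormSum (f t) =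
      (∑ h, if g.Glued (Γ.adj (g.restSide h)).1 then 0 else sqNorm (f h.1 h.2)) +
      ∑ h, if g.Glued (Γ.adj (g.restSide h)).1 then sqNorm (f h.1 h.2) else 0 := by
    rw [← Finset.sum_add_distrib]
    simp only [sqNormSum]
    rw [← Fintype.sum_prod_type']
    refine Finset.sum_congr rfl fun h _ => ?_
    split_ifs <;> simp
  rw [cutNorm_eq_sum]
  linarith

end TypeII

/-! ### The gluing formula -/

theorem angleTerm_comp_sub (a : Fin 3) (x ξ : Fin 3 → Spinor) :
    angleTerm (fun i => x (i - a)) ξ = angleTerm x fun d => ξ (a + d) := by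
  unfold angleTerm
  rw [← Equiv.sum_comp (Equiv.addLeft a)]
  refine Finset.sum_congr rfl fun d _ => ?_
  simp only [Equiv.coe_addLeft, add_sub_cancel_left, add_assoc]

/-- Both brackets in an angle term change sign when the cyclic order is reversed. -/
theorem angleTerm_comp_sub_left (a : Fin 3) (x ξ : Fin 3 → Spinor) :
    angleTerm (fun i => x (a - i)) ξ = angleTerm x fun d => ξ (a - d) := by
  unfold angleTerm
  rw [← Equiv.sum_comp (Equiv.subLeft (a - 1))]
  refine Finset.sum_congr rfl fun d _ => ?_
  have h1 : a - (a - 1 - d) = d + 1 := by abel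
  have h2 : a - 1 - d + 1 = a - d := by abel
  have h3 : a - (d + 1) = a - 1 - d := by abel
  simp only [Equiv.subLeft_apply, h1, h2, h3, sub_sub_cancel]
  rw [holBraket_swap (x d), holBraket_swap (ξ (a - d)), neg_mul_neg]

theorem measurePreserving_relabel (e : Fin 3 ≃ Fin 3) :
    MeasurePreserving (fun (x : Fin 3 → Spinor) i => x (e i)) triangleMeasure triangleMeasure := by
  unfold triangleMeasure
  convert measurePreserving_piCongrLeft (fun _ : Fin 3 => spinorMeasure) e.symm using 1
  ext1 x
  ext1 i
  obtain ⟨j, rfl⟩ := e.symm.surjective i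
  rw [MeasurableEquiv.coe_piCongrLeft, Equiv.piCongrLeft_apply_apply, Equiv.apply_symm_apply]

namespace TypeII

variable {T : Type*} {Γ : CellBoundary T} (g : TypeII Γ)

/-- The passage from the labels of `side₁` and `side₂` to the original labels of the sides. -/
def relabel : (Fin 3 → Spinor) × (Fin 3 → Spinor) ≃ᵐ (Fin 3 → Spinor) × (Fin 3 → Spinor) where
  toFun p := (fun i => p.1 (i - g.i₁), fun i => p.2 (g.i₂ - i))
  invFun p := (fun d => p.1 (g.i₁ + d), fun d => p.2 (g.i₂ - d))
  left_inv p := by ext <;> simp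
  right_inv p := by ext <;> simp
  measurable_toFun := by
    change Measurable fun p : (Fin 3 → Spinor) × (Fin 3 → Spinor) =>
      ((fun i => p.1 (i - g.i₁), fun i => p.2 (g.i₂ - i)) : (Fin 3 → Spinor) × (Fin 3 → Spinor))
    exact Continuous.measurable (by fun_prop)
  measurable_invFun := by
    change Measurable fun p : (Fin 3 → Spinor) × (Fin 3 → Spinor) =>
      ((fun d => p.1 (g.i₁ + d), fun d => p.2 (g.i₂ - d)) : (Fin 3 → Spinor) × (Fin 3 → Spinor))
    exact Continuous.measurable (by fun_prop)

theorem measurePreserving_relabel : MeasurePreserving g.relabel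
    (triangleMeasure.prod triangleMeasure) (triangleMeasure.prod triangleMeasure) :=
  (SpinNet.measurePreserving_relabel (Equiv.subRight g.i₁)).prod
    (SpinNet.measurePreserving_relabel (Equiv.subLeft g.i₂))

variable [DecidableEq T]

/-- A series over the total spins at all nodes, in which the total spins at the two glued nodes
are forced to agree. -/
theorem hasSum_diagonal_mul {𝕜 : Type*} [RCLike 𝕜] {A : ℕ → 𝕜} {B : (g.Rest → ℕ) → 𝕜} {a b : 𝕜}
    (hA : HasSum A a) (hB : HasSum B b) (hAn : Summable fun n => ‖A n‖)
    (hBn : Summable fun k => ‖B k‖) :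
    HasSum (fun k : T → ℕ => (if k g.t₁ = k g.t₂ then A (k g.t₁) else 0) *
      B fun t : g.Rest => k t) (a * b) := by
  let ι : ℕ × (g.Rest → ℕ) → T → ℕ := fun m => g.extend m.1 m.1 m.2
  have h1 : ∀ m, ι m g.t₁ = m.1 := fun m => by simp [ι, extend]
  have h2 : ∀ m, ι m g.t₂ = m.1 := fun m => by simp [ι, extend, g.ne.symm]
  have h3 : ∀ m, (fun t : g.Rest => ι m t) = m.2 := fun m => by
    ext t
    simp [ι, extend, t.2.1, t.2.2]
  have hinj : Function.Injective ι := fun m n h =>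
    Prod.ext (by rw [← h1 m, h, h1]) (by rw [← h3 m, h, h3])
  rw [← hinj.hasSum_iff]
  · refine (hA.mul hB (summable_mul_of_summable_norm hAn hBn)).congr_fun fun m => ?_
    simp only [Function.comp_apply, h1, h2, h3, if_true]
  · intro k hk
    rw [if_neg, zero_mul]
    intro he
    refine hk ⟨(k g.t₁, fun t => k t), ?_⟩
    ext t
    simp only [ι, extend]
    split_ifs with c1 c2
    · rw [c1]
    · rw [c2, he]
    · rfl

variable [Fintype T]

theorem measurePreserving_extend : MeasurePreserving
    (fun q : ((Fin 3 → Spinor) × (Fin 3 → Spinor)) × (g.Rest → Fin 3 → Spinor) =>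
      g.extend q.1.1 q.1.2 q.2)
    ((triangleMeasure.prod triangleMeasure).prod (auxMeasure g.Rest)) (auxMeasure T) := by
  have hm : Measurable fun q : ((Fin 3 → Spinor) × (Fin 3 → Spinor)) ×
      (g.Rest → Fin 3 → Spinor) => g.extend q.1.1 q.1.2 q.2 := by
    refine measurable_pi_lambda _ fun t => ?_
    unfold extend
    split_ifs <;> fun_prop
  refine ⟨hm, (Measure.pi_eq fun s hs => ?_).symm⟩
  have hpre : (fun q : ((Fin 3 → Spinor) × (Fin 3 → Spinor)) × (g.Rest → Fin 3 → Spinor) =>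
      g.extend q.1.1 q.1.2 q.2) ⁻¹' Set.univ.pi s =
      (s g.t₁ ×ˢ s g.t₂) ×ˢ Set.univ.pi fun t : g.Rest => s t := by
    ext q
    simp only [Set.mem_preimage, Set.mem_pi, Set.mem_univ, true_imp_iff, Set.mem_prod]
    refine ⟨fun h => ⟨⟨?_, ?_⟩, fun t => ?_⟩, fun h t => ?_⟩
    · simpa [extend] using h g.t₁
    · simpa [extend, g.ne.symm] using h g.t₂
    · simpa [extend, t.2.1, t.2.2] using h t
    · unfold extend
      split_ifs with h1 h2
      · exact h1 ▸ h.1.1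
      · exact h2 ▸ h.1.2
      · exact h.2 ⟨t, h1, h2⟩
  rw [Measure.map_apply hm (MeasurableSet.univ_pi hs), hpre, Measure.prod_prod, Measure.prod_prod,
    auxMeasure, Measure.pi_pi, g.prod_triangles]

theorem measurePreserving_unfold : MeasurePreserving
    (fun q : ((Fin 3 → Spinor) × (Fin 3 → Spinor)) × (g.Rest → Fin 3 → Spinor) =>
      g.unfold q.1 q.2)
    ((triangleMeasure.prod triangleMeasure).prod (auxMeasure g.Rest)) (auxMeasure T) :=
  g.measurePreserving_extend.comp
    (g.measurePreserving_relabel.prod (MeasurePreserving.id (auxMeasure g.Rest)))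

/-- The factor of the gluing integrand beside the exponential of the link term, as a function of
the spinors of the glued triangles and all auxiliary spinors. -/
noncomputable def amplitudeFactor (k : T → ℕ) (z : g.Rest → Fin 3 → Spinor)
    (q : ((Fin 3 → Spinor) × (Fin 3 → Spinor)) × (T → Fin 3 → Spinor)) : ℂ :=
  (∏ t, angleTerm (g.unfold q.1 z t) (q.2 t) ^ k t / ((k t).factorial : ℂ)) *
    (((sqNorm (q.1.1 0) : ℂ) - 1) * edgeFun (foldTerm q.1.1 q.1.2))

theorem gluingIntegrand_relabel (k : T → ℕ) (z : g.Rest → Fin 3 → Spinor)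
    (p : (Fin 3 → Spinor) × (Fin 3 → Spinor)) :
    g.gluingIntegrand k z (g.relabel p) =
      ∫ ξ, Complex.exp (linkTerm Γ ξ) * g.amplitudeFactor k z (p, ξ) ∂auxMeasure T := by
  have hf : ∑ i, antiBraket ((g.relabel p).1 i) ((g.relabel p).2 (g.i₁ + g.i₂ - i)) =
      foldTerm p.1 p.2 := by
    rw [foldTerm, ← Equiv.sum_comp (Equiv.subRight g.i₁) fun d => antiBraket (p.1 d) (p.2 d)]
    refine Finset.sum_congr rfl fun i _ => ?_
    have : g.i₂ - (g.i₁ + g.i₂ - i) = i - g.i₁ := by abel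
    simp [relabel, this]
  have he : g.edgeAmplitude (g.relabel p).1 (g.relabel p).2 = edgeFun (foldTerm p.1 p.2) := by
    rw [edgeAmplitude, hf, edgeFun]
  have hface : faceAmplitude ((g.relabel p).1 g.i₁) = (sqNorm (p.1 0) : ℂ) - 1 := by
    rw [faceAmplitude, braket_self]
    simp [relabel]
  rw [gluingIntegrand, he, hface, component, mul_assoc, ← integral_mul_const]
  refine integral_congr_ae (ae_of_all _ fun ξ => ?_)
  simp only [amplitudeFactor, unfold, relabel, MeasurableEquiv.coe_mk, Equiv.coe_fn_mk]
  ring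

theorem slowGrowth_amplitudeFactor (k : T → ℕ) (z : g.Rest → Fin 3 → Spinor) :
    SlowGrowth (g.amplitudeFactor k z) := by
  have h1 : ∀ i j, SlowGrowth fun q : ((Fin 3 → Spinor) × (Fin 3 → Spinor)) ×
      (T → Fin 3 → Spinor) => q.1.1 i j := fun i j =>
    SlowGrowth.of_norm_le (by fun_prop) (a := 0) (b := 1) fun q => by
      simpa using (norm_le_pi_norm (q.1.1 i) j).trans ((norm_le_pi_norm q.1.1 i).trans
        ((norm_fst_le q.1).trans (norm_fst_le q)))
  have h2 : ∀ i j, SlowGrowth fun q : ((Fin 3 → Spinor) × (Fin 3 → Spinor)) ×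
      (T → Fin 3 → Spinor) => q.1.2 i j := fun i j =>
    SlowGrowth.of_norm_le (by fun_prop) (a := 0) (b := 1) fun q => by
      simpa using (norm_le_pi_norm (q.1.2 i) j).trans ((norm_le_pi_norm q.1.2 i).trans
        ((norm_snd_le q.1).trans (norm_fst_le q)))
  have h3 : ∀ t i j, SlowGrowth fun q : ((Fin 3 → Spinor) × (Fin 3 → Spinor)) ×
      (T → Fin 3 → Spinor) => q.2 t i j := fun t i j =>
    SlowGrowth.of_norm_le (by fun_prop) (a := 0) (b := 1) fun q => by
      simpa using (norm_le_pi_norm (q.2 t i) j).trans ((norm_le_pi_norm (q.2 t) i).trans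
        ((norm_le_pi_norm q.2 t).trans (norm_snd_le q)))
  have h4 : ∀ t i j, SlowGrowth fun q : ((Fin 3 → Spinor) × (Fin 3 → Spinor)) ×
      (T → Fin 3 → Spinor) => g.unfold q.1 z t i j := fun t i j => by
    unfold unfold extend
    split_ifs
    · exact h1 _ j
    · exact h2 _ j
    · exact SlowGrowth.const _
  refine (SlowGrowth.prod _ fun t _ => ((SlowGrowth.angleTerm (h4 t) (h3 t)).pow _).div_const
    _).mul (((SlowGrowth.sqNorm (h1 0)).sub (SlowGrowth.const 1)).mul ?_)
  refine SlowGrowth.edgeFun_comp (K := 6) (continuous_foldTerm.comp continuous_fst) (by norm_num)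
    fun q => (norm_foldTerm_le q.1).trans ?_
  gcongr
  exact norm_fst_le q

theorem integrable_cexp_linkTerm_mul_amplitudeFactor (k : T → ℕ)
    (z : g.Rest → Fin 3 → Spinor) :
    Integrable (fun q => Complex.exp (linkTerm Γ q.2) * g.amplitudeFactor k z q)
      ((triangleMeasure.prod triangleMeasure).prod (auxMeasure T)) :=
  integrable_cexp_linkTerm_mul Γ (gaussianTail_triangle.prod gaussianTail_triangle)
    (g.slowGrowth_amplitudeFactor k z)

theorem integrable_gluingIntegrand (k : T → ℕ) (z : g.Rest → Fin 3 → Spinor) :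
    Integrable (g.gluingIntegrand k z) (triangleMeasure.prod triangleMeasure) := by
  rw [← g.measurePreserving_relabel.integrable_comp_emb g.relabel.measurableEmbedding]
  refine (g.integrable_cexp_linkTerm_mul_amplitudeFactor k z).integral_prod_left.congr
    (ae_of_all _ fun p => ?_)
  exact (g.gluingIntegrand_relabel k z p).symm

/-- The amplitudes act on the auxiliary spinors by joining the two glued triangles. -/
theorem integral_amplitudeFactor (k : T → ℕ) (z : g.Rest → Fin 3 → Spinor)
    (q : (Fin 3 → Spinor) × (Fin 3 → Spinor)) (f : g.Rest → Fin 3 → Spinor) :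
    ∫ p, g.amplitudeFactor k z (p, g.unfold q f) ∂triangleMeasure.prod triangleMeasure =
      (∏ t, angleTerm (z t) (f t) ^ k t / ((k t).factorial : ℂ)) *
        if k g.t₁ = k g.t₂ then weightedPow (k g.t₁) (hubTerm q.1 q.2) (rimTerm q.1 q.2) /
          ((k g.t₁ + 1).factorial : ℂ) else 0 := by
  rw [← integral_amplitudes, ← integral_const_mul]
  refine integral_congr_ae (ae_of_all _ fun p => ?_)
  beta_reduce
  rw [amplitudeFactor, g.prod_triangles]
  simp only [unfold_t₁, unfold_t₂, unfold_rest, angleTerm_comp_sub, angleTerm_comp_sub_left,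
    add_sub_cancel_left, sub_sub_cancel]
  ring

/-- The component `k` of the gluing, as an integrand in the remaining auxiliary spinors. -/
noncomputable def gluedIntegrand (k : T → ℕ) (z f : g.Rest → Fin 3 → Spinor) : ℂ :=
  Complex.exp (g.restLinkTerm f) *
    ((if k g.t₁ = k g.t₂ then mergedTerm g.sharedSign (g.cut₁ f) (g.cut₂ f) (k g.t₁) else 0) *
      ∏ t, angleTerm (z t) (f t) ^ k t / ((k t).factorial : ℂ))

/-- Fubini's theorem: the spinors of the glued triangles are integrated first, then their auxiliary
spinors. -/
theorem integrable_gluedIntegrand (k : T → ℕ) (z : g.Rest → Fin 3 → Spinor) :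
    Integrable (g.gluedIntegrand k z) (auxMeasure g.Rest) ∧
    ∫ p, g.gluingIntegrand k z p ∂triangleMeasure.prod triangleMeasure =
      ∫ f, g.gluedIntegrand k z f ∂auxMeasure g.Rest := by
  have hi := g.integrable_cexp_linkTerm_mul_amplitudeFactor k z
  let W : (T → Fin 3 → Spinor) → ℂ := fun ξ => ∫ p, Complex.exp (linkTerm Γ ξ) *
    g.amplitudeFactor k z (p, ξ) ∂triangleMeasure.prod triangleMeasure
  have hW : Integrable W (auxMeasure T) := hi.integral_prod_right
  have hmp := g.measurePreserving_unfold
  have hWc := hmp.integrable_comp_of_integrable hW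
  have hinner : ∀ f, ∫ q, W (g.unfold q f) ∂triangleMeasure.prod triangleMeasure =
      g.gluedIntegrand k z f := fun f => by
    have h1 : ∀ q, W (g.unfold q f) = (Complex.exp (g.restLinkTerm f) *
        ∏ t, angleTerm (z t) (f t) ^ k t / ((k t).factorial : ℂ)) *
        (if k g.t₁ = k g.t₂ then Complex.exp (cutLinkTerm g.sharedSign (g.cut₁ f) (g.cut₂ f) q) *
          (weightedPow (k g.t₁) (hubTerm q.1 q.2) (rimTerm q.1 q.2) /
            ((k g.t₁ + 1).factorial : ℂ)) else 0) := fun q => by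
      simp only [W]
      rw [integral_const_mul, integral_amplitudeFactor, linkTerm_unfold, Complex.exp_add]
      split_ifs <;> ring
    simp_rw [h1]
    rw [integral_const_mul, gluedIntegrand]
    split_ifs with hk
    · rw [integral_cexp_cutLinkTerm_mul g.norm_sharedSign (boolSign_sq _)]
      ring
    · simp
  refine ⟨hWc.integral_prod_right.congr (ae_of_all _ hinner), ?_⟩
  calc ∫ p, g.gluingIntegrand k z p ∂triangleMeasure.prod triangleMeasure
      = ∫ p, g.gluingIntegrand k z (g.relabel p) ∂triangleMeasure.prod triangleMeasure :=
        (g.measurePreserving_relabel.integral_comp' _).symm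
    _ = ∫ ξ, W ξ ∂auxMeasure T := by
        simp_rw [gluingIntegrand_relabel]
        exact integral_integral_swap hi
    _ = ∫ q : ((Fin 3 → Spinor) × (Fin 3 → Spinor)) × (g.Rest → Fin 3 → Spinor),
          W (g.unfold q.1 q.2)
          ∂(triangleMeasure.prod triangleMeasure).prod (auxMeasure g.Rest) := by
        rw [← hmp.map_eq]
        refine integral_map hmp.aemeasurable ?_
        rw [hmp.map_eq]
        exact hW.aestronglyMeasurable
    _ = _ := by
        refine (integral_prod_symm _ hWc).trans ?_
        exact integral_congr_ae (ae_of_all _ hinner)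

theorem eventually_hasSum_gluing :
    ∀ᶠ z in 𝓝 (0 : g.Rest → Fin 3 → Spinor), HasSum
      (fun k : T → ℕ => ∫ p, g.gluingIntegrand k z p ∂triangleMeasure.prod triangleMeasure)
      (state g.glue z) := by
  filter_upwards [eventually_norm_angleTerm_le] with z hz
  simp_rw [fun k => (g.integrable_gluedIntegrand k z).2]
  have ha : ∀ t, Continuous fun f : g.Rest → Fin 3 → Spinor => angleTerm (z t) (f t) := fun t =>
    (continuous_angleTerm (z t)).comp (continuous_apply t)
  let c : (g.Rest → Fin 3 → Spinor) → ℝ := fun f => cutNorm (g.cut₁ f) (g.cut₂ f)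
  have hc0 : ∀ f, 0 ≤ c f := fun f => cutNorm_nonneg _ _
  have hc : Continuous c := by
    simp only [c, cutNorm_eq_sum]
    refine Continuous.div_const (continuous_finsetSum _ fun h _ => ?_) _
    have := continuous_sqNorm
    split_ifs <;> fun_prop
  have hQ : Continuous fun f : g.Rest → Fin 3 → Spinor => ∑ t, sqNormSum (f t) := by
    have := continuous_sqNorm
    unfold sqNormSum
    fun_prop
  have hA : ∀ f, HasSum (fun n : ℕ => 4 * Real.exp (c f / 5) *
      ((5 / 4 * c f) ^ n / n.factorial)) (4 * Real.exp (c f / 5) * Real.exp (5 / 4 * c f)) :=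
    fun f => by
      rw [Real.exp_eq_exp_ℝ]
      exact (NormedSpace.expSeries_div_hasSum_exp (5 / 4 * c f)).mul_left _
  have hAn : ∀ f (n : ℕ), 0 ≤ 4 * Real.exp (c f / 5) * ((5 / 4 * c f) ^ n / n.factorial) :=
    fun f n => by have := hc0 f; positivity
  have hB : ∀ f : g.Rest → Fin 3 → Spinor, HasSum (fun k : g.Rest → ℕ =>
      ∏ t, ‖angleTerm (z t) (f t)‖ ^ k t / ((k t).factorial : ℝ))
      (Real.exp (∑ t, ‖angleTerm (z t) (f t)‖)) := fun f => hasSum_real_exp_sum _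
  have hBn : ∀ (f : g.Rest → Fin 3 → Spinor) (k : g.Rest → ℕ),
      0 ≤ ∏ t, ‖angleTerm (z t) (f t)‖ ^ k t / ((k t).factorial : ℝ) := fun f k => by positivity
  let bound : (T → ℕ) → (g.Rest → Fin 3 → Spinor) → ℝ := fun k f =>
    Real.exp ((∑ t, sqNormSum (f t)) / 2 - c f) *
      ((if k g.t₁ = k g.t₂ then 4 * Real.exp (c f / 5) *
        ((5 / 4 * c f) ^ k g.t₁ / (k g.t₁).factorial) else 0) *
        ∏ t : g.Rest, ‖angleTerm (z t) (f t)‖ ^ k t / ((k t).factorial : ℝ))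
  have hsum : ∀ f, HasSum (fun k => bound k f) (Real.exp ((∑ t, sqNormSum (f t)) / 2 - c f) *
      (4 * Real.exp (c f / 5) * Real.exp (5 / 4 * c f) *
        Real.exp (∑ t, ‖angleTerm (z t) (f t)‖))) := fun f => by
    refine (g.hasSum_diagonal_mul (hA f) (hB f) ?_ ?_).mul_left _
    · simpa only [Real.norm_of_nonneg (hAn f _)] using (hA f).summable
    · simpa only [Real.norm_of_nonneg (hBn f _)] using (hB f).summable
  refine hasSum_integral_of_dominated_convergence bound
    (fun k => (g.integrable_gluedIntegrand k z).1.aestronglyMeasurable)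
    (fun k => ae_of_all _ fun f => ?_) (ae_of_all _ fun f => (hsum f).summable) ?_
    (ae_of_all _ fun f => ?_)
  · rw [gluedIntegrand, norm_mul, norm_mul, norm_prod]
    simp only [norm_div, norm_pow, Complex.norm_natCast, bound]
    have h1 : ‖Complex.exp (g.restLinkTerm f)‖ ≤
        Real.exp ((∑ t, sqNormSum (f t)) / 2 - c f) :=
      (Complex.norm_exp_le_exp_norm _).trans (Real.exp_le_exp.2 (by
        linarith [g.norm_restLinkTerm_add_le f]))
    have h2 : ‖if k g.t₁ = k g.t₂ then
        mergedTerm g.sharedSign (g.cut₁ f) (g.cut₂ f) (k g.t₁) else 0‖ ≤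
        if k g.t₁ = k g.t₂ then 4 * Real.exp (c f / 5) *
          ((5 / 4 * c f) ^ k g.t₁ / (k g.t₁).factorial) else 0 := by
      split_ifs
      · exact norm_mergedTerm_le g.norm_sharedSign _ _ _
      · simp
    gcongr
  · simp_rw [fun f => (hsum f).tsum_eq]
    -- the cut links take `29 / 20` instead of `1` times their share of at most `1 / 2` of the weight
    refine ((integrable_auxMeasure_exp (T := g.Rest) (c := 33 / 40) (by norm_num)).const_mul
      4).mono' (by fun_prop) (ae_of_all _ fun f => ?_)
    have h1 := g.norm_restLinkTerm_add_le f
    have h2 := norm_nonneg (g.restLinkTerm f)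
    have h3 := hz f
    rw [Real.norm_of_nonneg (by positivity)]
    calc _ = 4 * Real.exp ((∑ t, sqNormSum (f t)) / 2 - c f + c f / 5 + 5 / 4 * c f +
          ∑ t, ‖angleTerm (z t) (f t)‖) := by
          rw [Real.exp_add, Real.exp_add, Real.exp_add]
          ring
      _ ≤ _ := by
          gcongr
          simp only [c]
          linarith
  · have h : HasSum (fun k : T → ℕ => g.gluedIntegrand k z f)
        (Complex.exp (g.restLinkTerm f) *
          (Complex.exp (-g.sharedSign * ∑ l, holBraket (g.cut₁ f l) (g.cut₂ f l)) *
            Complex.exp (∑ t, angleTerm (z t) (f t)))) := by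
      refine (g.hasSum_diagonal_mul (hasSum_mergedTerm g.norm_sharedSign (g.cut₁ f) (g.cut₂ f))
        (hasSum_exp_sum _) ?_ ?_).mul_left _
      · exact (hA f).summable.of_nonneg_of_le (fun _ => norm_nonneg _)
          fun n => norm_mergedTerm_le g.norm_sharedSign _ _ n
      · simpa only [norm_prod, norm_div, norm_pow, Complex.norm_natCast] using (hB f).summable
    suffices hs : stateIntegrand g.glue z f = _ from hs ▸ h
    rw [stateIntegrand, linkTerm_glue, Complex.exp_add, Complex.exp_add, mul_assoc]

end TypeII

/-! ### The delta function on the group -/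

namespace SU2

theorem star_eq_adjugate (u : SU2) :
    star (u : Matrix (Fin 2) (Fin 2) ℂ) = (u : Matrix (Fin 2) (Fin 2) ℂ).adjugate := by
  obtain ⟨h1, h2⟩ := Matrix.mem_specialUnitaryGroup_iff.1 u.2
  have h3 := Matrix.mem_unitaryGroup_iff'.1 h1
  have h4 := Matrix.mul_adjugate (u : Matrix (Fin 2) (Fin 2) ℂ)
  rw [h2, one_smul] at h4
  calc star (u : Matrix (Fin 2) (Fin 2) ℂ)
      = star (u : Matrix (Fin 2) (Fin 2) ℂ) * (u * (u : Matrix (Fin 2) (Fin 2) ℂ).adjugate) := by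
        rw [h4, mul_one]
    _ = _ := by rw [← mul_assoc, h3, one_mul]

theorem apply_one_one (u : SU2) : u.1 1 1 = star (u.1 0 0) := by
  have h := congrFun (congrFun (star_eq_adjugate u) 0) 0
  rw [Matrix.adjugate_fin_two] at h
  simpa [Matrix.star_apply] using h.symm

theorem apply_one_zero (u : SU2) : u.1 1 0 = -star (u.1 0 1) := by
  have h := congrFun (congrFun (star_eq_adjugate u) 1) 0
  rw [Matrix.adjugate_fin_two] at h
  simpa [Matrix.star_apply, eq_neg_iff_add_eq_zero, add_comm] using congrArg Neg.neg h.symm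

theorem det_eq_one (u : SU2) : u.1.det = 1 := (Matrix.mem_specialUnitaryGroup_iff.1 u.2).2

theorem norm_sq_add (u : SU2) : ‖u.1 0 0‖ ^ 2 + ‖u.1 0 1‖ ^ 2 = 1 := by
  have h := det_eq_one u
  rw [Matrix.det_fin_two, apply_one_one, apply_one_zero, mul_neg, sub_neg_eq_add] at h
  have h2 : ∀ a : ℂ, a * star a = ((‖a‖ ^ 2 : ℝ) : ℂ) := fun a => by
    rw [Complex.star_def, Complex.mul_conj']
    push_cast
    rfl
  rw [h2, h2] at h
  exact_mod_cast h

/-- Half the trace. -/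
def halfTrace (u : SU2) : ℝ := (u.1 0 0).re

theorem continuous_entry (i j : Fin 2) : Continuous fun u : SU2 => u.1 i j :=
  (continuous_apply_apply i j : Continuous fun M : Fin 2 → Fin 2 → ℂ => M i j).comp
    continuous_subtype_val

theorem continuous_halfTrace : Continuous halfTrace :=
  Complex.continuous_re.comp (continuous_entry 0 0)

theorem trace_eq (u : SU2) : u.1.trace = ((2 * halfTrace u : ℝ) : ℂ) := by
  rw [Matrix.trace_fin_two, apply_one_one, Complex.star_def, Complex.add_conj, halfTrace]

theorem abs_halfTrace_le (u : SU2) : |halfTrace u| ≤ 1 := by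
  refine (Complex.abs_re_le_norm _).trans ?_
  nlinarith [norm_sq_add u, sq_nonneg ‖u.1 0 1‖, norm_nonneg (u.1 0 0)]

theorem eq_one_of_halfTrace_eq_one {u : SU2} (h : halfTrace u = 1) : u = 1 := by
  have h1 := norm_sq_add u
  have h2 : ‖u.1 0 0‖ ^ 2 = 1 + (u.1 0 0).im ^ 2 := by
    rw [Complex.sq_norm, Complex.normSq_apply, ← halfTrace, h]
    ring
  have h3 : (u.1 0 0).im = 0 := by nlinarith [sq_nonneg (u.1 0 0).im, sq_nonneg ‖u.1 0 1‖]
  have h4 : u.1 0 1 = 0 := by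
    rw [← norm_eq_zero]
    nlinarith [sq_nonneg (u.1 0 0).im, sq_nonneg ‖u.1 0 1‖]
  have h5 : u.1 0 0 = 1 := Complex.ext h h3
  refine Subtype.ext ?_
  ext i j
  fin_cases i <;> fin_cases j <;> simp [apply_one_one, apply_one_zero, h4, h5]

theorem halfTrace_lt_one {u : SU2} (h : u ≠ 1) : halfTrace u < 1 :=
  lt_of_le_of_ne (abs_le.1 (abs_halfTrace_le u)).2 fun h1 => h (eq_one_of_halfTrace_eq_one h1)

theorem re_quadForm (u : SU2) (z : Spinor) :
    (quadForm u.1 z).re = halfTrace u * sqNorm z := by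
  rw [quadForm_apply, apply_one_one, apply_one_zero, halfTrace, sqNorm, Complex.sq_norm,
    Complex.sq_norm, Complex.normSq_apply, Complex.normSq_apply]
  simp only [Complex.star_def, Complex.add_re, Complex.mul_re, Complex.mul_im, Complex.add_im,
    Complex.neg_re, Complex.neg_im, Complex.conj_re, Complex.conj_im]
  ring

/-- The special unitary matrix with the given first row. -/
def ofRow (a b : ℂ) (h : a * star a + b * star b = 1) : SU2 :=
  ⟨!![a, b; -star b, star a], by
    have h' : star a * a + star b * b = 1 := by rw [← h]; ring
    have h'' : a * star b = star b * a := mul_comm _ _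
    rw [Matrix.mem_specialUnitaryGroup_iff, Matrix.mem_unitaryGroup_iff, Matrix.det_fin_two]
    refine ⟨?_, ?_⟩
    · ext i j
      fin_cases i <;> fin_cases j <;>
        simp [Matrix.mul_apply, Fin.sum_univ_two, Matrix.star_apply] <;>
        first
          | exact h
          | (simp only [Complex.star_def] at h; linear_combination h)
          | ring
    · simp only [Matrix.of_apply, Matrix.cons_val', Matrix.cons_val_zero, Matrix.cons_val_one,
        Matrix.cons_val_fin_one]
      linear_combination h⟩

/-- Every nonzero spinor is an eigenvector, to any unimodular eigenvalue, of some group element. -/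
theorem exists_quadForm_mul (z : Spinor) {e : ℂ} (he : ‖e‖ = 1) :
    ∃ h : SU2, ∀ u : SU2, quadForm (h * u).1 z = e * quadForm u.1 z := by
  by_cases hz : sqNorm z = 0
  · have h0 : z = 0 := norm_eq_zero.1 (by
      nlinarith [norm_sq_le_sqNorm z, norm_nonneg z])
    exact ⟨1, fun u => by simp [h0, quadForm_apply]⟩
  · have hN : (sqNorm z : ℂ) ≠ 0 := by exact_mod_cast hz
    have hN' : (sqNorm z : ℂ) = star (z 0) * z 0 + star (z 1) * z 1 := by
      rw [← braket_self, braket]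
    have he' : e * star e = 1 := by
      rw [Complex.star_def, Complex.mul_conj', he]; simp
    have hsN : star (sqNorm z : ℂ) = sqNorm z := by simp
    have hrow : (e * (star (z 0) * z 0) + star e * (star (z 1) * z 1)) / sqNorm z *
        star ((e * (star (z 0) * z 0) + star e * (star (z 1) * z 1)) / sqNorm z) +
        (e - star e) * (z 0 * star (z 1)) / sqNorm z *
        star ((e - star e) * (z 0 * star (z 1)) / sqNorm z) = 1 := by
      simp only [star_div₀, hsN, star_add, star_sub, star_mul', star_star]
      field_simp
      rw [hN']
      linear_combination (star (z 0) * z 0 + star (z 1) * z 1) ^ 2 * he'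
    refine ⟨ofRow _ _ hrow, fun u => ?_⟩
    simp only [quadForm_apply, Submonoid.coe_mul, Matrix.mul_apply, Fin.sum_univ_two, ofRow,
      Matrix.of_apply, Matrix.cons_val', Matrix.cons_val_zero, Matrix.cons_val_one,
      Matrix.cons_val_fin_one, star_div₀, hsN, star_add, star_sub, star_mul', star_star]
    field_simp
    rw [hN']
    ring

end SU2

instance : IsProbabilityMeasure haarSU2 := by
  refine ⟨?_⟩
  have := Measure.haarMeasure_self (K₀ := (⊤ : TopologicalSpace.PositiveCompacts SU2))
  simpa [haarSU2] using this

instance : haarSU2.IsMulLeftInvariant := by unfold haarSU2; infer_instance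

/-- The closed form of `∫ (⟨z|z⟩ - 1) e^{r⟨z|u|z⟩} dμ(z)`. -/
noncomputable def deltaKernel (r : ℝ) (u : SU2) : ℝ :=
  (1 - r ^ 2) / (1 - 2 * r * SU2.halfTrace u + r ^ 2) ^ 2

theorem deltaIntegrand_eq (r : ℝ) (u : SU2) (z : Spinor) :
    deltaIntegrand r u z = ((sqNorm z : ℂ) - 1) * Complex.exp (r * quadForm u.1 z) := by
  rw [deltaIntegrand, braket_self]
  rfl

theorem continuous_quadForm_group :
    Continuous fun q : SU2 × Spinor => quadForm q.1.1 q.2 := by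
  have h : ∀ i j, Continuous fun q : SU2 × Spinor => q.1.1 i j := fun i j =>
    (SU2.continuous_entry i j).comp continuous_fst
  have hz : ∀ j, Continuous fun q : SU2 × Spinor => q.2 j := fun j =>
    (continuous_apply j).comp continuous_snd
  simp only [quadForm_apply]
  exact ((hz 0).star.mul (((h 0 0).mul (hz 0)).add ((h 0 1).mul (hz 1)))).add
    ((hz 1).star.mul (((h 1 0).mul (hz 0)).add ((h 1 1).mul (hz 1))))

theorem norm_deltaIntegrand_le {r c : ℝ} {u : SU2} (hc : r * SU2.halfTrace u ≤ c) (hc1 : c < 1)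
    (z : Spinor) :
    ‖deltaIntegrand r u z‖ ≤ (1 + 2 / (1 - c)) * Real.exp ((1 + c) / 2 * sqNorm z) := by
  have hz := sqNorm_nonneg z
  have hd : 0 < 1 - c := by linarith
  rw [deltaIntegrand_eq, norm_mul, Complex.norm_exp, Complex.re_ofReal_mul, SU2.re_quadForm]
  have h1 : ‖(sqNorm z : ℂ) - 1‖ ≤ sqNorm z + 1 := by
    refine (norm_sub_le _ _).trans ?_
    rw [Complex.norm_real, Real.norm_of_nonneg hz, norm_one]
  have h2 : sqNorm z + 1 ≤ (1 + 2 / (1 - c)) * Real.exp ((1 - c) / 2 * sqNorm z) := by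
    have h4 : sqNorm z + 1 ≤ (1 + 2 / (1 - c)) * ((1 - c) / 2 * sqNorm z + 1) := by
      have h5 : (1 + 2 / (1 - c)) * ((1 - c) / 2 * sqNorm z + 1) =
          sqNorm z + 1 + ((1 - c) / 2 * sqNorm z + 2 / (1 - c)) := by
        field_simp
        ring
      rw [h5]
      have : 0 ≤ (1 - c) / 2 * sqNorm z + 2 / (1 - c) := by positivity
      linarith
    refine h4.trans ?_
    gcongr
    exact Real.add_one_le_exp _
  have h3 : Real.exp (r * (SU2.halfTrace u * sqNorm z)) ≤ Real.exp (c * sqNorm z) := by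
    rw [← mul_assoc]
    gcongr
  calc ‖(sqNorm z : ℂ) - 1‖ * Real.exp (r * (SU2.halfTrace u * sqNorm z))
      ≤ ((1 + 2 / (1 - c)) * Real.exp ((1 - c) / 2 * sqNorm z)) * Real.exp (c * sqNorm z) := by
        gcongr
        exact h1.trans h2
    _ = _ := by
        rw [mul_assoc, ← Real.exp_add]
        ring_nf

theorem integrable_deltaIntegrand {r : ℝ} {u : SU2} (h : r * SU2.halfTrace u < 1) :
    Integrable (deltaIntegrand r u) spinorMeasure := by
  refine ((integrable_spinorMeasure_exp (c := (1 + r * SU2.halfTrace u) / 2)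
    (by linarith)).const_mul _).mono' ?_ (ae_of_all _ fun z => norm_deltaIntegrand_le le_rfl h z)
  have h1 := continuous_quadForm u.1
  have h2 := continuous_sqNorm
  simp only [show deltaIntegrand r u = fun z => deltaIntegrand r u z from rfl, deltaIntegrand_eq]
  fun_prop

theorem one_sub_add_pos {r : ℝ} {u : SU2} (h : r * SU2.halfTrace u < 1) :
    0 < 1 - 2 * r * SU2.halfTrace u + r ^ 2 := by
  have h1 := SU2.abs_halfTrace_le u
  have h2 : SU2.halfTrace u ^ 2 ≤ 1 := (sq_le_one_iff_abs_le_one _).2 h1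
  nlinarith [mul_le_mul_of_nonneg_left h2 (sq_nonneg r), pow_pos (sub_pos.2 h) 2]

/-- The Gaussian integral `1 / (s² - 2 s r a + r²)` with weight `e^{-s⟨z|z⟩}` is differentiated with
respect to `s` at `s = 1`. -/
theorem integral_deltaIntegrand {r : ℝ} {u : SU2} (h : r * SU2.halfTrace u < 1) :
    ∫ z, deltaIntegrand r u z ∂spinorMeasure = (deltaKernel r u : ℂ) := by
  have hre : ∀ z, (quadForm ((r : ℂ) • u.1) z).re = r * SU2.halfTrace u * sqNorm z := fun z => by
    rw [quadForm_smul, Complex.re_ofReal_mul, SU2.re_quadForm]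
    ring
  have hcont := continuous_quadForm ((r : ℂ) • u.1)
  have hsq := continuous_sqNorm
  have hexp : Integrable (fun z => Complex.exp (quadForm ((r : ℂ) • u.1) z)) spinorMeasure := by
    refine (integrable_spinorMeasure_exp h).mono' (by fun_prop) (ae_of_all _ fun z => ?_)
    rw [Complex.norm_exp, hre]
  have hD := one_sub_add_pos h
  have hder := hasDerivAt_integral_exp (μ := spinorMeasure)
    (H := fun z => Complex.exp (quadForm ((r : ℂ) • u.1) z)) (q := sqNorm)
    (δ := (1 - r * SU2.halfTrace u) / 2) (by fun_prop) hsq.measurable sqNorm_nonneg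
    (by linarith) (by
      refine (integrable_spinorMeasure_exp (c := (1 + r * SU2.halfTrace u) / 2)
        (by linarith)).congr (ae_of_all _ fun z => ?_)
      beta_reduce
      rw [Complex.norm_exp, hre, ← Real.exp_add]
      ring_nf)
  have hval : ∀ s : ℝ, r * SU2.halfTrace u < s →
      ∫ z, Complex.exp (quadForm ((r : ℂ) • u.1) z) * Real.exp (-(s - 1) * sqNorm z)
        ∂spinorMeasure = (((s ^ 2 - s * (2 * r * SU2.halfTrace u) + r ^ 2)⁻¹ : ℝ) : ℂ) :=
    fun s hs => by
      rw [integral_exp_quadForm hs fun z => (hre z).le, Matrix.trace_smul, Matrix.det_smul,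
        SU2.trace_eq, SU2.det_eq_one]
      rw [Fintype.card_fin, smul_eq_mul, one_div]
      push_cast
      congr 1
      ring
  have hder2 : HasDerivAt (fun s : ℝ => (((s ^ 2 - s * (2 * r * SU2.halfTrace u) + r ^ 2)⁻¹ : ℝ)
      : ℂ)) (((-(2 - 2 * r * SU2.halfTrace u) /
        (1 - 2 * r * SU2.halfTrace u + r ^ 2) ^ 2 : ℝ)) : ℂ) 1 := by
    have hp : HasDerivAt (fun s : ℝ => s ^ 2 - s * (2 * r * SU2.halfTrace u) + r ^ 2)
        (2 - 2 * r * SU2.halfTrace u) 1 := by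
      have := (((hasDerivAt_id (1 : ℝ)).pow 2).sub
        ((hasDerivAt_id (1 : ℝ)).mul_const (2 * r * SU2.halfTrace u))).add_const (r ^ 2)
      refine this.congr_deriv ?_
      norm_num
    have := (hp.fun_inv (by
      rw [one_pow, one_mul]
      exact hD.ne')).ofReal_comp
    simpa using this
  have heq : -∫ z, sqNorm z * Complex.exp (quadForm ((r : ℂ) • u.1) z) ∂spinorMeasure =
      (((-(2 - 2 * r * SU2.halfTrace u) /
        (1 - 2 * r * SU2.halfTrace u + r ^ 2) ^ 2 : ℝ)) : ℂ) :=
    hder.unique (hder2.congr_of_eventuallyEq (by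
      filter_upwards [lt_mem_nhds h] with s hs using hval s hs))
  have hone := hval 1 h
  simp only [sub_self, neg_zero, zero_mul, Real.exp_zero, Complex.ofReal_one, mul_one] at hone
  have hq : Integrable (fun z => (sqNorm z : ℂ) * Complex.exp (quadForm ((r : ℂ) • u.1) z))
      spinorMeasure := by
    refine ((integrable_deltaIntegrand h).add hexp).congr (ae_of_all _ fun z => ?_)
    simp only [Pi.add_apply, deltaIntegrand_eq, quadForm_smul]
    ring
  have hsplit : ∀ z, deltaIntegrand r u z =
      sqNorm z * Complex.exp (quadForm ((r : ℂ) • u.1) z) -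
        Complex.exp (quadForm ((r : ℂ) • u.1) z) := fun z => by
    rw [deltaIntegrand_eq, quadForm_smul]
    ring
  simp_rw [hsplit]
  rw [integral_sub hq hexp, hone, neg_eq_iff_eq_neg.1 heq, ← Complex.ofReal_neg,
    ← Complex.ofReal_sub, deltaKernel]
  congr 1
  field_simp
  ring

/-- A rotation of the exponent by a phase can be absorbed into the group element, so the average
over the group is the value of the exponential at zero. -/
theorem integral_haar_cexp_quadForm (r : ℝ) (z : Spinor) :
    ∫ u : SU2, Complex.exp (r * quadForm u.1 z) ∂haarSU2 = 1 := by
  have hq : Continuous fun u : SU2 => quadForm u.1 z :=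
    continuous_quadForm_group.comp (continuous_id.prodMk continuous_const)
  have h := integral_eq_of_rotation (μ := haarSU2)
    (fun ζ (u : SU2) => Complex.exp (ζ * (r * quadForm u.1 z))) (fun u => by fun_prop) ?_
    fun θ => ?_
  · simpa using h
  · have hc : Continuous fun p : ℝ × SU2 =>
        Complex.exp (circleMap 0 1 p.1 * (r * quadForm p.2.1 z)) := by
      have := (continuous_circleMap 0 1).comp (continuous_fst (X := ℝ) (Y := SU2))
      have := hq.comp (continuous_snd (X := ℝ) (Y := SU2))
      fun_prop
    have hfin : IsFiniteMeasure (volume.restrict (Set.uIoc 0 (2 * Real.pi))) := by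
      rw [Set.uIoc_of_le (by positivity)]
      infer_instance
    obtain ⟨C, hC⟩ := isCompact_univ.exists_bound_of_continuousOn hq.continuousOn
    refine Integrable.of_bound hc.aestronglyMeasurable (Real.exp (|r| * C))
      (ae_of_all _ fun p => (Complex.norm_exp_le_exp_norm _).trans (Real.exp_le_exp.2 ?_))
    rw [norm_mul, norm_mul, norm_circleMap_zero, abs_one, one_mul, Complex.norm_real,
      Real.norm_eq_abs]
    gcongr
    exact hC p.2 trivial
  · obtain ⟨h, hh⟩ := SU2.exists_quadForm_mul z (e := circleMap 0 1 θ) (by simp)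
    rw [← integral_mul_left_eq_self (fun u : SU2 => Complex.exp (1 * (r * quadForm u.1 z))) h]
    refine integral_congr_ae (ae_of_all _ fun u => ?_)
    beta_reduce
    rw [hh]
    ring_nf

theorem continuous_deltaIntegrand (r : ℝ) :
    Continuous fun q : SU2 × Spinor => deltaIntegrand r q.1 q.2 := by
  have h1 := continuous_quadForm_group
  have h2 := continuous_sqNorm.comp (continuous_snd (X := SU2) (Y := Spinor))
  simp only [deltaIntegrand_eq]
  fun_prop

/-- The exponential averages to one over the group, so the total mass is `∫ (⟨z|z⟩ - 1) dμ = 2 - 1`. -/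
theorem integral_deltaKernel {r : ℝ} (h0 : 0 ≤ r) (h1 : r < 1) :
    ∫ u, deltaKernel r u ∂haarSU2 = 1 := by
  have hr : ∀ u, r * SU2.halfTrace u ≤ r := fun u => by
    have := (abs_le.1 (SU2.abs_halfTrace_le u)).2
    nlinarith
  have hi : Integrable (fun q : SU2 × Spinor => deltaIntegrand r q.1 q.2)
      (haarSU2.prod spinorMeasure) :=
    ((integrable_spinorMeasure_exp (c := (1 + r) / 2) (by linarith)).const_mul
      (1 + 2 / (1 - r))).comp_snd haarSU2 |>.mono' (continuous_deltaIntegrand r).aestronglyMeasurable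
      (ae_of_all _ fun q => norm_deltaIntegrand_le (hr q.1) h1 q.2)
  have hsq : ∫ z, (sqNorm z : ℂ) ∂spinorMeasure = 2 := by
    have := integral_sqNorm_pow 1
    simpa using this
  have h2 := slowGrowth_sqNorm.integrable gaussianTail_spinor
  rw [← Complex.ofReal_inj, ← integral_complex_ofReal]
  simp_rw [← fun u => integral_deltaIntegrand ((hr u).trans_lt h1)]
  rw [integral_integral_swap hi]
  simp_rw [deltaIntegrand_eq, integral_const_mul, integral_haar_cexp_quadForm, mul_one]
  rw [integral_sub h2 (integrable_const _), hsq]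
  simp
  norm_num

theorem tendsto_integral_deltaIntegrand {f : SU2 → ℂ} (hf : Continuous f) :
    Tendsto (fun r : ℝ => ∫ u, f u * ∫ z, deltaIntegrand r u z ∂spinorMeasure ∂haarSU2)
      (𝓝[<] 1) (𝓝 (f 1)) := by
  have hht := SU2.continuous_halfTrace
  have hev : ∀ᶠ r : ℝ in 𝓝[<] 1, 1 / 2 < r ∧ r < 1 := Ioo_mem_nhdsLT (by norm_num)
  have hlt : ∀ {r : ℝ}, 1 / 2 < r → r < 1 → ∀ u, r * SU2.halfTrace u < 1 := fun h1 h2 u => by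
    have := (abs_le.1 (SU2.abs_halfTrace_le u)).2
    nlinarith
  have hpeak := tendsto_setIntegral_peak_smul_of_integrableOn_of_tendsto (μ := haarSU2)
    (φ := deltaKernel) (l := 𝓝[<] 1) (x₀ := 1) (g := f) (a := f 1) (s := Set.univ)
    (t := Set.univ) MeasurableSet.univ MeasurableSet.univ subset_rfl Filter.univ_mem (by simp)
    ?_ ?_ ?_ ?_ ?_ ?_
  · refine hpeak.congr' ?_
    filter_upwards [hev] with r hr
    rw [setIntegral_univ]
    refine integral_congr_ae (ae_of_all _ fun u => ?_)
    beta_reduce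
    rw [integral_deltaIntegrand (hlt hr.1 hr.2 u), Complex.real_smul, mul_comm]
  · filter_upwards [hev] with r hr u _
    unfold deltaKernel
    have : 0 ≤ 1 - r ^ 2 := by nlinarith [hr.1, hr.2]
    positivity
  · intro V hV h1V
    -- away from the identity the trace is bounded away from its maximum
    obtain ⟨m, hm1, hm⟩ : ∃ m < 1, ∀ u ∈ Set.univ \ V, SU2.halfTrace u ≤ m := by
      have hK : IsCompact (Set.univ \ V) := (isClosed_univ.sdiff hV).isCompact
      rcases (Set.univ \ V).eq_empty_or_nonempty with he | hne
      · exact ⟨0, one_pos, by simp [he]⟩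
      · obtain ⟨u₀, hu₀, hmax⟩ := hK.exists_isMaxOn hne hht.continuousOn
        exact ⟨_, SU2.halfTrace_lt_one fun h => hu₀.2 (by rwa [h]), fun u hu => hmax hu⟩
    have hlim : Tendsto (fun r : ℝ => (1 - r ^ 2) / (1 - m) ^ 2) (𝓝[<] 1) (𝓝 0) := by
      have : Continuous fun r : ℝ => (1 - r ^ 2) / (1 - m) ^ 2 := by fun_prop
      have h := (this.tendsto 1).mono_left (nhdsWithin_le_nhds (s := Set.Iio 1))
      simpa using h
    rw [Metric.tendstoUniformlyOn_iff]
    intro ε hε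
    filter_upwards [hev, hlim.eventually_lt_const hε] with r hr hrε u hu
    have h2 : 0 ≤ 1 - r ^ 2 := by nlinarith [hr.1, hr.2]
    have h3 : 1 - m ≤ 1 - 2 * r * SU2.halfTrace u + r ^ 2 := by
      nlinarith [hm u hu, hr.1, hr.2, sq_nonneg (1 - r)]
    have h4 : 0 < 1 - m := by linarith
    rw [Pi.zero_apply, dist_zero_left, deltaKernel, Real.norm_of_nonneg (by positivity)]
    refine lt_of_le_of_lt ?_ hrε
    gcongr
  · refine tendsto_const_nhds.congr' ?_
    filter_upwards [hev] with r hr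
    rw [setIntegral_univ, integral_deltaKernel (by linarith [hr.1]) hr.2]
  · filter_upwards [hev] with r hr
    refine Continuous.aestronglyMeasurable ?_
    unfold deltaKernel
    refine Continuous.div (by fun_prop) (by fun_prop) fun u => ?_
    exact pow_ne_zero _ (one_sub_add_pos (hlt hr.1 hr.2 u)).ne'
  · exact (hf.integrable_of_hasCompactSupport (HasCompactSupport.of_compactSpace f)).integrableOn
  · exact hf.continuousAt.mono_left nhdsWithin_le_nhds

end SpinNet

open SpinNet in
theorem proposition4 {T : Type*} [Fintype T] [DecidableEq T] (Γ : CellBoundary T)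
    (g : TypeII Γ) :
    (∀ᶠ z in 𝓝 (0 : T → Fin 3 → Spinor),
      Integrable (stateIntegrand Γ z) (auxMeasure T) ∧
      HasSum (fun k : T → ℕ => component Γ k z) (state Γ z)) ∧
    (∀ (k : T → ℕ) (z : g.Rest → Fin 3 → Spinor),
      Integrable (g.gluingIntegrand k z) (triangleMeasure.prod triangleMeasure)) ∧
    (∀ᶠ z in 𝓝 (0 : g.Rest → Fin 3 → Spinor),
      Integrable (stateIntegrand g.glue z) (auxMeasure g.Rest) ∧
      HasSum
        (fun k : T → ℕ => ∫ p, g.gluingIntegrand k z p ∂triangleMeasure.prod triangleMeasure)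
        (state g.glue z)) ∧
    (∀ u : SU2, u ≠ 1 →
      Integrable (deltaIntegrand 1 u) spinorMeasure ∧
      ∫ z, deltaIntegrand 1 u z ∂spinorMeasure = 0) ∧
    (∀ f : SU2 → ℂ, Continuous f →
      Tendsto
        (fun r : ℝ => ∫ u, f u * ∫ z, deltaIntegrand r u z ∂spinorMeasure ∂haarSU2)
        (𝓝[<] 1) (𝓝 (f 1))) := by
  refine ⟨eventually_hasSum_state Γ, g.integrable_gluingIntegrand, ?_, fun u hu => ?_,
    fun f hf => tendsto_integral_deltaIntegrand hf⟩
  · filter_upwards [eventually_hasSum_state g.glue, g.eventually_hasSum_gluing] with z h1 h2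
    exact ⟨h1.1, h2⟩
  · have h : 1 * SU2.halfTrace u < 1 := by rw [one_mul]; exact SU2.halfTrace_lt_one hu
    refine ⟨integrable_deltaIntegrand h, ?_⟩
    rw [integral_deltaIntegrand h, deltaKernel]
    simp
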